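/- Let $X$ be a complex Banach space and let $(T(t))_{t\in\mathbb R}$ be a $C_0$-group on $X$ with generator $A$ such that, for some constant $M$ and some $a\in[0,2]$, $\|T(t)\|\le M(1+|t|^a)$ for all $t\in\mathbb R$. For $\lambda$ in the resolvent set $\rho(A)$ (which contains $\mathbb C\setminus i\mathbb R$) let $R(\lambda,A)=(\lambda-A)^{-1}$, and for $\alpha>0$, $\beta\in\mathbb R$ put $$D(\alpha+i\beta)=R(\alpha+i\beta,A)-R(-\alpha+i\beta,A).$$ For $x\in X$ let the local spectrum $\sigma(x)\subset\mathbb C$ be the complement of the set of all $\lambda\in\mathbb C$ such that the local resolvent $\mu\mapsto R(\mu,A)x$ extends analytically to a neighbourhood of $\lambda$, and for $F\subset\mathbb R$ let $X(F)=\{x\in X:\sigma(x)\subset iF\}$. Then for every closed set $F\subset\mathbb R$ $$X(F)=\Bigl\{x\in X:\ \lim_{\alpha\to0+}D(\alpha+i\beta)x=0\ \text{ for every }\beta\in\mathbb R\setminus F\Bigr\},$$ the limit being taken in the norm of $X$. If, moreover, $X$ is reflexive, the point spectrum $\sigma_p(A)$ is empty and $a\in[0,2)$, then for every closed set $F\subset\mathbb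 R$ $$X(F)=\Bigl\{x\in X:\ \sup_{\alpha>0}\|D(\alpha+i\beta)x\|<\infty\ \text{ for every }\beta\in\mathbb R\setminus F\Bigr\}.$$ -/

import Mathlib

open Filter Topology

/-- A `C₀`-group of bounded linear operators on a complex normed space `X`. -/
structure C0Group (X : Type*) [NormedAddCommGroup X] [NormedSpace ℂ X] where
  /-- the operators `T(t)`, `t ∈ ℝ` -/
  T : ℝ → X →L[ℂ] X
  map_zero : T 0 = ContinuousLinearMap.id ℂ X
  map_add : ∀ s t : ℝ, T (s + t) = (T s).comp (T t)
  strongly_continuous : ∀ x : X, Continuous fun t : ℝ => T t x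

namespace C0Group

variable {X : Type*} [NormedAddCommGroup X] [NormedSpace ℂ X]

/-- `y` is the derivative at `t = 0` of the orbit `t ↦ T(t) x`. -/
def IsGeneratorValue (S : C0Group X) (x y : X) : Prop :=
  Tendsto (fun t : ℝ => ((t : ℂ)⁻¹) • (S.T t x - x)) (𝓝[≠] 0) (𝓝 y)

theorem IsGeneratorValue.add {S : C0Group X} {x x' y y' : X}
    (h : S.IsGeneratorValue x y) (h' : S.IsGeneratorValue x' y') :
    S.IsGeneratorValue (x + x') (y + y') := by
  refine (Tendsto.add h h').congr fun t => ?_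
  rw [_root_.map_add, ← smul_add]
  congr 1
  abel

theorem IsGeneratorValue.smul {S : C0Group X} {x y : X} (c : ℂ)
    (h : S.IsGeneratorValue x y) : S.IsGeneratorValue (c • x) (c • y) := by
  refine (Tendsto.const_smul h c).congr fun t => ?_
  rw [_root_.map_smul, ← smul_sub, smul_comm]

theorem IsGeneratorValue.unique {S : C0Group X} {x y y' : X}
    (h : S.IsGeneratorValue x y) (h' : S.IsGeneratorValue x y') : y = y' :=
  tendsto_nhds_unique h h'

theorem IsGeneratorValue.zero (S : C0Group X) : S.IsGeneratorValue 0 0 := by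
  simp [IsGeneratorValue]

/-- The generator `A` of the group: its domain consists of all `x` for which
`A x = lim_{t → 0} (T(t) x - x) / t` exists in norm. -/
noncomputable def generator (S : C0Group X) : X →ₗ.[ℂ] X where
  domain :=
    { carrier := {x | ∃ y, S.IsGeneratorValue x y}
      add_mem' := fun ⟨y, hy⟩ ⟨y', hy'⟩ => ⟨y + y', hy.add hy'⟩
      zero_mem' := ⟨0, IsGeneratorValue.zero S⟩
      smul_mem' := fun c _ ⟨y, hy⟩ => ⟨c • y, hy.smul c⟩ }
  toFun :=
    { toFun := fun x => Classical.choose x.2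
      map_add' := fun x x' => (Classical.choose_spec (x + x').2).unique
        ((Classical.choose_spec x.2).add (Classical.choose_spec x'.2))
      map_smul' := fun c x => (Classical.choose_spec (c • x).2).unique
        ((Classical.choose_spec x.2).smul c) }

end C0Group

section Operators

variable {X : Type*} [NormedAddCommGroup X] [NormedSpace ℂ X]

/-- The bounded operator `R` is a two-sided inverse of `z - A : D(A) → X`. -/
def IsResolventAt (A : X →ₗ.[ℂ] X) (z : ℂ) (R : X →L[ℂ] X) : Prop :=
  (∀ x : X, ∃ h : R x ∈ A.domain, z • R x - A ⟨R x, h⟩ = x) ∧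
    ∀ y : A.domain, R (z • (y : X) - A y) = y

/-- The resolvent set `ρ(A)` of an (in general unbounded) operator `A`. -/
def opResolventSet (A : X →ₗ.[ℂ] X) : Set ℂ := {z | ∃ R : X →L[ℂ] X, IsResolventAt A z R}

open Classical in
/-- The resolvent `R(z, A) = (z - A)⁻¹`, for `z ∈ ρ(A)` (and `0` by convention elsewhere). -/
noncomputable def opResolvent (A : X →ₗ.[ℂ] X) (z : ℂ) : X →L[ℂ] X :=
  if h : ∃ R : X →L[ℂ] X, IsResolventAt A z R then h.choose else 0

/-- The point spectrum `σ_p(A)`: the set of eigenvalues of `A`. -/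
def opPointSpectrum (A : X →ₗ.[ℂ] X) : Set ℂ :=
  {z | ∃ x : A.domain, (x : X) ≠ 0 ∧ A x = z • (x : X)}

/-- The local spectrum `σ(x)` of `x` with respect to `A`: the complement of the set of those
`z ∈ ℂ` near which the local resolvent `w ↦ R(w, A) x` is analytic, that is, agrees on `ρ(A)`
with a function analytic in a full neighbourhood of `z`. -/
def localSpectrum (A : X →ₗ.[ℂ] X) (x : X) : Set ℂ :=
  {z | ∃ U : Set ℂ, IsOpen U ∧ z ∈ U ∧ ∃ g : ℂ → X, AnalyticOnNhd ℂ g U ∧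
    ∀ w ∈ U ∩ opResolventSet A, g w = opResolvent A w x}ᶜ

/-- The spectral subspace `X(F) = {x ∈ X : σ(x) ⊆ iF}` of `A`. -/
def spectralSubspace (A : X →ₗ.[ℂ] X) (F : Set ℝ) : Set X :=
  {x | localSpectrum A x ⊆ (fun β : ℝ => Complex.I * (β : ℂ)) '' F}

/-- `D(α + iβ) = R(α + iβ, A) - R(-α + iβ, A)`. -/
noncomputable def resolventJump (A : X →ₗ.[ℂ] X) (α β : ℝ) : X →L[ℂ] X :=
  opResolvent A ((α : ℂ) + Complex.I * (β : ℂ)) - opResolvent A (-(α : ℂ) + Complex.I * (β : ℂ))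

/-- `X` is reflexive: the canonical embedding of `X` into its bidual is onto. -/
def IsReflexiveSpace (X : Type*) [NormedAddCommGroup X] [NormedSpace ℂ X] : Prop :=
  Function.Surjective (NormedSpace.inclusionInDoubleDual ℂ X)

end Operators

/-!
Let `D(z) = R(z, A) - R(-conj z, A)`, so that `D(α + iβ)` is the jump of the resolvent between
mirror images in the imaginary axis. If `iβ` is not in the local spectrum of `x`, then `R(·, A) x`
extends continuously to `iβ`, hence `D(α + iβ) x → 0`; away from the axis the resolvent, a Laplace
transform of the group, is bounded. This gives both inclusions from left to right.

For the converse inclusions, suppose that the boundary condition on `D(α + iβ) x` holds off `F` but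
that the set `K` of singularities of the local resolvent meets an interval disjoint from `F`. The
growth of the group yields `‖R(z, A)‖ = O(|Re z|⁻³)` near the axis.

* By Baire's theorem (`exists_uniform_portion`), `‖D(α + iβ) x‖` is bounded uniformly for `β` in
  some portion of `K`.
* In a gap `(p, q)` of this portion, `D(z) x` is harmonic on the closed rectangle `[-1, 1] × [p, q]`
  except at the corners `ip`, `iq`, and bounded on its boundary. At a corner, a Poisson formula for
  the quadrant shows that `D(z) x` is a multiple of the harmonic function `Im (ζ⁻²)`, `ζ` being a
  coordinate at the corner, up to a bounded function (`IsCornerFunction.exists_expansion`).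
* The coefficient `c` vanishes (`HasResolventGrowth.hasNoDoublePole`). By the resolvent identity it
  satisfies `2 c = α D(α + ip) c` for all `α > 0`. Since `c` is the limit of `η² D(z) x` as `z`
  tends to `ip` along a diagonal with `Re z = η`, and `η³ D(z)` is bounded, this forces `c = 0` when
  `D(Nη + ip) x → 0`, and also when `D(Nη + ip) x` is bounded and `η³ D(z) → 0` in norm (`a < 2`).
* Hence the maximum principle (`norm_mirrorJump_le_of_gap`) bounds `D(z) x` in the gaps by a
  constant not depending on the gap, and `D(z) x` is bounded near a point of `K`.
* Finally, Cauchy's formulas on the two sides of the axis, with a polynomial factor that removes the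
  growth at the ends of the interval, add up to a formula in which the axis contributes only an
  integral of `D(z) x`. Its limit vanishes weakly by dominated convergence, and so the local
  resolvent extends across this point of `K` (`HasCubicGrowthOffAxis.exists_extension`),
  a contradiction.

The last step needs that `D(α + iβ) x` tends to `0` weakly. In the reflexive case this follows from
boundedness: a weak limit `c` satisfies `(1 - R(μ, A)) (1 + R(-conj μ, A)) c = 0` for `μ = 1 + iβ`,
and vanishes because `A` has no eigenvalues (`HasResolventGrowth.tendsto_weakly_zero`).
-/

/-! ### Cauchy's formula for rectangles -/

section RectangleIntegral

open Complex

variable {E : Type*} [NormedAddCommGroup E] [NormedSpace ℂ E]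

/-- The counterclockwise integral of `f` over the boundary of the rectangle `[a, b] × [c, d]`. -/
noncomputable def rectIntegral (f : ℂ → E) (a b c d : ℝ) : E :=
  (∫ x : ℝ in a..b, f (x + c * I)) - (∫ x : ℝ in a..b, f (x + d * I)) +
    I • (∫ y : ℝ in c..d, f (b + y * I)) - I • (∫ y : ℝ in c..d, f (a + y * I))

theorem rectIntegral_eq_zero {f : ℂ → E} {a b c d : ℝ} (hab : a ≤ b) (hcd : c ≤ d)
    {s : Set ℂ} (hs : s.Countable)
    (hc : ∀ z : ℂ, a ≤ z.re → z.re ≤ b → c ≤ z.im → z.im ≤ d → ContinuousAt f z)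
    (hd : ∀ z : ℂ, a ≤ z.re → z.re ≤ b → c ≤ z.im → z.im ≤ d → z ∉ s → DifferentiableAt ℂ f z) :
    rectIntegral f a b c d = 0 := by
  refine Complex.integral_boundary_rect_eq_zero_of_differentiable_on_off_countable f ⟨a, c⟩ ⟨b, d⟩
    s hs ?_ ?_
  · intro z hz
    simp only [Set.uIcc_of_le hab, Set.uIcc_of_le hcd] at hz
    exact (hc z hz.1.1 hz.1.2 hz.2.1 hz.2.2).continuousWithinAt
  · intro z hz
    simp only [min_eq_left hab, min_eq_left hcd, max_eq_right hab, max_eq_right hcd] at hz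
    exact hd z hz.1.1.1.le hz.1.1.2.le hz.1.2.1.le hz.1.2.2.le hz.2

theorem log_sub_log_neg_of_im_pos {z : ℂ} (hz : 0 < z.im) : log z - log (-z) = Real.pi * I := by
  simp only [Complex.log, norm_neg, arg_neg_eq_arg_sub_pi_of_im_pos hz]
  push_cast
  ring

theorem log_sub_log_neg_of_im_neg {z : ℂ} (hz : z.im < 0) :
    log z - log (-z) = -(Real.pi * I) := by
  simp only [Complex.log, norm_neg, arg_neg_eq_arg_add_pi_of_im_neg hz]
  push_cast
  ring

/-- A horizontal or vertical segment `t ↦ t • e + w` in the slit plane: the integral of `1 / z`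
over it is the increment of the principal logarithm. -/
theorem integral_inv_segment {a b : ℝ} {e w σ : ℂ} (hσ : σ ≠ 0)
    (h : ∀ t ∈ Set.uIcc a b, σ * (t * e + w) ∈ slitPlane) :
    e * ∫ t in a..b, ((t : ℂ) * e + w)⁻¹ = log (σ * (b * e + w)) - log (σ * (a * e + w)) := by
  have hne : ∀ t ∈ Set.uIcc a b, (t : ℂ) * e + w ≠ 0 := fun t ht h0 => by
    have := h t ht
    rw [h0, mul_zero] at this
    exact zero_notMem_slitPlane this
  have hcont : ContinuousOn (fun t : ℝ => ((t : ℂ) * e + w)⁻¹) (Set.uIcc a b) :=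
    ContinuousOn.inv₀ (by fun_prop) hne
  rw [← intervalIntegral.integral_const_mul]
  refine intervalIntegral.integral_eq_sub_of_hasDerivAt
    (f := fun t : ℝ => log (σ * ((t : ℂ) * e + w))) (fun t ht => ?_) ?_
  · have h1 : HasDerivAt (fun t : ℝ => σ * ((t : ℂ) * e + w)) (σ * e) t := by
      have h2 : HasDerivAt (fun t : ℝ => (t : ℂ)) 1 t := ofRealCLM.hasDerivAt
      simpa using ((h2.mul_const e).add_const w).const_mul σ
    have h2 := h1.clog_real (h t ht)
    rwa [mul_div_mul_left _ _ hσ, div_eq_mul_inv] at h2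
  · exact (continuousOn_const.mul hcont).intervalIntegrable

/-- The four increments of the logarithm telescope, except for the jumps of the principal branch
between the left side, where `log (-z)` is used, and the horizontal sides. -/
theorem rectIntegral_inv {a b c d : ℝ} (ha : a < 0) (hb : 0 < b) (hc : c < 0) (hd : 0 < d) :
    rectIntegral (fun z : ℂ => z⁻¹) a b c d = 2 * Real.pi * I := by
  have h1 := integral_inv_segment (a := a) (b := b) (e := 1) (w := c * I) (σ := 1) one_ne_zero
    (fun t _ => Or.inr (by simpa using hc.ne))
  have h2 := integral_inv_segment (a := a) (b := b) (e := 1) (w := d * I) (σ := 1) one_ne_zero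
    (fun t _ => Or.inr (by simpa using hd.ne'))
  have h3 := integral_inv_segment (a := c) (b := d) (e := I) (w := b) (σ := 1) one_ne_zero
    (fun t _ => Or.inl (by simpa using hb))
  have h4 := integral_inv_segment (a := c) (b := d) (e := I) (w := a) (σ := -1) (by norm_num)
    (fun t _ => Or.inl (by simpa using ha))
  have h5 := log_sub_log_neg_of_im_pos (z := a + d * I) (by simpa using hd)
  have h6 := log_sub_log_neg_of_im_neg (z := a + c * I) (by simpa using hc)
  simp only [one_mul, mul_one, neg_one_mul] at h1 h2 h3 h4
  simp only [rectIntegral, smul_eq_mul]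
  rw [h1, h2]
  simp only [add_comm (b : ℂ), add_comm (a : ℂ)] at h5 h6 ⊢
  rw [h3, h4]
  linear_combination h5 - h6

theorem rectIntegral_comp_sub (f : ℂ → E) (a b c d : ℝ) (w : ℂ) :
    rectIntegral (fun z => f (z - w)) a b c d =
      rectIntegral f (a - w.re) (b - w.re) (c - w.im) (d - w.im) := by
  have hw : w = w.re + w.im * I := (re_add_im w).symm
  simp only [rectIntegral]
  congr 1
  · congr 1
    · congr 1
      · rw [← intervalIntegral.integral_comp_sub_right]
        refine intervalIntegral.integral_congr fun x _ => congrArg f ?_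
        conv_lhs => rw [hw]
        push_cast; ring
      · rw [← intervalIntegral.integral_comp_sub_right]
        refine intervalIntegral.integral_congr fun x _ => congrArg f ?_
        conv_lhs => rw [hw]
        push_cast; ring
    · rw [← intervalIntegral.integral_comp_sub_right]
      refine congrArg _ (intervalIntegral.integral_congr fun x _ => congrArg f ?_)
      conv_lhs => rw [hw]
      push_cast; ring
  · rw [← intervalIntegral.integral_comp_sub_right]
    refine congrArg _ (intervalIntegral.integral_congr fun x _ => congrArg f ?_)
    conv_lhs => rw [hw]
    push_cast; ring

theorem rectIntegral_sub_inv {a b c d : ℝ} {w : ℂ} (ha : a < w.re) (hb : w.re < b)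
    (hc : c < w.im) (hd : w.im < d) :
    rectIntegral (fun z : ℂ => (z - w)⁻¹) a b c d = 2 * Real.pi * I := by
  rw [rectIntegral_comp_sub (fun z : ℂ => z⁻¹)]
  exact rectIntegral_inv (by linarith) (by linarith) (by linarith) (by linarith)

theorem rectIntegral_congr {f g : ℂ → E} {a b c d : ℝ} (hab : a ≤ b) (hcd : c ≤ d)
    (h : ∀ z : ℂ, a ≤ z.re → z.re ≤ b → c ≤ z.im → z.im ≤ d →
      (z.re = a ∨ z.re = b ∨ z.im = c ∨ z.im = d) → f z = g z) :
    rectIntegral f a b c d = rectIntegral g a b c d := by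
  simp only [rectIntegral]
  congr 1
  · congr 1
    · congr 1
      · refine intervalIntegral.integral_congr fun x hx => ?_
        rw [Set.uIcc_of_le hab] at hx
        apply h <;> simp [hx.1, hx.2, hcd]
      · refine intervalIntegral.integral_congr fun x hx => ?_
        rw [Set.uIcc_of_le hab] at hx
        apply h <;> simp [hx.1, hx.2, hcd]
    · refine congrArg _ (intervalIntegral.integral_congr fun x hx => ?_)
      rw [Set.uIcc_of_le hcd] at hx
      apply h <;> simp [hx.1, hx.2, hab]
  · refine congrArg _ (intervalIntegral.integral_congr fun x hx => ?_)
    rw [Set.uIcc_of_le hcd] at hx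
    apply h <;> simp [hx.1, hx.2, hab]

theorem rectIntegral_add {f g : ℂ → E} {a b c d : ℝ} (hab : a ≤ b) (hcd : c ≤ d)
    (hf : ∀ z : ℂ, a ≤ z.re → z.re ≤ b → c ≤ z.im → z.im ≤ d →
      (z.re = a ∨ z.re = b ∨ z.im = c ∨ z.im = d) → ContinuousAt f z)
    (hg : ∀ z : ℂ, a ≤ z.re → z.re ≤ b → c ≤ z.im → z.im ≤ d →
      (z.re = a ∨ z.re = b ∨ z.im = c ∨ z.im = d) → ContinuousAt g z) :
    rectIntegral (fun z => f z + g z) a b c d =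
      rectIntegral f a b c d + rectIntegral g a b c d := by
  have hh : ∀ {k : ℂ → E} (hk : ∀ z : ℂ, a ≤ z.re → z.re ≤ b → c ≤ z.im → z.im ≤ d →
      (z.re = a ∨ z.re = b ∨ z.im = c ∨ z.im = d) → ContinuousAt k z) (y : ℝ) (_ : y = c ∨ y = d),
      IntervalIntegrable (fun x : ℝ => k (x + y * I)) MeasureTheory.volume a b := by
    intro k hk y hy
    refine ContinuousOn.intervalIntegrable fun x hx => ?_
    rw [Set.uIcc_of_le hab] at hx
    refine ContinuousAt.continuousWithinAt
      (ContinuousAt.comp (f := fun x : ℝ => (x + y * I : ℂ)) ?_ (by fun_prop))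
    apply hk <;> rcases hy with rfl | rfl <;> simp [hx.1, hx.2, hcd]
  have hv : ∀ {k : ℂ → E} (hk : ∀ z : ℂ, a ≤ z.re → z.re ≤ b → c ≤ z.im → z.im ≤ d →
      (z.re = a ∨ z.re = b ∨ z.im = c ∨ z.im = d) → ContinuousAt k z) (x : ℝ) (_ : x = a ∨ x = b),
      IntervalIntegrable (fun y : ℝ => k (x + y * I)) MeasureTheory.volume c d := by
    intro k hk x hx
    refine ContinuousOn.intervalIntegrable fun y hy => ?_
    rw [Set.uIcc_of_le hcd] at hy
    refine ContinuousAt.continuousWithinAt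
      (ContinuousAt.comp (f := fun y : ℝ => (x + y * I : ℂ)) ?_ (by fun_prop))
    apply hk <;> rcases hx with rfl | rfl <;> simp [hy.1, hy.2, hab]
  simp only [rectIntegral]
  rw [intervalIntegral.integral_add (hh hf c (.inl rfl)) (hh hg c (.inl rfl)),
    intervalIntegral.integral_add (hh hf d (.inr rfl)) (hh hg d (.inr rfl)),
    intervalIntegral.integral_add (hv hf a (.inl rfl)) (hv hg a (.inl rfl)),
    intervalIntegral.integral_add (hv hf b (.inr rfl)) (hv hg b (.inr rfl))]
  simp only [smul_add]
  abel

theorem rectIntegral_smul_const [CompleteSpace E] (f : ℂ → ℂ) (x : E) (a b c d : ℝ) :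
    rectIntegral (fun z => f z • x) a b c d = rectIntegral f a b c d • x := by
  simp only [rectIntegral, intervalIntegral.integral_smul_const, sub_smul, add_smul, smul_smul,
    smul_eq_mul]

variable [CompleteSpace E]

/-- Cauchy's integral formula for a rectangle. The function `dslope f w` is holomorphic off `w` and
continuous at `w`, so its integral vanishes. -/
theorem rectIntegral_cauchy {f : ℂ → E} {a b c d : ℝ} {w : ℂ} (ha : a < w.re) (hb : w.re < b)
    (hc : c < w.im) (hd : w.im < d)
    (hf : ∀ z : ℂ, a ≤ z.re → z.re ≤ b → c ≤ z.im → z.im ≤ d → DifferentiableAt ℂ f z) :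
    rectIntegral (fun z => (z - w)⁻¹ • f z) a b c d = (2 * Real.pi * I : ℂ) • f w := by
  have hab : a ≤ b := (ha.trans hb).le
  have hcd : c ≤ d := (hc.trans hd).le
  have hne : ∀ z : ℂ, (z.re = a ∨ z.re = b ∨ z.im = c ∨ z.im = d) → z - w ≠ 0 := by
    rintro z hz h0
    rw [sub_eq_zero] at h0
    subst h0
    rcases hz with h | h | h | h <;> linarith
  have hw : DifferentiableAt ℂ f w := hf w ha.le hb.le hc.le hd.le
  have h0 : rectIntegral (dslope f w) a b c d = 0 := by
    refine rectIntegral_eq_zero hab hcd (Set.countable_singleton w) (fun z h1 h2 h3 h4 => ?_)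
      (fun z h1 h2 h3 h4 hz => ?_)
    · rcases eq_or_ne z w with rfl | hzw
      · exact continuousAt_dslope_same.2 hw
      · exact (continuousAt_dslope_of_ne hzw).2 (hf z h1 h2 h3 h4).continuousAt
    · exact (differentiableAt_dslope_of_ne hz).2 (hf z h1 h2 h3 h4)
  have h1 : rectIntegral (fun z => (z - w)⁻¹ • f z) a b c d =
      rectIntegral (fun z => dslope f w z + (z - w)⁻¹ • f w) a b c d := by
    refine rectIntegral_congr hab hcd fun z _ _ _ _ hz => ?_
    have := hne z hz
    rw [dslope_of_ne _ (sub_ne_zero.1 this), slope_def_module, smul_sub, sub_add_cancel]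
  rw [h1, rectIntegral_add hab hcd, h0, zero_add, rectIntegral_smul_const,
    rectIntegral_sub_inv ha hb hc hd]
  · intro z h1 h2 h3 h4 hz
    exact (continuousAt_dslope_of_ne (sub_ne_zero.1 (hne z hz))).2 (hf z h1 h2 h3 h4).continuousAt
  · intro z _ _ _ _ hz
    exact ((continuousAt_id.sub continuousAt_const).inv₀ (hne z hz)).smul continuousAt_const

end RectangleIntegral

/-! ### Limits of integrals of translates -/

section DominatedLimits

open MeasureTheory

variable {E : Type*} [NormedAddCommGroup E]

theorem aestronglyMeasurable_of_continuousAt_off_countable {f : ℝ → E} {a b : ℝ} (hab : a ≤ b)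
    {s : Set ℝ} (hs : s.Countable) (hf : ∀ t ∈ Set.Ioc a b, t ∉ s → ContinuousAt f t) :
    AEStronglyMeasurable f (volume.restrict (Set.uIoc a b)) := by
  rw [Set.uIoc_of_le hab]
  have h1 : (Set.Ioc a b \ s : Set ℝ) =ᵐ[volume] Set.Ioc a b :=
    sdiff_null_ae_eq_self (hs.measure_zero volume)
  rw [← Measure.restrict_congr_set h1]
  refine ContinuousOn.aestronglyMeasurable (fun t ht => ?_)
    (measurableSet_Ioc.diff hs.measurableSet)
  exact (hf t ht.1 ht.2).continuousWithinAt

theorem intervalIntegrable_of_bounded_off_countable {f : ℝ → E} {a b C : ℝ} (hab : a ≤ b)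
    {s : Set ℝ} (hs : s.Countable) (hf : ∀ t ∈ Set.Ioc a b, t ∉ s → ContinuousAt f t)
    (hC : ∀ t ∈ Set.Ioc a b, t ∉ s → ‖f t‖ ≤ C) : IntervalIntegrable f volume a b := by
  refine (intervalIntegrable_const (c := C)).mono_fun
    (aestronglyMeasurable_of_continuousAt_off_countable hab hs hf) ?_
  rw [Set.uIoc_of_le hab]
  filter_upwards [ae_restrict_mem measurableSet_Ioc,
    ae_restrict_of_ae (measure_eq_zero_iff_ae_notMem.1 (hs.measure_zero volume))] with t h1 h2
  exact (hC t h1 h2).trans (le_abs_self C)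

variable [NormedSpace ℂ E]

/-- Passage to the limit `ε → 0+` under the integral sign for the translates `z ↦ V (z + ε)`,
away from countably many exceptional parameters. -/
theorem tendsto_integral_shift {a b C r : ℝ} (hab : a ≤ b) (hr : 0 < r) {κ : ℝ → ℂ} {V : ℂ → E}
    {γ : ℝ → ℂ} (hγ : Continuous γ) {s : Set ℝ} (hs : s.Countable)
    (hκ : ∀ t ∈ Set.Ioc a b, t ∉ s → ContinuousAt κ t)
    (hV : ∀ t ∈ Set.Ioc a b, t ∉ s → ∀ ε : ℝ, 0 ≤ ε → ε < r → ContinuousAt V (γ t + ε))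
    (hC : ∀ t ∈ Set.Ioc a b, t ∉ s → ∀ ε : ℝ, 0 < ε → ε < r → ‖κ t • V (γ t + ε)‖ ≤ C) :
    Tendsto (fun ε : ℝ => ∫ t in a..b, κ t • V (γ t + ε)) (𝓝[>] 0)
      (𝓝 (∫ t in a..b, κ t • V (γ t))) := by
  have hev : ∀ᶠ ε : ℝ in 𝓝[>] 0, 0 < ε ∧ ε < r := Ioo_mem_nhdsGT hr
  refine intervalIntegral.tendsto_integral_filter_of_dominated_convergence (fun _ => C) ?_ ?_
    intervalIntegrable_const ?_
  · filter_upwards [hev] with ε hε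
    refine aestronglyMeasurable_of_continuousAt_off_countable hab hs fun t ht hts => ?_
    refine (hκ t ht hts).smul (ContinuousAt.comp (f := fun t : ℝ => γ t + (ε : ℂ))
      (hV t ht hts ε hε.1.le hε.2) (by fun_prop))
  · filter_upwards [hev] with ε hε
    rw [Set.uIoc_of_le hab]
    filter_upwards [measure_eq_zero_iff_ae_notMem.1 (hs.measure_zero volume)] with t h1 h2
    exact hC t h2 h1 ε hε.1 hε.2
  · rw [Set.uIoc_of_le hab]
    filter_upwards [measure_eq_zero_iff_ae_notMem.1 (hs.measure_zero volume)] with t h1 h2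
    refine Tendsto.const_smul ?_ (κ t)
    have h3 : Tendsto (fun ε : ℝ => γ t + (ε : ℂ)) (𝓝 0) (𝓝 (γ t + ((0 : ℝ) : ℂ))) :=
      Continuous.tendsto (by fun_prop) 0
    have h4 := ((hV t h2 h1 0 le_rfl hr).tendsto.comp h3).mono_left
      (nhdsWithin_le_nhds (s := Set.Ioi (0 : ℝ)))
    simpa [Function.comp_def] using h4

end DominatedLimits

/-! ### The Poisson kernel of a quadrant -/

section QuadrantKernel

open Complex ComplexConjugate

/-- The Poisson kernel of a quadrant, not normalized, as a meromorphic function of `z`: the odd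
function with residue `1` at `± w` and `-1` at `± conj w`. -/
noncomputable def quadrantKernel (w z : ℂ) : ℂ :=
  (z - w)⁻¹ + (z + w)⁻¹ - (z - conj w)⁻¹ - (z + conj w)⁻¹

/-- The derivative at `0` of the quadrant kernel. -/
noncomputable def quadrantKernelSlope (w : ℂ) : ℂ := -(4 * I * (((w ^ 2)⁻¹).im : ℂ))

theorem quadrantKernel_neg (w z : ℂ) : quadrantKernel w (-z) = -quadrantKernel w z := by
  have h1 : -z - w = -(z + w) := by ring
  have h2 : -z + w = -(z - w) := by ring
  have h3 : -z - conj w = -(z + conj w) := by ring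
  have h4 : -z + conj w = -(z - conj w) := by ring
  simp only [quadrantKernel, h1, h2, h3, h4, inv_neg]
  ring

theorem quadrantKernelSlope_eq (w : ℂ) :
    quadrantKernelSlope w = -2 * ((w ^ 2)⁻¹ - ((conj w) ^ 2)⁻¹) := by
  have h : ((conj w) ^ 2)⁻¹ = conj ((w ^ 2)⁻¹) := by simp
  rw [h, sub_conj, quadrantKernelSlope]
  push_cast
  ring

theorem inv_sub_add_inv_add {w z : ℂ} (h1 : z - w ≠ 0) (h2 : z + w ≠ 0) :
    (z - w)⁻¹ + (z + w)⁻¹ = 2 * z * (z ^ 2 - w ^ 2)⁻¹ := by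
  have : z ^ 2 - w ^ 2 ≠ 0 := by
    rw [show z ^ 2 - w ^ 2 = (z - w) * (z + w) by ring]
    exact mul_ne_zero h1 h2
  field_simp
  ring

theorem re_le_norm_sub {w : ℂ} (t : ℝ) : w.re ≤ ‖(t * I : ℂ) - w‖ := by
  have := abs_re_le_norm ((t * I : ℂ) - w)
  simp only [sub_re, mul_re, ofReal_re, I_re, mul_zero, ofReal_im, I_im, mul_one, sub_self,
    zero_sub, abs_neg] at this
  exact (le_abs_self _).trans this

theorem re_le_norm_add {w : ℂ} (t : ℝ) : w.re ≤ ‖(t * I : ℂ) + w‖ := by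
  have := abs_re_le_norm ((t * I : ℂ) + w)
  simp only [add_re, mul_re, ofReal_re, I_re, mul_zero, ofReal_im, I_im, mul_one, sub_self,
    zero_add] at this
  exact (le_abs_self _).trans this

theorem quadrantKernel_imag_axis {w : ℂ} (hw : 0 < w.re) (t : ℝ) :
    quadrantKernel w (t * I) =
      2 * (t * I) * ((w ^ 2 + t ^ 2)⁻¹ * -1 + ((conj w) ^ 2 + t ^ 2)⁻¹) := by
  have hc : 0 < (conj w).re := by simpa
  have h (v : ℂ) (hv : 0 < v.re) : (t * I - v : ℂ) ≠ 0 ∧ (t * I + v : ℂ) ≠ 0 :=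
    ⟨norm_pos_iff.1 (hv.trans_le (re_le_norm_sub t)),
      norm_pos_iff.1 (hv.trans_le (re_le_norm_add t))⟩
  have key (v : ℂ) : ((t * I : ℂ) ^ 2 - v ^ 2) = -(v ^ 2 + t ^ 2) := by
    rw [mul_pow, I_sq]; ring
  have h1 := inv_sub_add_inv_add (h w hw).1 (h w hw).2
  have h2 := inv_sub_add_inv_add (h _ hc).1 (h _ hc).2
  rw [key, inv_neg] at h1 h2
  rw [quadrantKernel]
  linear_combination h1 - h2

theorem sq_re_le_norm_sq_add {w : ℂ} (hw : 0 < w.re) (t : ℝ) :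
    w.re ^ 2 ≤ ‖w ^ 2 + (t : ℂ) ^ 2‖ := by
  have : w ^ 2 + (t : ℂ) ^ 2 = -((t * I - w) * (t * I + w)) := by
    linear_combination (t : ℂ) ^ 2 * I_sq
  rw [this, norm_neg, norm_mul, sq]
  exact mul_le_mul (re_le_norm_sub t) (re_le_norm_add t) hw.le (norm_nonneg _)

/-- The quadrant kernel minus its linear part vanishes to third order at the corner. -/
theorem norm_quadrantKernel_sub_linear_le {w : ℂ} (hw : 0 < w.re) (t : ℝ) :
    ‖quadrantKernel w (t * I) - quadrantKernelSlope w * (t * I)‖ ≤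
      4 / (w.re ^ 2 * w.re ^ 2) * |t| ^ 3 := by
  have hc : 0 < (conj w).re := by simpa
  have h (v : ℂ) (hv : 0 < v.re) : v ^ 2 + (t : ℂ) ^ 2 ≠ 0 ∧ v ≠ 0 :=
    ⟨norm_pos_iff.1 ((pow_pos hv 2).trans_le (sq_re_le_norm_sq_add hv t)),
      fun h0 => by simp [h0] at hv⟩
  have e (v : ℂ) (hv : 0 < v.re) : (v ^ 2)⁻¹ - (v ^ 2 + (t : ℂ) ^ 2)⁻¹ =
      (t : ℂ) ^ 2 * ((v ^ 2)⁻¹ * (v ^ 2 + (t : ℂ) ^ 2)⁻¹) := by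
    have := h v hv
    have h1 := this.1
    have h2 := this.2
    field_simp
    ring
  have bd (v : ℂ) (hv : 0 < v.re) : ‖(v ^ 2)⁻¹ * (v ^ 2 + (t : ℂ) ^ 2)⁻¹‖ ≤
      1 / (v.re ^ 2 * v.re ^ 2) := by
    rw [norm_mul, norm_inv, norm_inv, ← mul_inv, ← one_div, norm_pow]
    refine one_div_le_one_div_of_le (by positivity) ?_
    gcongr
    · exact (le_abs_self _).trans (abs_re_le_norm v)
    · exact sq_re_le_norm_sq_add hv t
  have h1 := e w hw
  have h2 := e _ hc
  have b1 := bd w hw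
  have b2 := bd _ hc
  rw [conj_re] at b2
  have : quadrantKernel w (t * I) - quadrantKernelSlope w * (t * I) =
      2 * (t * I) * (t : ℂ) ^ 2 * ((w ^ 2)⁻¹ * (w ^ 2 + (t : ℂ) ^ 2)⁻¹ -
        ((conj w) ^ 2)⁻¹ * ((conj w) ^ 2 + (t : ℂ) ^ 2)⁻¹) := by
    rw [quadrantKernel_imag_axis hw, quadrantKernelSlope_eq]
    linear_combination 2 * (t * I) * (h1 - h2)
  rw [this, norm_mul]
  have n1 : ‖2 * (t * I) * (t : ℂ) ^ 2‖ = 2 * |t| ^ 3 := by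
    simp only [norm_mul, norm_pow, norm_real, Real.norm_eq_abs, norm_I, mul_one, norm_ofNat]
    ring
  rw [n1]
  calc 2 * |t| ^ 3 * _ ≤ 2 * |t| ^ 3 * (1 / (w.re ^ 2 * w.re ^ 2) + 1 / (w.re ^ 2 * w.re ^ 2)) := by
        gcongr
        exact (norm_sub_le _ _).trans (add_le_add b1 b2)
    _ = _ := by ring

/-- The total mass of the quadrant kernel on the imaginary half-axis is bounded independently of
the pole: the norm of the kernel there is the derivative of `2 arctan ((t² + A) / B)`, where
`A = Re (w²)` and `B = |Im (w²)|`. -/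
theorem integral_norm_quadrantKernel_le {w : ℂ} (hw : 0 < w.re) (hw' : w.im ≠ 0) {ρ : ℝ}
    (hρ : 0 < ρ) : ∫ t in (0 : ℝ)..ρ, ‖quadrantKernel w (t * I)‖ ≤ 2 * Real.pi := by
  set A : ℝ := (w ^ 2).re with hA
  set B : ℝ := |(w ^ 2).im| with hB
  have hB0 : 0 < B := by
    rw [hB, abs_pos, sq, mul_im]
    have : w.re * w.im + w.im * w.re = 2 * (w.re * w.im) := by ring
    rw [this]
    exact mul_ne_zero two_ne_zero (mul_ne_zero hw.ne' hw')
  have hn : ∀ t : ℝ, ‖w ^ 2 + (t : ℂ) ^ 2‖ ^ 2 = (t ^ 2 + A) ^ 2 + B ^ 2 := fun t => by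
    rw [← normSq_eq_norm_sq, normSq_apply, hB, sq_abs]
    have h1 : (w ^ 2 + (t : ℂ) ^ 2).re = A + t ^ 2 := by
      rw [add_re, ← ofReal_pow, ofReal_re]
    have h2 : (w ^ 2 + (t : ℂ) ^ 2).im = (w ^ 2).im := by
      rw [add_im, ← ofReal_pow, ofReal_im, add_zero]
    rw [h1, h2]; ring
  have hk : ∀ t ∈ Set.uIcc 0 ρ,
      ‖quadrantKernel w (t * I)‖ = 4 * t * B / ((t ^ 2 + A) ^ 2 + B ^ 2) := by
    intro t ht
    rw [Set.uIcc_of_le hρ.le] at ht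
    have h0 : w ^ 2 + (t : ℂ) ^ 2 ≠ 0 :=
      norm_pos_iff.1 ((pow_pos hw 2).trans_le (sq_re_le_norm_sq_add hw t))
    have h0' : (conj w) ^ 2 + (t : ℂ) ^ 2 ≠ 0 :=
      norm_pos_iff.1 ((pow_pos (by simpa) 2).trans_le (sq_re_le_norm_sq_add (w := conj w)
        (by simpa) t))
    have e1 : (conj w) ^ 2 + (t : ℂ) ^ 2 = conj (w ^ 2 + (t : ℂ) ^ 2) := by simp
    have e2 : quadrantKernel w (t * I) = 2 * (t * I) * ((w ^ 2 - (conj w) ^ 2) /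
        ((w ^ 2 + (t : ℂ) ^ 2) * ((conj w) ^ 2 + (t : ℂ) ^ 2))) := by
      rw [quadrantKernel_imag_axis hw]
      field_simp
      ring
    have e3 : ‖w ^ 2 - (conj w) ^ 2‖ = 2 * B := by
      rw [← map_pow, sub_conj, norm_mul, norm_I, mul_one, norm_real, Real.norm_eq_abs, abs_mul,
        abs_two]
    have e4 : ‖(w ^ 2 + (t : ℂ) ^ 2) * ((conj w) ^ 2 + (t : ℂ) ^ 2)‖ =
        (t ^ 2 + A) ^ 2 + B ^ 2 := by
      rw [e1, norm_mul, norm_conj, ← sq, hn]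
    rw [e2, norm_mul, norm_div, e3, e4]
    simp only [norm_mul, norm_real, Real.norm_eq_abs, norm_I, mul_one, norm_ofNat,
      abs_of_nonneg ht.1]
    ring
  rw [intervalIntegral.integral_congr hk]
  have hd : ∀ t ∈ Set.uIcc 0 ρ, HasDerivAt (fun t : ℝ => 2 * Real.arctan ((t ^ 2 + A) / B))
      (4 * t * B / ((t ^ 2 + A) ^ 2 + B ^ 2)) t := by
    intro t _
    have h1 : HasDerivAt (fun t : ℝ => (t ^ 2 + A) / B) (2 * t / B) t := by
      simpa using (((hasDerivAt_pow 2 t).add_const A).div_const B)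
    refine ((h1.arctan).const_mul 2).congr_deriv ?_
    have : (t ^ 2 + A) ^ 2 + B ^ 2 ≠ 0 := by positivity
    have : 1 + ((t ^ 2 + A) / B) ^ 2 ≠ 0 := by positivity
    field_simp
    ring
  have hcont : ContinuousOn (fun t : ℝ => 4 * t * B / ((t ^ 2 + A) ^ 2 + B ^ 2))
      (Set.uIcc 0 ρ) :=
    ContinuousOn.div (by fun_prop) (by fun_prop) fun t _ => by positivity
  rw [intervalIntegral.integral_eq_sub_of_hasDerivAt hd hcont.intervalIntegrable]
  have h1 := Real.arctan_lt_pi_div_two ((ρ ^ 2 + A) / B)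
  have h2 := Real.neg_pi_div_two_lt_arctan ((0 ^ 2 + A) / B)
  linarith

end QuadrantKernel

/-! ### Expansion of harmonic jumps at a corner -/

section CornerExpansion

open Complex ComplexConjugate MeasureTheory

variable {E : Type*} [NormedAddCommGroup E] [NormedSpace ℂ E]

/-- A function `V` holomorphic on the right half of the square of half-side `ρ` (and a bit
further to the right), up to the imaginary axis but for the origin, of growth `|Im z|⁻³`, and such
that the harmonic function `z ↦ V z - V (conj z)` is bounded on the imaginary axis. -/
structure IsCornerFunction (V : ℂ → E) (ρ C : ℝ) : Prop where
  pos : 0 < ρ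
  diff : ∀ z : ℂ, 0 ≤ z.re → z.re ≤ 2 * ρ → |z.im| ≤ ρ → z ≠ 0 → DifferentiableAt ℂ V z
  growth : ∀ z : ℂ, 0 ≤ z.re → z.re ≤ 2 * ρ → |z.im| ≤ ρ → |z.im| ^ 3 * ‖V z‖ ≤ C
  jump : ∀ t : ℝ, 0 < t → t ≤ ρ → ‖V (t * I) - V (-(t * I))‖ ≤ C

namespace IsCornerFunction

variable {V : ℂ → E} {ρ C : ℝ} (h : IsCornerFunction V ρ C)
include h

/-- A bound for `V` away from the corner, by compactness. The part `ρ ≤ Re z` includes the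
translates to the right of the side `Re z = ρ`. -/
theorem exists_bound_sides : ∃ W, ∀ z : ℂ, 0 ≤ z.re → z.re ≤ 2 * ρ → |z.im| ≤ ρ →
    (ρ ≤ z.re ∨ |z.im| = ρ) → ‖V z‖ ≤ W := by
  have hK : IsCompact ((Set.Icc 0 (2 * ρ) ×ℂ Set.Icc (-ρ) ρ) ∩
      ({z : ℂ | ρ ≤ z.re} ∪ {z : ℂ | |z.im| = ρ})) :=
    (isCompact_Icc.reProdIm isCompact_Icc).inter_right
      ((isClosed_le continuous_const continuous_re).union
        (isClosed_eq continuous_im.abs continuous_const))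
  obtain ⟨W, hW⟩ := hK.exists_bound_of_continuousOn (f := V) fun z hz => by
    refine (h.diff z hz.1.1.1 hz.1.1.2 (abs_le.2 hz.1.2) ?_).continuousAt.continuousWithinAt
    rintro rfl
    have := h.pos
    rcases hz.2 with h' | h'
    · exact absurd h' (by simpa using this)
    · simp only [Set.mem_ofPred_eq, zero_im, abs_zero] at h'
      exact this.ne h'
  exact ⟨W, fun z h1 h2 h3 h4 => hW z ⟨⟨⟨h1, h2⟩, abs_le.1 h3⟩, h4⟩⟩

end IsCornerFunction

theorem norm_sub_ge_of_side {ρ : ℝ} {w z : ℂ} (hw : |w.re| ≤ ρ / 2) (hw' : |w.im| ≤ ρ / 2)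
    (hz : ρ ≤ z.re ∨ |z.im| = ρ) : ρ / 2 ≤ ‖z - w‖ := by
  rcases hz with hz | hz
  · have := (le_abs_self _).trans (abs_re_le_norm (z - w))
    rw [sub_re] at this
    linarith [(abs_le.1 hw).2]
  · have h1 := abs_im_le_norm (z - w)
    rw [sub_im] at h1
    have h2 := abs_sub_abs_le_abs_sub z.im w.im
    linarith

theorem norm_quadrantKernel_le_of_side {ρ : ℝ} (hρ : 0 < ρ) {w z : ℂ} (hw : |w.re| ≤ ρ / 2)
    (hw' : |w.im| ≤ ρ / 2) (hz : ρ ≤ z.re ∨ |z.im| = ρ) : ‖quadrantKernel w z‖ ≤ 8 / ρ := by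
  have key (v : ℂ) (hv : |v.re| ≤ ρ / 2) (hv' : |v.im| ≤ ρ / 2) : ‖(z - v)⁻¹‖ ≤ 2 / ρ := by
    rw [norm_inv, ← inv_div]
    exact inv_anti₀ (by positivity) (norm_sub_ge_of_side hv hv' hz)
  have h1 := key w hw hw'
  have h2 := key (-w) (by simpa) (by simpa)
  have h3 := key (conj w) (by simpa) (by simpa)
  have h4 := key (-conj w) (by simpa) (by simpa)
  rw [sub_neg_eq_add] at h2 h4
  calc ‖quadrantKernel w z‖ ≤ 2 / ρ + 2 / ρ + 2 / ρ + 2 / ρ :=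
        (norm_sub_le _ _).trans (add_le_add ((norm_sub_le _ _).trans
          (add_le_add ((norm_add_le _ _).trans (add_le_add h1 h2)) h3)) h4)
    _ = 8 / ρ := by ring

theorem differentiableAt_quadrantKernel {w z : ℂ} (h1 : z - w ≠ 0) (h2 : z + w ≠ 0)
    (h3 : z - conj w ≠ 0) (h4 : z + conj w ≠ 0) : DifferentiableAt ℂ (quadrantKernel w) z := by
  unfold quadrantKernel
  fun_prop (disch := assumption)

theorem ne_zero_of_boundary {ρ : ℝ} {w z : ℂ} (hw0 : w.re ≠ 0) (hw : |w.re| ≤ ρ / 2)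
    (hρ : 0 < ρ) (hw' : |w.im| ≤ ρ / 2) (hz : z.re = 0 ∨ ρ ≤ z.re ∨ |z.im| = ρ) :
    z - w ≠ 0 := by
  rcases hz with hz | hz
  · intro h0
    have := congrArg re h0
    rw [sub_re, hz, zero_re] at this
    exact hw0 (by linarith)
  · exact norm_pos_iff.1 (lt_of_lt_of_le (by positivity) (norm_sub_ge_of_side hw hw' hz))

theorem differentiableAt_quadrantKernel_of_boundary {ρ : ℝ} (hρ : 0 < ρ) {w z : ℂ}
    (hw0 : 0 < w.re) (hw : |w.re| ≤ ρ / 2) (hw' : |w.im| ≤ ρ / 2)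
    (hz : z.re = 0 ∨ ρ ≤ z.re ∨ |z.im| = ρ) : DifferentiableAt ℂ (quadrantKernel w) z := by
  refine differentiableAt_quadrantKernel ?_ ?_ ?_ ?_
  · exact ne_zero_of_boundary hw0.ne' hw hρ hw' hz
  · rw [← sub_neg_eq_add]
    exact ne_zero_of_boundary (by simpa using hw0.ne') (by simpa) hρ (by simpa) hz
  · exact ne_zero_of_boundary (by simpa using hw0.ne') (by simpa) hρ (by simpa) hz
  · rw [← sub_neg_eq_add]
    exact ne_zero_of_boundary (by simpa using hw0.ne') (by simpa) hρ (by simpa) hz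

namespace IsCornerFunction

variable {V : ℂ → E} {ρ C : ℝ} (h : IsCornerFunction V ρ C)
include h

/-- Cauchy's formula for the translate `V (· + ε)` and the quadrant kernel made flat at `0`. -/
theorem rectIntegral_shift [CompleteSpace E] {w : ℂ} (hw : 0 < w.re) (hw2 : w.re ≤ ρ / 2)
    (hw3 : |w.im| ≤ ρ / 2) {ε : ℝ} (hε : 0 < ε) (hε' : ε < ρ) :
    rectIntegral (fun z => (quadrantKernel w z - quadrantKernelSlope w * z) • V (z + ε))
      0 ρ (-ρ) ρ = (2 * Real.pi * I : ℂ) • (V (w + ε) - V (conj w + ε)) := by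
  have hρ := h.pos
  have hwa : |w.re| ≤ ρ / 2 := by rwa [abs_of_pos hw]
  have hV : ∀ z : ℂ, 0 ≤ z.re → z.re ≤ ρ → -ρ ≤ z.im → z.im ≤ ρ →
      DifferentiableAt ℂ (fun z => V (z + ε)) z := by
    intro z h1 h2 h3 h4
    have hre : (z + (ε : ℂ)).re = z.re + ε := by simp
    have him : (z + (ε : ℂ)).im = z.im := by simp
    refine differentiableAt_comp_add_const.2 (h.diff (z + ε) (by rw [hre]; linarith)
      (by rw [hre]; linarith)
      (by rw [him]; exact abs_le.2 ⟨h3, h4⟩)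
      (ne_zero_of_re_pos (by rw [hre]; linarith)))
  have him := abs_le.1 hw3
  have hm : ∀ z : ℂ, 0 ≤ z.re → DifferentiableAt ℂ
      (fun z => (z + w)⁻¹ - (z + conj w)⁻¹ - quadrantKernelSlope w * z) z := by
    intro z hz
    have h1 : z + w ≠ 0 := ne_zero_of_re_pos (by rw [add_re]; linarith)
    have h2 : z + conj w ≠ 0 := ne_zero_of_re_pos (by rw [add_re, conj_re]; linarith)
    fun_prop (disch := assumption)
  -- the kernel splits into the poles at `w` and `conj w`, which Cauchy's formula evaluates, and
  -- the holomorphic remainder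
  have hbd : ∀ z : ℂ, 0 ≤ z.re → z.re ≤ ρ → -ρ ≤ z.im → z.im ≤ ρ →
      (z.re = 0 ∨ z.re = ρ ∨ z.im = -ρ ∨ z.im = ρ) → (z.re = 0 ∨ ρ ≤ z.re ∨ |z.im| = ρ) := by
    rintro z _ _ _ _ (h1 | h1 | h1 | h1)
    · exact .inl h1
    · exact .inr (.inl h1.ge)
    · exact .inr (.inr (by rw [h1, abs_neg, abs_of_pos hρ]))
    · exact .inr (.inr (by rw [h1, abs_of_pos hρ]))
  have c1 := rectIntegral_cauchy (f := fun z => V (z + ε)) (w := w) (a := 0) (b := ρ) (c := -ρ)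
    (d := ρ) hw (by linarith) (by linarith) (by linarith) hV
  have c2 := rectIntegral_cauchy (f := fun z => -V (z + ε)) (w := conj w) (a := 0) (b := ρ)
    (c := -ρ) (d := ρ) (by simpa) (by rw [conj_re]; linarith) (by rw [conj_im]; linarith)
    (by rw [conj_im]; linarith) (fun z h1 h2 h3 h4 => (hV z h1 h2 h3 h4).neg)
  have c3 := rectIntegral_eq_zero (a := 0) (b := ρ) (c := -ρ) (d := ρ) hρ.le (by linarith)
    Set.countable_empty
    (f := fun z => ((z + w)⁻¹ - (z + conj w)⁻¹ - quadrantKernelSlope w * z) • V (z + ε))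
    (fun z h1 h2 h3 h4 => ((hm z h1).smul (hV z h1 h2 h3 h4)).continuousAt)
    (fun z h1 h2 h3 h4 _ => ((hm z h1).smul (hV z h1 h2 h3 h4)))
  have hne (v : ℂ) (hv : 0 < v.re) (h2 : v.re ≤ ρ / 2) (h3 : |v.im| ≤ ρ / 2) : ∀ z : ℂ,
      0 ≤ z.re → z.re ≤ ρ → -ρ ≤ z.im → z.im ≤ ρ →
      (z.re = 0 ∨ z.re = ρ ∨ z.im = -ρ ∨ z.im = ρ) → ContinuousAt (fun z => (z - v)⁻¹) z :=
    fun z a1 a2 a3 a4 a5 => (continuousAt_id.sub continuousAt_const).inv₀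
      (ne_zero_of_boundary hv.ne' (by rwa [abs_of_pos hv]) hρ h3 (hbd z a1 a2 a3 a4 a5))
  have k1 := rectIntegral_add (E := E) (a := 0) (b := ρ) (c := -ρ) (d := ρ) hρ.le (by linarith)
    (f := fun z => (z - w)⁻¹ • V (z + ε)) (g := fun z => (z - conj w)⁻¹ • -V (z + ε))
    (fun z a1 a2 a3 a4 a5 => (hne w hw hw2 hw3 z a1 a2 a3 a4 a5).smul
      (hV z a1 a2 a3 a4).continuousAt)
    (fun z a1 a2 a3 a4 a5 => (hne (conj w) (by simpa) (by simpa) (by simpa) z a1 a2 a3 a4 a5).smul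
      (hV z a1 a2 a3 a4).continuousAt.neg)
  have k2 := rectIntegral_add (E := E) (a := 0) (b := ρ) (c := -ρ) (d := ρ) hρ.le (by linarith)
    (f := fun z => (z - w)⁻¹ • V (z + ε) + (z - conj w)⁻¹ • -V (z + ε))
    (g := fun z => ((z + w)⁻¹ - (z + conj w)⁻¹ - quadrantKernelSlope w * z) • V (z + ε))
    (fun z a1 a2 a3 a4 a5 => ((hne w hw hw2 hw3 z a1 a2 a3 a4 a5).smul
      (hV z a1 a2 a3 a4).continuousAt).add
      ((hne (conj w) (by simpa) (by simpa) (by simpa) z a1 a2 a3 a4 a5).smul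
      (hV z a1 a2 a3 a4).continuousAt.neg))
    (fun z a1 a2 a3 a4 a5 => ((hm z a1).smul (hV z a1 a2 a3 a4)).continuousAt)
  rw [k1, c1, c2, c3, add_zero, smul_neg, ← sub_eq_add_neg, ← smul_sub] at k2
  rw [← k2]
  congr 1
  funext z
  simp only [quadrantKernel]
  module

/-- A factor `k` of cubic decay compensates the growth of `V`. -/
theorem growth_mul_le {k : ℂ} {t B : ℝ} (hk : ‖k‖ ≤ B * |t| ^ 3) (hB : 0 ≤ B) {z : ℂ}
    (hz0 : 0 ≤ z.re) (hz1 : z.re ≤ 2 * ρ) (hz2 : z.im = t) (ht : |t| ≤ ρ) : ‖k • V z‖ ≤ B * C := by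
  rw [norm_smul]
  calc ‖k‖ * ‖V z‖ ≤ B * |t| ^ 3 * ‖V z‖ := by gcongr
    _ = B * (|z.im| ^ 3 * ‖V z‖) := by rw [hz2]; ring
    _ ≤ B * C := by gcongr; exact h.growth z hz0 hz1 (by rwa [hz2])

/-- The limit `ε → 0+` of `IsCornerFunction.rectIntegral_shift`. -/
theorem rectIntegral_eq [CompleteSpace E] {w : ℂ} (hw : 0 < w.re) (hw2 : w.re ≤ ρ / 2)
    (hw3 : |w.im| ≤ ρ / 2) :
    rectIntegral (fun z => (quadrantKernel w z - quadrantKernelSlope w * z) • V z)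
      0 ρ (-ρ) ρ = (2 * Real.pi * I : ℂ) • (V w - V (conj w)) := by
  have hρ := h.pos
  have hwa : |w.re| ≤ ρ / 2 := by rwa [abs_of_pos hw]
  obtain ⟨W, hW⟩ := h.exists_bound_sides
  have hW0 : 0 ≤ W := (norm_nonneg _).trans (hW (ρ : ℂ) (by simpa using hρ.le)
    (by simp; linarith) (by simpa using hρ.le) (by simp))
  set k : ℂ → ℂ := fun z => quadrantKernel w z - quadrantKernelSlope w * z with hk
  have hkc : ∀ z : ℂ, (z.re = 0 ∨ ρ ≤ z.re ∨ |z.im| = ρ) → ContinuousAt k z := fun z hz =>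
    (differentiableAt_quadrantKernel_of_boundary hρ hw hwa hw3 hz).continuousAt.sub
      (by fun_prop)
  have hkb : ∀ z : ℂ, 0 ≤ z.re → z.re ≤ ρ → |z.im| ≤ ρ → (ρ ≤ z.re ∨ |z.im| = ρ) →
      ‖k z‖ ≤ 8 / ρ + ‖quadrantKernelSlope w‖ * (ρ + ρ) := by
    intro z h0 h1 h2 h3
    refine (norm_sub_le _ _).trans (add_le_add
      (norm_quadrantKernel_le_of_side hρ hwa hw3 h3) ?_)
    rw [norm_mul]
    gcongr
    refine (norm_le_abs_re_add_abs_im z).trans ?_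
    gcongr
    rwa [abs_of_nonneg h0]
  -- the three sides away from the corner
  have side (a b : ℝ) (hab : a ≤ b) (γ : ℝ → ℂ) (hγ : Continuous γ)
      (hs : ∀ t ∈ Set.Ioc a b, 0 ≤ (γ t).re ∧ (γ t).re ≤ ρ ∧ |(γ t).im| ≤ ρ ∧
        (ρ ≤ (γ t).re ∨ |(γ t).im| = ρ)) :
      Tendsto (fun ε : ℝ => ∫ t in a..b, k (γ t) • V (γ t + ε)) (𝓝[>] 0)
        (𝓝 (∫ t in a..b, k (γ t) • V (γ t))) := by
    have hshift : ∀ t ∈ Set.Ioc a b, ∀ ε : ℝ, 0 ≤ ε → ε < ρ → 0 ≤ (γ t + ε).re ∧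
        (γ t + ε).re ≤ 2 * ρ ∧ |(γ t + ε).im| ≤ ρ ∧
        (ρ ≤ (γ t + ε).re ∨ |(γ t + ε).im| = ρ) := by
      intro t ht ε hε hε'
      obtain ⟨h1, h2, h3, h4⟩ := hs t ht
      simp only [add_re, ofReal_re, add_im, ofReal_im, add_zero]
      exact ⟨by linarith, by linarith, h3, h4.imp (fun h => by linarith) id⟩
    refine tendsto_integral_shift (κ := fun t => k (γ t)) hab hρ hγ Set.countable_empty
      (C := (8 / ρ + ‖quadrantKernelSlope w‖ * (ρ + ρ)) * W) ?_ ?_ ?_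
    · intro t ht _
      exact (hkc _ (.inr (hs t ht).2.2.2)).comp hγ.continuousAt
    · intro t ht _ ε hε hε'
      obtain ⟨h1, h2, h3, h4⟩ := hshift t ht ε hε hε'
      refine (h.diff _ h1 h2 h3 ?_).continuousAt
      intro h0
      rw [h0] at h4
      simp only [zero_re, zero_im, abs_zero] at h4
      rcases h4 with h4 | h4 <;> linarith
    · intro t ht _ ε hε hε'
      obtain ⟨h1, h2, h3, h4⟩ := hshift t ht ε hε.le hε'
      obtain ⟨g1, g2, g3, g4⟩ := hs t ht
      rw [norm_smul]
      exact mul_le_mul (hkb _ g1 g2 g3 g4) (hW _ h1 h2 h3 h4) (norm_nonneg _)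
        (by positivity)
  have s1 := side 0 ρ hρ.le (fun x : ℝ => (x + (-ρ : ℝ) * I : ℂ)) (by fun_prop) fun t ht => by
    simp [ht.1.le, ht.2, abs_of_pos hρ]
  have s2 := side 0 ρ hρ.le (fun x : ℝ => (x + (ρ : ℝ) * I : ℂ)) (by fun_prop) fun t ht => by
    simp [ht.1.le, ht.2, abs_of_pos hρ]
  have s3 := side (-ρ) ρ (by linarith) (fun y : ℝ => ((ρ : ℝ) + y * I : ℂ)) (by fun_prop)
    fun t ht => by
      simpa [hρ.le] using abs_le.2 ⟨ht.1.le, ht.2⟩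
  -- on the imaginary axis the cubic zero of `k` at the corner absorbs the growth of `V`
  have s4 : Tendsto (fun ε : ℝ => ∫ y in (-ρ)..ρ, k (((0 : ℝ) : ℂ) + y * I) •
      V (((0 : ℝ) : ℂ) + y * I + ε)) (𝓝[>] 0)
        (𝓝 (∫ y in (-ρ)..ρ, k (((0 : ℝ) : ℂ) + y * I) • V (((0 : ℝ) : ℂ) + y * I))) := by
    refine tendsto_integral_shift (κ := fun y : ℝ => k (((0 : ℝ) : ℂ) + y * I)) (by linarith) hρ
      (γ := fun y : ℝ => ((0 : ℝ) : ℂ) + y * I)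
      (by fun_prop) (Set.countable_singleton 0) (C := 4 / (w.re ^ 2 * w.re ^ 2) * C) ?_ ?_ ?_
    · intro t _ _
      refine ContinuousAt.comp (f := fun y : ℝ => ((0 : ℝ) : ℂ) + y * I)
        (hkc _ (.inl (by simp))) (by fun_prop)
    · intro t ht h0 ε hε hε'
      refine (h.diff _ (by simpa using hε) (by simp; linarith)
        (by simpa using abs_le.2 ⟨ht.1.le, ht.2⟩) fun h1 => h0 ?_).continuousAt
      simpa using congrArg im h1
    · intro t ht _ ε hε hε'
      refine h.growth_mul_le (t := t) ?_ (by positivity) (by simpa using hε.le)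
        (by simp; linarith) (by simp) (abs_le.2 ⟨ht.1.le, ht.2⟩)
      have := norm_quadrantKernel_sub_linear_le hw t
      simpa [hk] using this
  have hlim : Tendsto (fun ε : ℝ => rectIntegral (fun z => k z • V (z + ε)) 0 ρ (-ρ) ρ) (𝓝[>] 0)
      (𝓝 (rectIntegral (fun z => k z • V z) 0 ρ (-ρ) ρ)) :=
    (((s1.sub s2).add (s3.const_smul I)).sub (s4.const_smul I))
  have hc (v : ℂ) (hv : 0 < v.re) (hv2 : v.re ≤ ρ / 2) (hv3 : |v.im| ≤ ρ / 2) :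
      Tendsto (fun ε : ℝ => V (v + ε)) (𝓝[>] 0) (𝓝 (V v)) := by
    have h1 := (h.diff v hv.le (by linarith) (by linarith) (ne_zero_of_re_pos hv)).continuousAt
    have h3 : Tendsto (fun ε : ℝ => v + (ε : ℂ)) (𝓝 0) (𝓝 (v + ((0 : ℝ) : ℂ))) :=
      Continuous.tendsto (by fun_prop) 0
    rw [ofReal_zero, add_zero] at h3
    exact (h1.tendsto.comp h3).mono_left nhdsWithin_le_nhds
  refine tendsto_nhds_unique (hlim.congr' ?_) (((hc w hw hw2 hw3).sub
    (hc (conj w) (by simpa) (by simpa) (by simpa))).const_smul _)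
  filter_upwards [Ioo_mem_nhdsGT hρ] with ε hε
  exact h.rectIntegral_shift hw hw2 hw3 hε.1 hε.2

end IsCornerFunction

/-- For an odd kernel `κ`, the integral of `κ • V` over the boundary of `[0, ρ] × [-ρ, ρ]`, with
the two halves of the side on the imaginary axis folded together. -/
noncomputable def foldedIntegral (V : ℂ → E) (ρ : ℝ) (κ : ℂ → ℂ) : E :=
  (∫ x : ℝ in 0..ρ, κ (x + (-ρ : ℝ) * I) • V (x + (-ρ : ℝ) * I)) -
    (∫ x : ℝ in 0..ρ, κ (x + ρ * I) • V (x + ρ * I)) +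
    I • (∫ y : ℝ in (-ρ)..ρ, κ (ρ + y * I) • V (ρ + y * I)) -
    I • (∫ y : ℝ in 0..ρ, κ (y * I) • (V (y * I) - V (-(y * I))))

namespace IsCornerFunction

variable {V : ℂ → E} {ρ C : ℝ} (h : IsCornerFunction V ρ C)
include h

theorem continuousAt_imag {t : ℝ} (ht : |t| ≤ ρ) (h0 : t ≠ 0) :
    ContinuousAt (fun y : ℝ => V (y * I)) t :=
  ContinuousAt.comp (f := fun y : ℝ => (y * I : ℂ)) (h.diff _ (by simp)
    (by simpa using h.pos.le) (by simpa using ht) (by simpa using h0)).continuousAt (by fun_prop)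

theorem rectIntegral_eq_folded {κ : ℂ → ℂ} (hodd : ∀ z, κ (-z) = -κ z)
    (hκ : ∀ t : ℝ, ContinuousAt κ (t * I)) {B : ℝ} (hB : 0 ≤ B)
    (hκB : ∀ t : ℝ, ‖κ (t * I)‖ ≤ B * |t| ^ 3) :
    rectIntegral (fun z => κ z • V z) 0 ρ (-ρ) ρ = foldedIntegral V ρ κ := by
  have hρ := h.pos
  have hint (a b : ℝ) (hab : a ≤ b) (ha : -ρ ≤ a) (hb : b ≤ ρ) :
      IntervalIntegrable (fun y : ℝ => κ (y * I) • V (y * I)) volume a b := by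
    refine intervalIntegrable_of_bounded_off_countable hab (Set.countable_singleton 0)
      (C := B * C) (fun t ht h0 => ?_) fun t ht _ => ?_
    · exact (ContinuousAt.comp (f := fun y : ℝ => (y * I : ℂ)) (hκ t) (by fun_prop)).smul
        (h.continuousAt_imag (abs_le.2 ⟨by linarith [ht.1], by linarith [ht.2]⟩) h0)
    · exact h.growth_mul_le (hκB t) hB (by simp) (by simpa using hρ.le) (by simp)
        (abs_le.2 ⟨by linarith [ht.1], by linarith [ht.2]⟩)
  have key : ∫ y in (-ρ)..ρ, κ (y * I) • V (y * I) =
      ∫ y in 0..ρ, κ (y * I) • (V (y * I) - V (-(y * I))) := by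
    rw [← intervalIntegral.integral_add_adjacent_intervals
      (hint (-ρ) 0 (by linarith) le_rfl hρ.le) (hint 0 ρ hρ.le (by linarith) le_rfl)]
    have h1 : ∫ y in (-ρ)..0, κ (y * I) • V (y * I) =
        ∫ y in 0..ρ, κ ((-y : ℝ) * I) • V ((-y : ℝ) * I) := by
      rw [intervalIntegral.integral_comp_neg (fun y : ℝ => κ (y * I) • V (y * I)), neg_zero]
    have h2 : IntervalIntegrable (fun y : ℝ => κ ((-y : ℝ) * I) • V ((-y : ℝ) * I)) volume 0 ρ := by
      have := (hint (-ρ) 0 (by linarith) le_rfl hρ.le).comp_sub_left 0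
      simpa using this.symm
    rw [h1, ← intervalIntegral.integral_add h2 (hint 0 ρ hρ.le (by linarith) le_rfl)]
    refine intervalIntegral.integral_congr fun y _ => ?_
    simp only [ofReal_neg, neg_mul, hodd]
    module
  simp only [rectIntegral, foldedIntegral, ofReal_zero, zero_add]
  rw [key]

/-- Folding makes the integrand on the axis bounded, so that the quadrant kernel and its linear
correction can be integrated separately, although neither need be integrable against `V` alone. -/
theorem foldedIntegral_sub_mul {κ : ℂ → ℂ}
    (hκ : ∀ z : ℂ, (z.re = 0 ∨ ρ ≤ z.re ∨ |z.im| = ρ) → ContinuousAt κ z) (s : ℂ) :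
    foldedIntegral V ρ (fun z => κ z - s * z) =
      foldedIntegral V ρ κ - s • foldedIntegral V ρ (fun z => z) := by
  have hρ := h.pos
  have side (a b : ℝ) (hab : a ≤ b) (γ : ℝ → ℂ) (hγ : Continuous γ)
      (hs : ∀ t ∈ Set.Icc a b, 0 ≤ (γ t).re ∧ (γ t).re ≤ ρ ∧ |(γ t).im| ≤ ρ ∧
        (ρ ≤ (γ t).re ∨ |(γ t).im| = ρ)) :
      ∫ t in a..b, (κ (γ t) - s * γ t) • V (γ t) =
        (∫ t in a..b, κ (γ t) • V (γ t)) - s • ∫ t in a..b, γ t • V (γ t) := by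
    have hVc : ContinuousOn (fun t => V (γ t)) (Set.uIcc a b) := by
      intro t ht
      rw [Set.uIcc_of_le hab] at ht
      obtain ⟨h1, h2, h3, h4⟩ := hs t ht
      refine (ContinuousAt.comp (h.diff _ h1 (by linarith) h3 fun h0 => ?_).continuousAt
        hγ.continuousAt).continuousWithinAt
      rw [h0] at h4
      simp only [zero_re, zero_im, abs_zero] at h4
      rcases h4 with h4 | h4 <;> linarith
    have hκc : ContinuousOn (fun t => κ (γ t)) (Set.uIcc a b) := by
      intro t ht
      rw [Set.uIcc_of_le hab] at ht
      exact (ContinuousAt.comp (hκ _ (.inr (hs t ht).2.2.2)) hγ.continuousAt).continuousWithinAt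
    have i1 : IntervalIntegrable (fun t => κ (γ t) • V (γ t)) volume a b :=
      (hκc.smul hVc).intervalIntegrable
    have i2 : IntervalIntegrable (fun t => s • γ t • V (γ t)) volume a b :=
      ((hγ.continuousOn.smul hVc).const_smul s).intervalIntegrable
    rw [← intervalIntegral.integral_smul, ← intervalIntegral.integral_sub i1 i2]
    refine intervalIntegral.integral_congr fun t _ => ?_
    module
  have s1 := side 0 ρ hρ.le (fun x : ℝ => (x + (-ρ : ℝ) * I : ℂ)) (by fun_prop) fun t ht => by
    simp [ht.1, ht.2, abs_of_pos hρ]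
  have s2 := side 0 ρ hρ.le (fun x : ℝ => (x + (ρ : ℝ) * I : ℂ)) (by fun_prop) fun t ht => by
    simp [ht.1, ht.2, abs_of_pos hρ]
  have s3 := side (-ρ) ρ (by linarith) (fun y : ℝ => ((ρ : ℝ) + y * I : ℂ)) (by fun_prop)
    fun t ht => by
      simpa [hρ.le] using abs_le.2 ht
  have hU (κ' : ℂ → ℂ) (hκ' : ∀ t : ℝ, ContinuousAt κ' (t * I)) :
      IntervalIntegrable (fun y : ℝ => κ' (y * I) • (V (y * I) - V (-(y * I)))) volume 0 ρ := by
    have hc : Continuous fun y : ℝ => κ' (y * I) := continuous_iff_continuousAt.2 fun t =>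
      ContinuousAt.comp (f := fun y : ℝ => (y * I : ℂ)) (hκ' t) (by fun_prop)
    obtain ⟨B, hB⟩ := (isCompact_Icc (a := 0) (b := ρ)).exists_bound_of_continuousOn
      hc.continuousOn
    refine intervalIntegrable_of_bounded_off_countable hρ.le Set.countable_empty (C := B * C)
      (fun t ht _ => hc.continuousAt.smul ?_) fun t ht _ => ?_
    · refine (h.continuousAt_imag (abs_le.2 ⟨by linarith [ht.1], ht.2⟩) ht.1.ne').sub ?_
      have h1 := h.continuousAt_imag (t := -t) (by rw [abs_neg, abs_of_pos ht.1]; exact ht.2)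
        (by simpa using ht.1.ne')
      have h2 := ContinuousAt.comp (f := fun y : ℝ => -y) h1 (by fun_prop)
      simpa [Function.comp_def] using h2
    · rw [norm_smul]
      exact mul_le_mul (hB t ⟨ht.1.le, ht.2⟩) (h.jump t ht.1 ht.2) (norm_nonneg _)
        ((norm_nonneg _).trans (hB t ⟨ht.1.le, ht.2⟩))
  have s4 : ∫ y : ℝ in 0..ρ, (κ (y * I) - s * (y * I)) • (V (y * I) - V (-(y * I))) =
      (∫ y : ℝ in 0..ρ, κ (y * I) • (V (y * I) - V (-(y * I)))) -
        s • ∫ y : ℝ in 0..ρ, ((y : ℂ) * I) • (V (y * I) - V (-(y * I))) := by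
    have i2 : IntervalIntegrable
        (fun y : ℝ => s • ((y : ℂ) * I) • (V (y * I) - V (-(y * I)))) volume 0 ρ :=
      (hU (fun z => z) fun t => continuousAt_id).smul s
    rw [← intervalIntegral.integral_smul, ← intervalIntegral.integral_sub
      (hU κ fun t => hκ _ (.inl (by simp))) i2]
    refine intervalIntegral.integral_congr fun t _ => ?_
    module
  simp only [foldedIntegral]
  rw [s1, s2, s3, s4]
  module

/-- The bound is uniform in `w`: on the outer sides the kernel is bounded, and on the axis its
total mass is. -/
theorem exists_bound_foldedIntegral :
    ∃ W, ∀ w : ℂ, 0 < w.re → w.re ≤ ρ / 2 → |w.im| ≤ ρ / 2 → w.im ≠ 0 →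
      ‖foldedIntegral V ρ (quadrantKernel w)‖ ≤ W := by
  have hρ := h.pos
  obtain ⟨W, hW⟩ := h.exists_bound_sides
  have hW0 : 0 ≤ W := (norm_nonneg _).trans (hW (ρ : ℂ) (by simpa using hρ.le)
    (by simp; linarith) (by simpa using hρ.le) (by simp))
  have hC0 : 0 ≤ C := (norm_nonneg _).trans (h.jump ρ hρ le_rfl)
  refine ⟨8 / ρ * W * |ρ - 0| + 8 / ρ * W * |ρ - 0| + 8 / ρ * W * |ρ - -ρ| + C * (2 * Real.pi),
    fun w hw hw2 hw3 hw4 => ?_⟩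
  have hwa : |w.re| ≤ ρ / 2 := by rwa [abs_of_pos hw]
  have side (a b : ℝ) (hab : a ≤ b) (γ : ℝ → ℂ)
      (hs : ∀ t ∈ Set.Ioc a b, 0 ≤ (γ t).re ∧ (γ t).re ≤ ρ ∧ |(γ t).im| ≤ ρ ∧
        (ρ ≤ (γ t).re ∨ |(γ t).im| = ρ)) :
      ‖∫ t in a..b, quadrantKernel w (γ t) • V (γ t)‖ ≤ 8 / ρ * W * |b - a| := by
    refine intervalIntegral.norm_integral_le_of_norm_le_const fun t ht => ?_
    rw [Set.uIoc_of_le hab] at ht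
    obtain ⟨h1, h2, h3, h4⟩ := hs t ht
    rw [norm_smul]
    exact mul_le_mul (norm_quadrantKernel_le_of_side hρ hwa hw3 h4)
      (hW _ h1 (by linarith) h3 h4) (norm_nonneg _) (by positivity)
  have s1 := side 0 ρ hρ.le (fun x : ℝ => (x + (-ρ : ℝ) * I : ℂ)) fun t ht => by
    simp [ht.1.le, ht.2, abs_of_pos hρ]
  have s2 := side 0 ρ hρ.le (fun x : ℝ => (x + (ρ : ℝ) * I : ℂ)) fun t ht => by
    simp [ht.1.le, ht.2, abs_of_pos hρ]
  have s3 := side (-ρ) ρ (by linarith) (fun y : ℝ => ((ρ : ℝ) + y * I : ℂ)) fun t ht => by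
    simpa [hρ.le] using abs_le.2 ⟨ht.1.le, ht.2⟩
  have s4 : ‖∫ y : ℝ in 0..ρ, quadrantKernel w (y * I) • (V (y * I) - V (-(y * I)))‖ ≤
      C * (2 * Real.pi) := by
    have hcont : Continuous fun y : ℝ => quadrantKernel w (y * I) :=
      continuous_iff_continuousAt.2 fun t =>
        ContinuousAt.comp (f := fun y : ℝ => (y * I : ℂ))
          (differentiableAt_quadrantKernel_of_boundary hρ hw hwa hw3 (.inl (by simp))).continuousAt
          (by fun_prop)
    refine (intervalIntegral.norm_integral_le_of_norm_le hρ.le (g := fun y : ℝ =>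
      C * ‖quadrantKernel w (y * I)‖) (.of_forall fun t ht => ?_)
      ((hcont.norm.const_mul C).intervalIntegrable _ _)).trans ?_
    · rw [norm_smul, mul_comm]
      gcongr
      exact h.jump t ht.1 ht.2
    · rw [intervalIntegral.integral_const_mul]
      gcongr
      exact integral_norm_quadrantKernel_le hw hw4 hρ
  refine (norm_sub_le _ _).trans (add_le_add ((norm_add_le _ _).trans
    (add_le_add ((norm_sub_le _ _).trans (add_le_add s1 s2)) ?_)) ?_)
  · rw [norm_smul, norm_I, one_mul]
    exact s3
  · rw [norm_smul, norm_I, one_mul]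
    exact s4

/-- At the corner, the harmonic function `V z - V (conj z)` is a multiple of `Im (z ^ (-2))` up to
a bounded function. The multiple comes from the linear correction `quadrantKernelSlope`, which is
what Cauchy's formula needs for convergence at the corner. -/
theorem exists_expansion [CompleteSpace E] : ∃ c : E, ∃ C' : ℝ, ∀ w : ℂ, 0 < w.re →
    w.re ≤ ρ / 2 → |w.im| ≤ ρ / 2 →
      ‖V w - V (conj w) - (((w ^ 2)⁻¹).im : ℂ) • c‖ ≤ C' := by
  have hρ := h.pos
  obtain ⟨W, hW⟩ := h.exists_bound_foldedIntegral
  set J := foldedIntegral V ρ (fun z => z) with hJ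
  have hpi : (2 * Real.pi * I : ℂ) ≠ 0 := two_pi_I_ne_zero
  refine ⟨((2 * Real.pi * I : ℂ)⁻¹ * (4 * I)) • J, max (‖(2 * Real.pi * I : ℂ)⁻¹‖ * W) 0,
    fun w hw hw2 hw3 => ?_⟩
  rcases eq_or_ne w.im 0 with h0 | h0
  · have h1 : conj w = w := conj_eq_iff_im.2 h0
    have h2 : ((w ^ 2)⁻¹).im = 0 := by
      rw [← conj_eq_iff_im]
      simp [h1]
    simp [h1, h2]
  · have hwa : |w.re| ≤ ρ / 2 := by rwa [abs_of_pos hw]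
    have e1 := h.rectIntegral_eq hw hw2 hw3
    rw [h.rectIntegral_eq_folded
      (κ := fun z => quadrantKernel w z - quadrantKernelSlope w * z)
      (fun z => by rw [quadrantKernel_neg]; ring)
      (fun t => (differentiableAt_quadrantKernel_of_boundary hρ hw hwa hw3
        (.inl (by simp))).continuousAt.sub (by fun_prop))
      (by positivity) (norm_quadrantKernel_sub_linear_le hw),
      h.foldedIntegral_sub_mul (fun z hz =>
        (differentiableAt_quadrantKernel_of_boundary hρ hw hwa hw3 hz).continuousAt)] at e1
    have e2 : V w - V (conj w) - (((w ^ 2)⁻¹).im : ℂ) • ((2 * Real.pi * I : ℂ)⁻¹ * (4 * I)) • J =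
        (2 * Real.pi * I : ℂ)⁻¹ • foldedIntegral V ρ (quadrantKernel w) := by
      rw [← inv_smul_smul₀ hpi (V w - V (conj w)), ← e1, quadrantKernelSlope]
      module
    rw [e2, norm_smul]
    exact (mul_le_mul_of_nonneg_left (hW w hw hw2 hw3 h0) (norm_nonneg _)).trans (le_max_left _ _)

end IsCornerFunction

end CornerExpansion

/-! ### The jump across the imaginary axis and its maximum principle -/

section MaximumPrinciple

open Complex ComplexConjugate

variable {E : Type*} [NormedAddCommGroup E] [NormedSpace ℂ E]

/-- The jump `w z - w (-conj z)` between a point and its mirror image in the imaginary axis. It is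
a harmonic function of `z` where `w` is holomorphic. -/
def mirrorJump (w : ℂ → E) (z : ℂ) : E := w z - w (-conj z)

/-- For `f = φ ∘ w`, this is a holomorphic function with real part `Re φ (mirrorJump w z)`. -/
theorem differentiableAt_mirror {f : ℂ → ℂ} {z : ℂ} (h1 : DifferentiableAt ℂ f z)
    (h2 : DifferentiableAt ℂ f (-conj z)) :
    DifferentiableAt ℂ (fun z => f z - conj (f (-conj z))) z := by
  have h3 : DifferentiableAt ℂ (fun z => f (-z)) (conj z) :=
    DifferentiableAt.comp (conj z) h2 (by fun_prop)
  have h4 := h3.conj_conj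
  rw [conj_conj] at h4
  exact h1.sub h4

theorem continuousAt_cpow_ofReal_of_nonneg_re {z : ℂ} {ε : ℝ} (hz : 0 ≤ z.re) (hz0 : z ≠ 0) :
    ContinuousAt (fun z : ℂ => z ^ (ε : ℂ)) z := by
  refine continuousAt_id.cpow continuousAt_const ?_
  rcases hz.lt_or_eq with h | h
  · exact .inl h
  · exact .inr fun h' => hz0 (Complex.ext h.symm h')

theorem tendsto_cpow_ofReal_zero {ε : ℝ} (hε : 0 < ε) :
    Tendsto (fun z : ℂ => ‖z ^ (ε : ℂ)‖) (𝓝 0) (𝓝 0) := by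
  simp only [norm_cpow_real]
  have h : ContinuousAt (fun z : ℂ => ‖z‖ ^ ε) 0 :=
    continuous_norm.continuousAt.rpow_const (.inr hε.le)
  have := h.tendsto
  rwa [norm_zero, Real.zero_rpow hε.ne'] at this

/-- Maximum principle in a rectangle with two exceptional boundary points `i p` and `i q`, the
midpoints of two opposite sides. The maximum modulus principle is applied to
`exp (P z) * b₁ z ^ ε * b₂ z ^ ε`, where `Re P = Re φ (mirrorJump w ·)` for a norming functional
`φ`, and `b₁`, `b₂` are linear barriers vanishing at the exceptional points; then `ε → 0`. -/
theorem norm_mirrorJump_le_of_boundary {w : ℂ → E} {p q B B' : ℝ} (hpq : p < q)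
    (hd : ∀ z : ℂ, |z.re| ≤ 1 → p ≤ z.im → z.im ≤ q → z ≠ p * I → z ≠ q * I →
      DifferentiableAt ℂ w z)
    (hbdd : ∀ z : ℂ, |z.re| ≤ 1 → p ≤ z.im → z.im ≤ q → z ≠ p * I → z ≠ q * I →
      ‖mirrorJump w z‖ ≤ B')
    (hbdry : ∀ z : ℂ, |z.re| ≤ 1 → p ≤ z.im → z.im ≤ q → z ≠ p * I → z ≠ q * I →
      (|z.re| = 1 ∨ z.im = p ∨ z.im = q) → ‖mirrorJump w z‖ ≤ B)
    {z : ℂ} (hz1 : |z.re| < 1) (hz2 : p < z.im) (hz3 : z.im < q) : ‖mirrorJump w z‖ ≤ B := by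
  obtain ⟨φ, hφ, hφz⟩ := exists_dual_vector'' ℂ (mirrorJump w z)
  set P : ℂ → ℂ := fun z => φ (w z) - conj (φ (w (-conj z))) with hP
  have hPre : ∀ z, (P z).re = (φ (mirrorJump w z)).re := fun z => by
    simp [hP, mirrorJump]
  have hPle : ∀ z, (P z).re ≤ ‖mirrorJump w z‖ := fun z => by
    rw [hPre]
    refine (re_le_norm _).trans ((φ.le_opNorm _).trans ?_)
    exact mul_le_of_le_one_left (norm_nonneg _) hφ
  have hPz : (P z).re = ‖mirrorJump w z‖ := by rw [hPre, hφz]; simp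
  set L : ℝ := 1 + (q - p) with hL
  have hL0 : 0 < L := by linarith
  set b₁ : ℂ → ℂ := fun z => -I * (z - p * I) / L with hb₁
  set b₂ : ℂ → ℂ := fun z => I * (z - q * I) / L with hb₂
  have hb₁re : ∀ z, (b₁ z).re = (z.im - p) / L := fun z => by
    simp [hb₁, div_ofReal_re]
  have hb₂re : ∀ z, (b₂ z).re = (q - z.im) / L := fun z => by
    simp [hb₂, div_ofReal_re]
  have hb₁0 : ∀ z, b₁ z = 0 ↔ z = p * I := fun z => by
    simp [hb₁, hL0.ne', sub_eq_zero]
  have hb₂0 : ∀ z, b₂ z = 0 ↔ z = q * I := fun z => by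
    simp [hb₂, hL0.ne', sub_eq_zero]
  have hb₁n : ∀ z : ℂ, |z.re| ≤ 1 → p ≤ z.im → z.im ≤ q → ‖b₁ z‖ ≤ 1 := fun z h1 h2 h3 => by
    rw [hb₁]
    simp only [norm_div, norm_mul, norm_neg, norm_I, one_mul, norm_real, Real.norm_eq_abs,
      abs_of_pos hL0]
    rw [div_le_one hL0]
    refine (norm_le_abs_re_add_abs_im _).trans ?_
    simp only [sub_re, mul_re, ofReal_re, I_re, mul_zero, ofReal_im, I_im, mul_one, sub_self,
      sub_zero, sub_im, mul_im, add_zero]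
    rw [abs_of_nonneg (sub_nonneg.2 h2)]
    linarith
  have hb₂n : ∀ z : ℂ, |z.re| ≤ 1 → p ≤ z.im → z.im ≤ q → ‖b₂ z‖ ≤ 1 := fun z h1 h2 h3 => by
    rw [hb₂]
    simp only [norm_div, norm_mul, norm_I, one_mul, norm_real, Real.norm_eq_abs,
      abs_of_pos hL0]
    rw [div_le_one hL0]
    refine (norm_le_abs_re_add_abs_im _).trans ?_
    simp only [sub_re, mul_re, ofReal_re, I_re, mul_zero, ofReal_im, I_im, mul_one, sub_self,
      sub_zero, sub_im, mul_im, add_zero]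
    rw [abs_of_nonpos (sub_nonpos.2 h3)]
    linarith
  have hb₁c : Continuous b₁ := by fun_prop
  have hb₂c : Continuous b₂ := by fun_prop
  set U : Set ℂ := Set.Ioo (-1) 1 ×ℂ Set.Ioo p q with hU
  have hUo : IsOpen U := isOpen_Ioo.reProdIm isOpen_Ioo
  have hUb : Bornology.IsBounded U := (Metric.isBounded_Ioo _ _).reProdIm (Metric.isBounded_Ioo _ _)
  have hUcl : closure U = Set.Icc (-1) 1 ×ℂ Set.Icc p q := by
    rw [hU, closure_reProdIm, closure_Ioo (by norm_num), closure_Ioo hpq.ne]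
  have hPd : ∀ z : ℂ, |z.re| ≤ 1 → p ≤ z.im → z.im ≤ q → z ≠ p * I → z ≠ q * I →
      DifferentiableAt ℂ P z := fun z h1 h2 h3 h4 h5 => by
    have aux (r : ℝ) (hr : z ≠ r * I) : -conj z ≠ r * I := fun h => hr <| by
      have := congrArg (fun z => -conj z) h
      simpa using this
    have e1 := hd z h1 h2 h3 h4 h5
    have e2 := hd (-conj z) (by simpa using h1) (by simpa using h2) (by simpa using h3)
      (aux p h4) (aux q h5)
    exact differentiableAt_mirror (f := fun z => φ (w z))
      (φ.differentiableAt.comp z e1) (φ.differentiableAt.comp _ e2)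
  have hmain : ∀ ε : ℝ, 0 < ε →
      Real.exp ‖mirrorJump w z‖ * (‖b₁ z‖ ^ ε * ‖b₂ z‖ ^ ε) ≤ Real.exp B := by
    intro ε hε
    have hε0 : (ε : ℂ) ≠ 0 := ofReal_ne_zero.2 hε.ne'
    set G : ℂ → ℂ := fun z => exp (P z) * (b₁ z ^ (ε : ℂ) * b₂ z ^ (ε : ℂ)) with hG
    have hGn : ∀ z, ‖G z‖ = Real.exp (P z).re * (‖b₁ z‖ ^ ε * ‖b₂ z‖ ^ ε) := fun z => by
      simp only [hG, norm_mul, norm_exp, norm_cpow_real]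
    have hG0 : ∀ z : ℂ, (z = p * I ∨ z = q * I) → G z = 0 := by
      rintro z (h | h)
      · simp only [hG, (hb₁0 z).2 h, zero_cpow hε0, zero_mul, mul_zero]
      · simp only [hG, (hb₂0 z).2 h, zero_cpow hε0, mul_zero]
    have hGle : ∀ z : ℂ, |z.re| ≤ 1 → p ≤ z.im → z.im ≤ q → ∀ A, ‖mirrorJump w z‖ ≤ A →
        ‖G z‖ ≤ Real.exp A := by
      intro z h1 h2 h3 A hA
      rw [hGn]
      calc _ ≤ Real.exp A * (1 * 1) := by
            gcongr
            · exact (hPle z).trans hA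
            · exact Real.rpow_le_one (norm_nonneg _) (hb₁n z h1 h2 h3) hε.le
            · exact Real.rpow_le_one (norm_nonneg _) (hb₂n z h1 h2 h3) hε.le
        _ = _ := by ring
    -- near the exceptional points `G` is dominated by one of the barrier factors
    have hGle₁ : ∀ z : ℂ, |z.re| ≤ 1 → p ≤ z.im → z.im ≤ q →
        ‖G z‖ ≤ Real.exp B' * ‖b₁ z ^ (ε : ℂ)‖ := by
      intro z h1 h2 h3
      by_cases h4 : z = p * I ∨ z = q * I
      · rw [hG0 z h4, norm_zero]; positivity
      · push Not at h4
        rw [hGn, norm_cpow_real]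
        gcongr
        · exact (hPle z).trans (hbdd z h1 h2 h3 h4.1 h4.2)
        · exact mul_le_of_le_one_right (by positivity)
            (Real.rpow_le_one (norm_nonneg _) (hb₂n z h1 h2 h3) hε.le)
    have hGle₂ : ∀ z : ℂ, |z.re| ≤ 1 → p ≤ z.im → z.im ≤ q →
        ‖G z‖ ≤ Real.exp B' * ‖b₂ z ^ (ε : ℂ)‖ := by
      intro z h1 h2 h3
      by_cases h4 : z = p * I ∨ z = q * I
      · rw [hG0 z h4, norm_zero]; positivity
      · push Not at h4
        rw [hGn, norm_cpow_real]
        gcongr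
        · exact (hPle z).trans (hbdd z h1 h2 h3 h4.1 h4.2)
        · exact mul_le_of_le_one_left (by positivity)
            (Real.rpow_le_one (norm_nonneg _) (hb₁n z h1 h2 h3) hε.le)
    have hlim : ∀ (b : ℂ → ℂ) (z₀ : ℂ), Continuous b → b z₀ = 0 →
        Tendsto (fun z => Real.exp B' * ‖b z ^ (ε : ℂ)‖) (𝓝 z₀) (𝓝 0) := by
      intro b z₀ hb h0
      have h1 : Tendsto b (𝓝 z₀) (𝓝 0) := by simpa [h0] using hb.tendsto z₀
      simpa using ((tendsto_cpow_ofReal_zero hε).comp h1).const_mul (Real.exp B')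
    have hGd : DiffContOnCl ℂ G U := by
      constructor
      · intro z hz
        rw [hU, mem_reProdIm] at hz
        obtain ⟨⟨h1, h2⟩, h3, h4⟩ := hz
        have n1 : z ≠ p * I := fun h => by rw [h] at h3; simp at h3
        have n2 : z ≠ q * I := fun h => by rw [h] at h4; simp at h4
        have d1 := hPd z (abs_le.2 ⟨h1.le, h2.le⟩) h3.le h4.le n1 n2
        have d2 : DifferentiableAt ℂ (fun z => b₁ z ^ (ε : ℂ)) z :=
          DifferentiableAt.cpow_const (by fun_prop)
            (.inl (by rw [hb₁re]; exact div_pos (by linarith) hL0))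
        have d3 : DifferentiableAt ℂ (fun z => b₂ z ^ (ε : ℂ)) z :=
          DifferentiableAt.cpow_const (by fun_prop)
            (.inl (by rw [hb₂re]; exact div_pos (by linarith) hL0))
        exact (d1.cexp.mul (d2.mul d3)).differentiableWithinAt
      · rw [hUcl]
        intro z hz
        rw [mem_reProdIm] at hz
        obtain ⟨h1, h3, h4⟩ := hz
        have hev : ∀ᶠ y in 𝓝[Set.Icc (-1) 1 ×ℂ Set.Icc p q] z,
            |y.re| ≤ 1 ∧ p ≤ y.im ∧ y.im ≤ q := by
          filter_upwards [self_mem_nhdsWithin] with y hy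
          exact ⟨abs_le.2 hy.1, hy.2.1, hy.2.2⟩
        by_cases n1 : z = p * I
        · rw [ContinuousWithinAt, hG0 z (.inl n1)]
          refine squeeze_zero_norm' ?_ ((hlim b₁ z hb₁c ((hb₁0 z).2 n1)).mono_left
            nhdsWithin_le_nhds)
          filter_upwards [hev] with y hy
          exact hGle₁ y hy.1 hy.2.1 hy.2.2
        by_cases n2 : z = q * I
        · rw [ContinuousWithinAt, hG0 z (.inr n2)]
          refine squeeze_zero_norm' ?_ ((hlim b₂ z hb₂c ((hb₂0 z).2 n2)).mono_left
            nhdsWithin_le_nhds)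
          filter_upwards [hev] with y hy
          exact hGle₂ y hy.1 hy.2.1 hy.2.2
        have d1 := hPd z (abs_le.2 h1) h3 h4 n1 n2
        have d2 : ContinuousAt (fun z => b₁ z ^ (ε : ℂ)) z :=
          ContinuousAt.comp (f := b₁) (continuousAt_cpow_ofReal_of_nonneg_re
            (by rw [hb₁re]; exact div_nonneg (by linarith) hL0.le)
            (fun h => n1 ((hb₁0 z).1 h))) hb₁c.continuousAt
        have d3 : ContinuousAt (fun z => b₂ z ^ (ε : ℂ)) z :=
          ContinuousAt.comp (f := b₂) (continuousAt_cpow_ofReal_of_nonneg_re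
            (by rw [hb₂re]; exact div_nonneg (by linarith) hL0.le)
            (fun h => n2 ((hb₂0 z).1 h))) hb₂c.continuousAt
        exact (d1.continuousAt.cexp.mul (d2.mul d3)).continuousWithinAt
    have hfr : ∀ y ∈ frontier U, ‖G y‖ ≤ Real.exp B := by
      intro y hy
      rw [hUo.frontier_eq, hUcl] at hy
      obtain ⟨⟨h1, h2⟩, h3⟩ := hy
      by_cases h4 : y = p * I ∨ y = q * I
      · rw [hG0 y h4, norm_zero]; positivity
      push Not at h4
      have h1' := abs_le.2 h1
      refine hGle y h1' h2.1 h2.2 _ (hbdry y h1' h2.1 h2.2 h4.1 h4.2 ?_)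
      by_contra! hcon
      refine h3 ⟨abs_lt.1 (lt_of_le_of_ne h1' hcon.1), lt_of_le_of_ne h2.1 (Ne.symm hcon.2.1),
        lt_of_le_of_ne h2.2 hcon.2.2⟩
    have := norm_le_of_forall_mem_frontier_norm_le hUb hGd hfr
      (subset_closure (show z ∈ U from ⟨abs_lt.1 hz1, hz2, hz3⟩))
    rwa [hGn, hPz] at this
  have hb₁z : ‖b₁ z‖ ≠ 0 := fun h => by
    rw [norm_eq_zero, hb₁0] at h
    rw [h] at hz2; simp at hz2
  have hb₂z : ‖b₂ z‖ ≠ 0 := fun h => by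
    rw [norm_eq_zero, hb₂0] at h
    rw [h] at hz3; simp at hz3
  have hl : Tendsto (fun ε : ℝ => Real.exp ‖mirrorJump w z‖ * (‖b₁ z‖ ^ ε * ‖b₂ z‖ ^ ε)) (𝓝[>] 0)
      (𝓝 (Real.exp ‖mirrorJump w z‖ * (‖b₁ z‖ ^ (0 : ℝ) * ‖b₂ z‖ ^ (0 : ℝ)))) := by
    refine Tendsto.mono_left ?_ nhdsWithin_le_nhds
    refine Tendsto.const_mul _ (Tendsto.mul ?_ ?_)
    · exact (Real.continuous_const_rpow hb₁z).tendsto 0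
    · exact (Real.continuous_const_rpow hb₂z).tendsto 0
  rw [Real.rpow_zero, Real.rpow_zero, mul_one, mul_one] at hl
  refine Real.exp_le_exp.1 (le_of_tendsto hl ?_)
  filter_upwards [self_mem_nhdsWithin] with ε hε
  exact hmain ε hε

end MaximumPrinciple

/-! ### Bounds in the gaps of the singular set -/

section GapBound

open Complex ComplexConjugate

variable {E : Type*} [NormedAddCommGroup E] [NormedSpace ℂ E]

/-- There is no singularity of order two at `i p`, as seen along the diagonal
`η + i (p + σ η)`, `η → 0+`: if the values of `η² (w z - w (-conj z))` there converge quadratically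
to a vector, then this vector is zero. -/
def HasNoDoublePole (w : ℂ → E) (p σ : ℝ) : Prop :=
  ∀ c : E, (∃ C : ℝ, ∀ᶠ η : ℝ in 𝓝[>] 0,
    ‖((η : ℂ) ^ 2) • mirrorJump w (η + ((p + σ * η : ℝ) : ℂ) * I) - c‖ ≤ C * η ^ 2) → c = 0

theorem mirrorJump_neg_conj {E : Type*} [NormedAddCommGroup E] (w : ℂ → E) (z : ℂ) :
    mirrorJump w (-conj z) = -mirrorJump w z := by
  simp [mirrorJump]

theorem mirrorJump_comp_neg {E : Type*} [NormedAddCommGroup E] (w : ℂ → E) (z : ℂ) :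
    mirrorJump (fun z => w (-z)) z = mirrorJump w (-z) := by
  simp [mirrorJump]

theorem HasNoDoublePole.comp_neg {w : ℂ → E} {p : ℝ} (h : HasNoDoublePole w p (-1)) :
    HasNoDoublePole (fun z => w (-z)) (-p) 1 := by
  rintro c ⟨C, hC⟩
  rw [← neg_eq_zero]
  refine h (-c) ⟨C, hC.mono fun η hη => ?_⟩
  have e : (-((η : ℂ) + ((-p + 1 * η : ℝ) : ℂ) * I)) =
      -conj ((η : ℂ) + ((p + -1 * η : ℝ) : ℂ) * I) := by
    simp only [map_add, map_mul, conj_ofReal, conj_I]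
    push_cast
    ring
  rw [mirrorJump_comp_neg, e, mirrorJump_neg_conj] at hη
  rw [← norm_neg]
  refine (congrArg norm ?_).trans_le hη
  module

variable [CompleteSpace E]

/-- Above a corner `i p` without double pole, the jump is bounded. After rotating the corner to the
origin, the leading term `Im (z ^ (-2))` equals `-1 / (2 η²)` on the diagonal `z = η + i η`, so its
coefficient is the one excluded by `HasNoDoublePole`. -/
theorem exists_bound_mirrorJump_above {w : ℂ → E} {p ρ C : ℝ} (hρ : 0 < ρ)
    (hd : ∀ z : ℂ, |z.re| ≤ ρ → p ≤ z.im → z.im ≤ p + 2 * ρ → z ≠ p * I → DifferentiableAt ℂ w z)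
    (hg : ∀ z : ℂ, |z.re| ≤ ρ → |z.re| ^ 3 * ‖w z‖ ≤ C)
    (hs : ∀ t : ℝ, 0 < |t| → |t| ≤ ρ → ‖mirrorJump w (t + p * I)‖ ≤ C)
    (hp : HasNoDoublePole w p 1) :
    ∃ C' : ℝ, ∀ z : ℂ, |z.re| ≤ ρ / 2 → p < z.im → z.im ≤ p + ρ / 2 → ‖mirrorJump w z‖ ≤ C' := by
  have hre : ∀ z : ℂ, (I * z + p * I).re = -z.im := fun z => by simp
  have him : ∀ z : ℂ, (I * z + p * I).im = p + z.re := fun z => by simp [add_comm]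
  have hconj : ∀ z : ℂ, I * conj z + p * I = -conj (I * z + p * I) := fun z => by
    simp only [map_add, map_mul, conj_ofReal, conj_I]
    ring
  have hV : IsCornerFunction (fun z => w (I * z + p * I)) ρ C := by
    refine ⟨hρ, fun z h1 h2 h3 h4 => ?_, fun z h1 h2 h3 => ?_, fun t h1 h2 => ?_⟩
    · refine DifferentiableAt.comp (f := fun z => I * z + p * I) z (hd _ ?_ ?_ ?_ ?_) (by fun_prop)
      · rwa [hre, abs_neg]
      · rw [him]; linarith
      · rw [him]; linarith
      · simpa using h4
    · have := hg (I * z + p * I) (by rwa [hre, abs_neg])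
      rwa [hre, abs_neg] at this
    · have e1 : I * (t * I) + p * I = ((-t : ℝ) : ℂ) + p * I := by
        push_cast; linear_combination (t : ℂ) * I_sq
      have e2 : I * (-(t * I)) + p * I = -conj (((-t : ℝ) : ℂ) + p * I) := by
        simp only [map_add, map_mul, conj_ofReal, conj_I]
        push_cast; linear_combination (-t : ℂ) * I_sq
      have := hs (-t) (by rwa [abs_neg, abs_of_pos h1]) (by rwa [abs_neg, abs_of_pos h1])
      simp only [e1, e2]
      exact this
  obtain ⟨c, C', hC'⟩ := hV.exists_expansion
  have hc : c = 0 := by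
    have h2 : (2 : ℂ)⁻¹ • c = 0 := by
      refine hp _ ⟨C', ?_⟩
      filter_upwards [Ioc_mem_nhdsGT (half_pos hρ)] with η hη
      have e1 : ((((η : ℂ) + η * I) ^ 2)⁻¹).im = -(2 * η ^ 2)⁻¹ := by
        have : ((η : ℂ) + η * I) ^ 2 = ((2 * η ^ 2 : ℝ) : ℂ) * I := by
          push_cast; linear_combination (η : ℂ) ^ 2 * I_sq
        rw [this, mul_inv, inv_I, ← ofReal_inv, mul_neg, neg_im, im_ofReal_mul, I_im, mul_one]
      have := hC' (η + η * I) (by simpa using hη.1) (by simpa using hη.2)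
        (by simpa [abs_of_pos hη.1] using hη.2)
      have e2 : I * ((η : ℂ) + η * I) + p * I =
          -conj ((η : ℂ) + ((p + 1 * η : ℝ) : ℂ) * I) := by
        simp only [map_add, map_mul, conj_ofReal, conj_I]
        push_cast; linear_combination (η : ℂ) * I_sq
      have e3 : I * conj ((η : ℂ) + η * I) + p * I =
          (η : ℂ) + ((p + 1 * η : ℝ) : ℂ) * I := by
        simp only [map_add, map_mul, conj_ofReal, conj_I]
        push_cast; linear_combination (-η : ℂ) * I_sq
      rw [e1, e2, e3] at this
      have hη0 : (η : ℂ) ≠ 0 := ofReal_ne_zero.2 hη.1.ne'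
      have e4 : ((η : ℂ) ^ 2) • mirrorJump w (η + ((p + 1 * η : ℝ) : ℂ) * I) - (2 : ℂ)⁻¹ • c =
          -((η : ℂ) ^ 2) • (w (-conj ((η : ℂ) + ((p + 1 * η : ℝ) : ℂ) * I)) -
            w ((η : ℂ) + ((p + 1 * η : ℝ) : ℂ) * I) - ((-(2 * η ^ 2)⁻¹ : ℝ) : ℂ) • c) := by
        rw [mirrorJump, smul_sub (-((η : ℂ) ^ 2)), smul_smul (-((η : ℂ) ^ 2))]
        have : -((η : ℂ) ^ 2) * ((-(2 * η ^ 2)⁻¹ : ℝ) : ℂ) = (2 : ℂ)⁻¹ := by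
          push_cast
          field_simp
        rw [this]
        module
      rw [e4, norm_smul, norm_neg, norm_pow, norm_real, Real.norm_eq_abs, sq_abs, mul_comm]
      gcongr
    simpa using h2
  refine ⟨C', fun z h1 h2 h3 => ?_⟩
  have e : I * (-I * (z - p * I)) + p * I = z := by
    linear_combination (-(z - p * I)) * I_sq
  have := hC' (-I * (z - p * I)) (by simpa using h2) (by simp; linarith) (by simpa using h1)
  rw [hc, smul_zero, sub_zero] at this
  simp only [hconj, e] at this
  exact this

theorem exists_bound_mirrorJump_below {w : ℂ → E} {p ρ C : ℝ} (hρ : 0 < ρ)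
    (hd : ∀ z : ℂ, |z.re| ≤ ρ → p - 2 * ρ ≤ z.im → z.im ≤ p → z ≠ p * I → DifferentiableAt ℂ w z)
    (hg : ∀ z : ℂ, |z.re| ≤ ρ → |z.re| ^ 3 * ‖w z‖ ≤ C)
    (hs : ∀ t : ℝ, 0 < |t| → |t| ≤ ρ → ‖mirrorJump w (t + p * I)‖ ≤ C)
    (hp : HasNoDoublePole w p (-1)) :
    ∃ C' : ℝ, ∀ z : ℂ, |z.re| ≤ ρ / 2 → p - ρ / 2 ≤ z.im → z.im < p → ‖mirrorJump w z‖ ≤ C' := by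
  obtain ⟨C', hC'⟩ := exists_bound_mirrorJump_above (w := fun z => w (-z)) (p := -p) (C := C) hρ
    (fun z h1 h2 h3 h4 => DifferentiableAt.comp (f := fun z : ℂ => -z) z
      (hd _ (by simpa using h1) (by rw [neg_im]; linarith) (by rw [neg_im]; linarith)
        fun h => h4 (by rw [← neg_neg z, h]; push_cast; ring)) (by fun_prop))
    (fun z h1 => by simpa using hg (-z) (by simpa using h1))
    (fun t h1 h2 => by
      rw [mirrorJump_comp_neg]
      have := hs (-t) (by simpa using h1) (by simpa using h2)
      convert this using 3
      push_cast; ring)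
    hp.comp_neg
  refine ⟨C', fun z h1 h2 h3 => ?_⟩
  have := hC' (-z) (by simpa using h1) (by simpa using h3) (by rw [neg_im]; linarith)
  rwa [mirrorJump_comp_neg, neg_neg] at this

/-- In a gap `i (p, q)` of the singular set the jump is bounded by its bound on the boundary of the
rectangle `[-1, 1] × [p, q]`. That it is bounded at all, which the maximum principle requires, comes
from the corner bounds at `i p` and `i q` and from compactness elsewhere. -/
theorem norm_mirrorJump_le_of_gap {w : ℂ → E} {p q B C : ℝ} (hpq : p < q)
    (hd : ∀ z : ℂ, |z.re| ≤ 1 → p ≤ z.im → z.im ≤ q → z ≠ p * I → z ≠ q * I →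
      DifferentiableAt ℂ w z)
    (hg : ∀ z : ℂ, |z.re| ≤ 1 → |z.re| ^ 3 * ‖w z‖ ≤ C)
    (hbdry : ∀ z : ℂ, 0 < |z.re| → |z.re| ≤ 1 → p ≤ z.im → z.im ≤ q →
      (|z.re| = 1 ∨ z.im = p ∨ z.im = q) → ‖mirrorJump w z‖ ≤ B)
    (hp : HasNoDoublePole w p 1) (hq : HasNoDoublePole w q (-1))
    {z : ℂ} (hz1 : |z.re| < 1) (hz2 : p < z.im) (hz3 : z.im < q) : ‖mirrorJump w z‖ ≤ B := by
  set ρ : ℝ := min 1 ((q - p) / 4) with hρdef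
  have hρ : 0 < ρ := lt_min one_pos (by linarith)
  have hρ1 : ρ ≤ 1 := min_le_left _ _
  have hρ2 : ρ ≤ (q - p) / 4 := min_le_right _ _
  obtain ⟨C₁, hC₁⟩ := exists_bound_mirrorJump_above (w := w) (p := p) (C := max B C) hρ
    (fun z h1 h2 h3 h4 => hd z (h1.trans hρ1) h2 (by linarith) h4 fun h => by
      rw [h] at h3; simp at h3; linarith)
    (fun z h1 => (hg z (h1.trans hρ1)).trans (le_max_right _ _))
    (fun t h1 h2 => (hbdry _ (by simpa using h1) (by simpa using h2.trans hρ1) (by simp)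
      (by simpa using hpq.le) (by simp)).trans (le_max_left _ _)) hp
  obtain ⟨C₂, hC₂⟩ := exists_bound_mirrorJump_below (w := w) (p := q) (C := max B C) hρ
    (fun z h1 h2 h3 h4 => hd z (h1.trans hρ1) (by linarith) h3 (fun h => by
      rw [h] at h2; simp at h2; linarith) h4)
    (fun z h1 => (hg z (h1.trans hρ1)).trans (le_max_right _ _))
    (fun t h1 h2 => (hbdry _ (by simpa using h1) (by simpa using h2.trans hρ1)
      (by simpa using hpq.le) (by simp) (by simp)).trans (le_max_left _ _)) hq
  have hK : IsCompact ((Set.Icc (-1 : ℝ) 1 ×ℂ Set.Icc p q) ∩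
      ({z : ℂ | ρ / 2 ≤ |z.re|} ∪ {z : ℂ | p + ρ / 2 ≤ z.im ∧ z.im ≤ q - ρ / 2})) := by
    refine (isCompact_Icc.reProdIm isCompact_Icc).inter_right (IsClosed.union ?_ ?_)
    · exact isClosed_le continuous_const continuous_re.abs
    · exact (isClosed_le continuous_const continuous_im).inter
        (isClosed_le continuous_im continuous_const)
  have hmir : ∀ z : ℂ, (-conj z).re = -z.re ∧ (-conj z).im = z.im := fun z => by simp
  have hcont : ∀ z ∈ ((Set.Icc (-1 : ℝ) 1 ×ℂ Set.Icc p q) ∩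
      ({z : ℂ | ρ / 2 ≤ |z.re|} ∪ {z : ℂ | p + ρ / 2 ≤ z.im ∧ z.im ≤ q - ρ / 2})),
      ContinuousAt w z := by
    rintro z ⟨⟨h1, h2⟩, h3⟩
    refine (hd z (abs_le.2 h1) h2.1 h2.2 ?_ ?_).continuousAt
    · rintro rfl
      rcases h3 with h3 | h3
      · simp at h3; linarith
      · simp at h3; linarith [h3.1]
    · rintro rfl
      rcases h3 with h3 | h3
      · simp at h3; linarith
      · simp at h3; linarith [h3.2]
  obtain ⟨C₃, hC₃⟩ := hK.exists_bound_of_continuousOn (f := w)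
    fun z hz => (hcont z hz).continuousWithinAt
  refine norm_mirrorJump_le_of_boundary (B' := max B (max (max C₁ C₂) (C₃ + C₃))) hpq hd ?_ ?_
    hz1 hz2 hz3
  · intro z h1 h2 h3 h4 h5
    by_cases hK' : ρ / 2 ≤ |z.re| ∨ (p + ρ / 2 ≤ z.im ∧ z.im ≤ q - ρ / 2)
    · refine le_max_of_le_right (le_max_of_le_right ((norm_sub_le _ _).trans (add_le_add ?_ ?_)))
      · exact hC₃ z ⟨⟨abs_le.1 h1, h2, h3⟩, hK'⟩
      · refine hC₃ _ ⟨⟨?_, ?_⟩, ?_⟩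
        · rw [Set.mem_preimage, (hmir z).1]
          exact abs_le.1 (by rwa [abs_neg])
        · rw [Set.mem_preimage, (hmir z).2]
          exact ⟨h2, h3⟩
        · change ρ / 2 ≤ |(-conj z).re| ∨ _ ≤ (-conj z).im ∧ (-conj z).im ≤ _
          rwa [(hmir z).1, (hmir z).2, abs_neg]
    · push Not at hK'
      obtain ⟨h6, h7⟩ := hK'
      by_cases h8 : z.im = p ∨ z.im = q
      · refine le_max_of_le_left (hbdry z ?_ h1 h2 h3 (.inr h8))
        rw [abs_pos]
        intro h9
        rcases h8 with h8 | h8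
        · exact h4 (Complex.ext (by simpa using h9) (by simpa using h8))
        · exact h5 (Complex.ext (by simpa using h9) (by simpa using h8))
      push Not at h8
      refine le_max_of_le_right (le_max_of_le_left ?_)
      rcases lt_or_ge z.im (p + ρ / 2) with h9 | h9
      · exact le_max_of_le_left (hC₁ z h6.le (lt_of_le_of_ne h2 (Ne.symm h8.1)) h9.le)
      · exact le_max_of_le_right (hC₂ z h6.le (h7 h9).le (lt_of_le_of_ne h3 h8.2))
  · intro z h1 h2 h3 h4 h5 h6
    refine hbdry z ?_ h1 h2 h3 h6
    rcases h6 with h6 | h8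
    · rw [h6]; exact one_pos
    · rw [abs_pos]
      intro h9
      rcases h8 with h8 | h8
      · exact h4 (Complex.ext (by simpa using h9) (by simpa using h8))
      · exact h5 (Complex.ext (by simpa using h9) (by simpa using h8))

end GapBound

/-! ### Holomorphic extension across the imaginary axis -/

section Extension

open Complex ComplexConjugate MeasureTheory

variable {E : Type*} [NormedAddCommGroup E] [NormedSpace ℂ E]

theorem differentiableOn_cauchyTransform {a b : ℝ} {γ : ℝ → ℂ} {k : ℝ → E}
    (hk : IntervalIntegrable k volume a b) (hγ : Continuous γ) {U : Set ℂ} (hU : IsOpen U)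
    (hγU : ∀ t ∈ Set.uIcc a b, γ t ∉ U) :
    DifferentiableOn ℂ (fun l => ∫ t in a..b, (γ t - l)⁻¹ • k t) U := by
  intro l hl
  obtain ⟨r, hr, hrU⟩ := Metric.isOpen_iff.1 hU l hl
  have hfar : ∀ t ∈ Set.uIoc a b, ∀ m ∈ Metric.ball l (r / 2), r / 2 ≤ ‖γ t - m‖ := by
    intro t ht m hm
    have h1 : r ≤ dist (γ t) l := by
      by_contra! h
      exact hγU t (Set.uIoc_subset_uIcc ht) (hrU h)
    have h2 := dist_triangle (γ t) m l
    rw [Metric.mem_ball] at hm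
    rw [← dist_eq_norm]
    linarith
  have hmeas (m : ℂ) : AEStronglyMeasurable (fun t => (γ t - m)⁻¹)
      (volume.restrict (Set.uIoc a b)) :=
    (hγ.measurable.sub_const m).inv.aestronglyMeasurable
  have hkm : AEStronglyMeasurable k (volume.restrict (Set.uIoc a b)) :=
    (intervalIntegrable_iff.1 hk).aestronglyMeasurable
  have hl' : l ∈ Metric.ball l (r / 2) := Metric.mem_ball_self (half_pos hr)
  refine (intervalIntegral.hasDerivAt_integral_of_dominated_loc_of_deriv_le
    (F := fun l t => (γ t - l)⁻¹ • k t) (F' := fun l t => (((γ t - l) ^ 2)⁻¹) • k t)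
    (bound := fun t => ((r / 2) ^ 2)⁻¹ * ‖k t‖) (Metric.ball_mem_nhds l (half_pos hr))
    (.of_forall fun m => (hmeas m).smul hkm) ?_ ?_ ?_ (hk.norm.const_mul _)
    ?_).2.differentiableAt.differentiableWithinAt
  · refine (hk.norm.const_mul ((r / 2)⁻¹)).mono_fun ((hmeas l).smul hkm) ?_
    filter_upwards [ae_restrict_mem measurableSet_uIoc] with t ht
    rw [norm_smul, norm_inv, norm_mul, norm_norm, Real.norm_eq_abs,
      abs_of_pos (inv_pos.2 (half_pos hr))]
    gcongr
    exact hfar t ht l hl'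
  · have := (hmeas l).pow 2
    refine AEStronglyMeasurable.smul ?_ hkm
    simpa [Pi.pow_def] using this
  · refine .of_forall fun t ht m hm => ?_
    rw [norm_smul, norm_inv, norm_pow]
    gcongr
    exact hfar t ht m hm
  · refine .of_forall fun t ht m hm => ?_
    have h0 : γ t - m ≠ 0 := norm_pos_iff.1 (lt_of_lt_of_le (half_pos hr) (hfar t ht m hm))
    have h1 : HasDerivAt (fun m => γ t - m) (-1) m := (hasDerivAt_id m).const_sub (γ t)
    have h2 := (h1.fun_inv h0).smul_const (k t)
    simpa using h2

/-- A polynomial vanishing to fourth order at `i a` and `i b`; it compensates growth of order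
three at these points. -/
noncomputable def cutoff (a b : ℝ) (z : ℂ) : ℂ := ((z - a * I) * (z - b * I)) ^ 4

theorem continuous_cutoff (a b : ℝ) : Continuous (cutoff a b) := by
  unfold cutoff; fun_prop

theorem cutoff_neg (a b : ℝ) (z : ℂ) : cutoff (-b) (-a) (-z) = cutoff a b z := by
  unfold cutoff
  push_cast
  ring

/-- The Cauchy integral of `cutoff a b • W` over the three sides of the rectangle
`[0, 1/2] × [a, b]` which are not on the imaginary axis. -/
noncomputable def sideTransform (W : ℂ → E) (a b : ℝ) (l : ℂ) : E :=
  (∫ x : ℝ in 0..(1 / 2 : ℝ),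
      (((x + a * I : ℂ) - l)⁻¹ * cutoff a b (x + a * I)) • W (x + a * I)) -
    (∫ x : ℝ in 0..(1 / 2 : ℝ),
      (((x + b * I : ℂ) - l)⁻¹ * cutoff a b (x + b * I)) • W (x + b * I)) +
    I • (∫ y : ℝ in a..b, (((((1 / 2 : ℝ) : ℂ) + y * I) - l)⁻¹ *
      cutoff a b (((1 / 2 : ℝ) : ℂ) + y * I)) • W (((1 / 2 : ℝ) : ℂ) + y * I))

/-- `W` is holomorphic in the right half-plane, with growth of order three at the imaginary
axis. -/
structure HasCubicGrowth (W : ℂ → E) (C : ℝ) : Prop where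
  diff : ∀ z : ℂ, 0 < z.re → DifferentiableAt ℂ W z
  growth : ∀ z : ℂ, 0 < z.re → z.re ≤ 1 → z.re ^ 3 * ‖W z‖ ≤ C

namespace HasCubicGrowth

variable {W : ℂ → E} {C : ℝ} (hW : HasCubicGrowth W C)
include hW

theorem norm_cutoff_smul_le_horizontal {a b : ℝ} {x ε : ℝ} {y : ℝ} (hy : y = a ∨ y = b)
    (hx : 0 < x) (hx' : x ≤ 1 / 2) (hε : 0 ≤ ε) (hε' : ε ≤ 1 / 2) :
    ‖cutoff a b (x + y * I) • W (x + y * I + ε)‖ ≤ (1 + |b - a|) ^ 4 * C := by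
  have h1 : ‖cutoff a b (x + y * I)‖ ≤ (1 + |b - a|) ^ 4 * x ^ 3 := by
    have key : ‖((x : ℂ) + y * I - a * I) * (x + y * I - b * I)‖ ≤ x * (1 + |b - a|) := by
      have aux (r : ℝ) (hr : |r| = |b - a|) : ‖(x : ℂ) + r * I‖ ≤ 1 + |b - a| := by
        refine (norm_add_le _ _).trans ?_
        rw [norm_mul, norm_I, norm_real, norm_real, mul_one, Real.norm_eq_abs, Real.norm_eq_abs,
          hr, abs_of_pos hx]
        linarith
      rcases hy with rfl | rfl
      · have e : (x : ℂ) + y * I - b * I = x + ((y - b : ℝ) : ℂ) * I := by push_cast; ring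
        rw [norm_mul, add_sub_cancel_right, e, norm_real, Real.norm_eq_abs, abs_of_pos hx]
        gcongr
        exact aux _ (abs_sub_comm _ _)
      · have e : (x : ℂ) + y * I - a * I = x + ((y - a : ℝ) : ℂ) * I := by push_cast; ring
        rw [norm_mul, add_sub_cancel_right, e, norm_real, Real.norm_eq_abs, abs_of_pos hx,
          mul_comm]
        gcongr
        exact aux _ rfl
    rw [cutoff, norm_pow]
    calc _ ≤ (x * (1 + |b - a|)) ^ 4 := by gcongr
      _ = (1 + |b - a|) ^ 4 * x ^ 3 * x := by ring
      _ ≤ (1 + |b - a|) ^ 4 * x ^ 3 * 1 := by gcongr; linarith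
      _ = _ := by ring
  have h2 := hW.growth (x + y * I + ε) (by simp; linarith) (by simp; linarith)
  have h3 : ((x : ℂ) + y * I + ε).re = x + ε := by simp
  rw [h3] at h2
  rw [norm_smul]
  calc _ ≤ (1 + |b - a|) ^ 4 * x ^ 3 * ‖W (x + y * I + ε)‖ := by gcongr
    _ ≤ (1 + |b - a|) ^ 4 * ((x + ε) ^ 3 * ‖W (x + y * I + ε)‖) := by
        rw [mul_assoc]
        gcongr
        linarith
    _ ≤ _ := by gcongr

theorem norm_le_vertical {y ε : ℝ} (hε : 0 ≤ ε) (hε' : ε ≤ 1 / 2) :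
    ‖W (((1 / 2 : ℝ) : ℂ) + y * I + ε)‖ ≤ 8 * C := by
  have h2 := hW.growth (((1 / 2 : ℝ) : ℂ) + y * I + ε) (by simp; linarith) (by simp; linarith)
  have h3 : (((1 / 2 : ℝ) : ℂ) + y * I + ε).re = 1 / 2 + ε := by simp
  rw [h3] at h2
  have h4 : (1 / 2 : ℝ) ^ 3 ≤ (1 / 2 + ε) ^ 3 := by gcongr; linarith
  nlinarith [norm_nonneg (W (((1 / 2 : ℝ) : ℂ) + y * I + ε))]

theorem differentiableOn_sideTransform {a b : ℝ} (hab : a ≤ b) :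
    DifferentiableOn ℂ (sideTransform W a b) (Set.Ioo (-(1 / 2)) (1 / 2) ×ℂ Set.Ioo a b) := by
  have hU : IsOpen (Set.Ioo (-(1 / 2) : ℝ) (1 / 2) ×ℂ Set.Ioo a b) :=
    isOpen_Ioo.reProdIm isOpen_Ioo
  have hor (y : ℝ) (hy : y = a ∨ y = b) : DifferentiableOn ℂ (fun l : ℂ =>
      ∫ x : ℝ in 0..(1 / 2 : ℝ),
      (((x + y * I : ℂ) - l)⁻¹ * cutoff a b (x + y * I)) • W (x + y * I))
      (Set.Ioo (-(1 / 2) : ℝ) (1 / 2) ×ℂ Set.Ioo a b) := by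
    simp only [mul_smul]
    refine differentiableOn_cauchyTransform
      (k := fun x : ℝ => cutoff a b (x + y * I) • W (x + y * I)) ?_ (by fun_prop) hU ?_
    · refine intervalIntegrable_of_bounded_off_countable (by norm_num) Set.countable_empty
        (C := (1 + |b - a|) ^ 4 * C) (fun t ht _ => ?_) fun t ht _ => ?_
      · have hc : ContinuousAt (fun x : ℝ => (x + y * I : ℂ)) t := by fun_prop
        exact ((continuous_cutoff a b).continuousAt.comp hc).smul
          ((hW.diff _ (by simpa using ht.1)).continuousAt.comp hc)
      · simpa using hW.norm_cutoff_smul_le_horizontal hy ht.1 ht.2 le_rfl (by norm_num)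
    · rintro t _ ⟨_, h⟩
      rcases hy with rfl | rfl
      · simp at h
      · simp at h
  have ver : DifferentiableOn ℂ (fun l : ℂ =>
      ∫ y : ℝ in a..b, (((((1 / 2 : ℝ) : ℂ) + y * I) - l)⁻¹ *
      cutoff a b (((1 / 2 : ℝ) : ℂ) + y * I)) • W (((1 / 2 : ℝ) : ℂ) + y * I))
      (Set.Ioo (-(1 / 2) : ℝ) (1 / 2) ×ℂ Set.Ioo a b) := by
    simp only [mul_smul]
    refine differentiableOn_cauchyTransform
      (k := fun y : ℝ => cutoff a b (((1 / 2 : ℝ) : ℂ) + y * I) •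
        W (((1 / 2 : ℝ) : ℂ) + y * I)) ?_ (by fun_prop) hU ?_
    · refine ContinuousOn.intervalIntegrable fun t _ => ContinuousAt.continuousWithinAt ?_
      have hc : ContinuousAt (fun y : ℝ => (((1 / 2 : ℝ) : ℂ) + y * I : ℂ)) t := by fun_prop
      exact ((continuous_cutoff a b).continuousAt.comp hc).smul
        (ContinuousAt.comp (hW.diff _ (by simp)).continuousAt hc)
    · rintro t _ ⟨h, _⟩
      simp at h
  exact ((hor a (.inl rfl)).sub (hor b (.inr rfl))).add (ver.const_smul I)

/-- Cauchy's formula for `cutoff a b • W (· + ε)` in the rectangle `[0, 1/2] × [a, b]`, in the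
limit `ε → 0+`. -/
theorem tendsto_integral_imag_axis [CompleteSpace E] {a b : ℝ} (hab : a < b) {l : ℂ}
    (hl : |l.re| < 1 / 2) (hl0 : l.re ≠ 0) (hla : a < l.im) (hlb : l.im < b) :
    Tendsto (fun ε : ℝ => I • ∫ y : ℝ in a..b,
        (((y * I : ℂ) - l)⁻¹ * cutoff a b (y * I)) • W (y * I + ε)) (𝓝[>] 0)
      (𝓝 (sideTransform W a b l -
        if 0 < l.re then (2 * Real.pi * I : ℂ) • cutoff a b l • W l else 0)) := by
  have hl' := abs_lt.1 hl
  have hdist (z : ℂ) (hz : z.re = 1 / 2 ∨ z.im = a ∨ z.im = b) : z - l ≠ 0 := by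
    intro h
    rw [sub_eq_zero] at h
    subst h
    rcases hz with h | h | h <;> linarith
  -- the sides away from the imaginary axis
  have hor (y : ℝ) (hy : y = a ∨ y = b) : Tendsto (fun ε : ℝ =>
      ∫ x : ℝ in 0..(1 / 2 : ℝ),
        (((x + y * I : ℂ) - l)⁻¹ * cutoff a b (x + y * I)) • W (x + y * I + ε)) (𝓝[>] 0)
      (𝓝 (∫ x : ℝ in 0..(1 / 2 : ℝ),
        (((x + y * I : ℂ) - l)⁻¹ * cutoff a b (x + y * I)) • W (x + y * I))) := by
    have hc : Continuous (fun x : ℝ => (x + y * I : ℂ)) := by fun_prop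
    have hinv : Continuous (fun x : ℝ => ((x + y * I : ℂ) - l)⁻¹) :=
      Continuous.inv₀ (by fun_prop) fun x => hdist _ (by
        rcases hy with rfl | rfl <;> simp)
    obtain ⟨D, hD⟩ := (isCompact_Icc (a := 0) (b := (1 / 2 : ℝ))).exists_bound_of_continuousOn
      hinv.continuousOn
    refine tendsto_integral_shift (by norm_num) (r := 1 / 2) (by norm_num) hc Set.countable_empty
      (κ := fun x : ℝ => ((x + y * I : ℂ) - l)⁻¹ * cutoff a b (x + y * I))
      (C := D * ((1 + |b - a|) ^ 4 * C))
      (fun t _ _ => (hinv.mul ((continuous_cutoff a b).comp hc)).continuousAt)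
      (fun t ht _ ε hε _ => (hW.diff _ ?_).continuousAt) (fun t ht _ ε hε hε' => ?_)
    · simp only [add_re, ofReal_re, mul_re, I_re, mul_zero, ofReal_im, I_im, mul_one, sub_self,
        add_zero]
      linarith [ht.1]
    · rw [mul_smul, norm_smul]
      exact mul_le_mul (hD t ⟨ht.1.le, ht.2⟩)
        (hW.norm_cutoff_smul_le_horizontal hy ht.1 ht.2 hε.le hε'.le) (norm_nonneg _)
        ((norm_nonneg _).trans (hD t ⟨ht.1.le, ht.2⟩))
  have ver : Tendsto (fun ε : ℝ =>
      ∫ y : ℝ in a..b, (((((1 / 2 : ℝ) : ℂ) + y * I) - l)⁻¹ *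
        cutoff a b (((1 / 2 : ℝ) : ℂ) + y * I)) • W (((1 / 2 : ℝ) : ℂ) + y * I + ε)) (𝓝[>] 0)
      (𝓝 (∫ y : ℝ in a..b, (((((1 / 2 : ℝ) : ℂ) + y * I) - l)⁻¹ *
        cutoff a b (((1 / 2 : ℝ) : ℂ) + y * I)) • W (((1 / 2 : ℝ) : ℂ) + y * I))) := by
    have hc : Continuous (fun y : ℝ => (((1 / 2 : ℝ) : ℂ) + y * I : ℂ)) := by fun_prop
    have hinv : Continuous (fun y : ℝ => ((((1 / 2 : ℝ) : ℂ) + y * I) - l)⁻¹ *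
        cutoff a b (((1 / 2 : ℝ) : ℂ) + y * I)) :=
      (Continuous.inv₀ (by fun_prop) fun x => hdist _ (by simp)).mul
        ((continuous_cutoff a b).comp hc)
    obtain ⟨D, hD⟩ := (isCompact_Icc (a := a) (b := b)).exists_bound_of_continuousOn
      hinv.continuousOn
    refine tendsto_integral_shift hab.le (r := 1 / 2) (by norm_num) hc Set.countable_empty
      (κ := fun y : ℝ => ((((1 / 2 : ℝ) : ℂ) + y * I) - l)⁻¹ *
        cutoff a b (((1 / 2 : ℝ) : ℂ) + y * I))
      (C := D * (8 * C))
      (fun t _ _ => hinv.continuousAt)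
      (fun t ht _ ε hε _ => (hW.diff _ ?_).continuousAt) (fun t ht _ ε hε hε' => ?_)
    · simp only [add_re, ofReal_re, mul_re, I_re, mul_zero, ofReal_im, I_im, mul_one, sub_self,
        add_zero]
      linarith
    · rw [norm_smul]
      exact mul_le_mul (hD t ⟨ht.1.le, ht.2⟩)
        (hW.norm_le_vertical hε.le hε'.le) (norm_nonneg _)
        ((norm_nonneg _).trans (hD t ⟨ht.1.le, ht.2⟩))
  have hside := ((hor a (.inl rfl)).sub (hor b (.inr rfl))).add (ver.const_smul I)
  have hrect : Tendsto (fun ε : ℝ => rectIntegral (fun z => ((z - l)⁻¹ * cutoff a b z) •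
      W (z + ε)) 0 (1 / 2) a b) (𝓝[>] 0)
      (𝓝 (if 0 < l.re then (2 * Real.pi * I : ℂ) • cutoff a b l • W l else 0)) := by
    have hdiff : ∀ ε : ℝ, 0 < ε → ∀ z : ℂ, 0 ≤ z.re →
        DifferentiableAt ℂ (fun z => cutoff a b z • W (z + ε)) z := fun ε hε z hz => by
      refine DifferentiableAt.smul (by unfold cutoff; fun_prop)
        (differentiableAt_comp_add_const.2 (hW.diff _ ?_))
      rw [add_re, ofReal_re]; linarith
    split_ifs with hpos
    · have h1 : Tendsto (fun ε : ℝ => (2 * Real.pi * I : ℂ) • cutoff a b l • W (l + ε)) (𝓝[>] 0)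
          (𝓝 ((2 * Real.pi * I : ℂ) • cutoff a b l • W l)) := by
        have h3 : Tendsto (fun ε : ℝ => l + (ε : ℂ)) (𝓝 0) (𝓝 (l + ((0 : ℝ) : ℂ))) :=
          Continuous.tendsto (by fun_prop) 0
        rw [ofReal_zero, add_zero] at h3
        exact ((((hW.diff l hpos).continuousAt.tendsto.comp h3).mono_left
          nhdsWithin_le_nhds).const_smul _).const_smul _
      refine h1.congr' ?_
      filter_upwards [self_mem_nhdsWithin] with ε hε
      rw [← rectIntegral_cauchy (f := fun z => cutoff a b z • W (z + ε)) (w := l) hpos hl'.2 hla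
        hlb fun z h1 _ _ _ => hdiff ε hε z h1]
      simp only [mul_smul]
    · refine tendsto_const_nhds.congr' ?_
      filter_upwards [self_mem_nhdsWithin] with ε hε
      have hd : ∀ z : ℂ, 0 ≤ z.re →
          DifferentiableAt ℂ (fun z => ((z - l)⁻¹ * cutoff a b z) • W (z + ε)) z := fun z hz => by
        simp only [mul_smul]
        refine DifferentiableAt.smul (DifferentiableAt.inv (by fun_prop) ?_) (hdiff ε hε z hz)
        intro h
        rw [sub_eq_zero] at h
        subst h
        exact hpos (lt_of_le_of_ne hz hl0.symm)
      exact (rectIntegral_eq_zero (by norm_num) hab.le Set.countable_empty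
        (fun z h1 _ _ _ => (hd z h1).continuousAt) (fun z h1 _ _ _ _ => hd z h1)).symm
  refine (hside.sub hrect).congr fun ε => ?_
  simp only [rectIntegral, ofReal_zero, zero_add]
  abel

end HasCubicGrowth

/-- Holomorphy off the imaginary axis, with growth of order three there. -/
structure HasCubicGrowthOffAxis (w : ℂ → E) (C : ℝ) : Prop where
  diff : ∀ z : ℂ, z.re ≠ 0 → DifferentiableAt ℂ w z
  growth : ∀ z : ℂ, |z.re| ≤ 1 → |z.re| ^ 3 * ‖w z‖ ≤ C

namespace HasCubicGrowthOffAxis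

variable {w : ℂ → E} {C : ℝ} (hw : HasCubicGrowthOffAxis w C)
include hw

theorem right : HasCubicGrowth w C :=
  ⟨fun z hz => hw.diff z hz.ne', fun z hz hz' => by
    simpa [abs_of_pos hz] using hw.growth z (by rwa [abs_of_pos hz])⟩

theorem left : HasCubicGrowth (fun z => w (-z)) C :=
  ⟨fun z hz => DifferentiableAt.comp (f := fun z : ℂ => -z) z
      (hw.diff (-z) (by simpa using hz.ne')) (by fun_prop),
    fun z hz hz' => by
      simpa [abs_of_pos hz] using hw.growth (-z) (by simpa [abs_of_pos hz] using hz')⟩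

theorem continuous_line {α : ℝ} (hα : α ≠ 0) : Continuous fun y : ℝ => w (y * I + α) :=
  continuous_iff_continuousAt.2 fun y => ContinuousAt.comp (f := fun y : ℝ => (y * I + α : ℂ))
    (hw.diff _ (by simpa using hα)).continuousAt (by fun_prop)

/-- The vertical line integrals of the jump against the Cauchy kernel tend to `0` weakly. -/
theorem tendsto_integral_mirrorJump [CompleteSpace E] {a b B : ℝ} (hab : a < b)
    (hB : ∀ z : ℂ, 0 < |z.re| → |z.re| ≤ 1 → a ≤ z.im → z.im ≤ b → ‖mirrorJump w z‖ ≤ B)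
    (φ : E →L[ℂ] ℂ) (hφ : ∀ y : ℝ, a ≤ y → y ≤ b →
      Tendsto (fun α : ℝ => φ (mirrorJump w (α + y * I))) (𝓝[>] 0) (𝓝 0))
    {l : ℂ} (hl0 : l.re ≠ 0) :
    Tendsto (fun ε : ℝ => φ (I • ∫ y : ℝ in a..b,
      (((y * I : ℂ) - l)⁻¹ * cutoff a b (y * I)) • mirrorJump w (y * I + ε))) (𝓝[>] 0) (𝓝 0) := by
  set κ : ℝ → ℂ := fun y => ((y * I : ℂ) - l)⁻¹ * cutoff a b (y * I) with hκ
  have hκc : Continuous κ := by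
    refine Continuous.mul (Continuous.inv₀ (by fun_prop) fun y h => hl0 ?_)
      ((continuous_cutoff a b).comp (by fun_prop))
    simpa using congrArg re h
  obtain ⟨D, hD⟩ := (isCompact_Icc (a := a) (b := b)).exists_bound_of_continuousOn
    hκc.continuousOn
  have hmc : ∀ ε : ℝ, 0 < ε → Continuous fun y : ℝ => mirrorJump w (y * I + ε) := fun ε hε => by
    have h1 := hw.continuous_line hε.ne'
    have h2 := hw.continuous_line (neg_ne_zero.2 hε.ne')
    refine (h1.sub h2).congr fun y => ?_
    have e : -conj ((y : ℂ) * I + ε) = y * I + ((-ε : ℝ) : ℂ) := by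
      simp only [map_add, map_mul, conj_ofReal, conj_I]; push_cast; ring
    simp only [mirrorJump, e, Pi.sub_apply]
  have h1 : Tendsto (fun ε : ℝ => ∫ y : ℝ in a..b, κ y * φ (mirrorJump w (y * I + ε))) (𝓝[>] 0)
      (𝓝 (∫ y : ℝ in a..b, (0 : ℂ))) := by
    refine intervalIntegral.tendsto_integral_filter_of_dominated_convergence
      (fun _ => D * (‖φ‖ * B)) ?_ ?_ intervalIntegrable_const ?_
    · filter_upwards [self_mem_nhdsWithin] with ε hε
      exact (hκc.mul (φ.continuous.comp (hmc ε hε))).aestronglyMeasurable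
    · filter_upwards [Ioc_mem_nhdsGT one_pos] with ε hε
      refine .of_forall fun y hy => ?_
      rw [Set.uIoc_of_le hab.le] at hy
      rw [norm_mul]
      refine mul_le_mul (hD y ⟨hy.1.le, hy.2⟩) ((φ.le_opNorm _).trans ?_) (norm_nonneg _)
        ((norm_nonneg _).trans (hD y ⟨hy.1.le, hy.2⟩))
      gcongr
      refine hB _ ?_ ?_ (by simpa using hy.1.le) (by simpa using hy.2)
      · simpa using hε.1.ne'
      · simpa [abs_of_pos hε.1] using hε.2
    · refine .of_forall fun y hy => ?_
      rw [Set.uIoc_of_le hab.le] at hy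
      have := (hφ y hy.1.le hy.2).const_mul (κ y)
      simpa [add_comm] using this
  rw [intervalIntegral.integral_zero] at h1
  have h2 := h1.const_mul I
  rw [mul_zero] at h2
  refine h2.congr' ?_
  filter_upwards [self_mem_nhdsWithin] with ε hε
  have hint : IntervalIntegrable (fun y : ℝ => κ y • mirrorJump w (y * I + ε)) volume a b :=
    (hκc.smul (hmc ε hε)).intervalIntegrable _ _
  rw [map_smul, ← φ.intervalIntegral_comp_comm hint, smul_eq_mul]
  simp only [map_smul, smul_eq_mul]

/-- Adding Cauchy's formulas on both sides of the axis, the integrals along the axis combine to an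
integral of the jump, which tends to `0` weakly; the outer sides are left. -/
theorem sideTransform_add_eq [CompleteSpace E] {a b B : ℝ} (hab : a < b)
    (hB : ∀ z : ℂ, 0 < |z.re| → |z.re| ≤ 1 → a ≤ z.im → z.im ≤ b → ‖mirrorJump w z‖ ≤ B)
    (hφ : ∀ φ : E →L[ℂ] ℂ, ∀ y : ℝ, a ≤ y → y ≤ b →
      Tendsto (fun α : ℝ => φ (mirrorJump w (α + y * I))) (𝓝[>] 0) (𝓝 0))
    {l : ℂ} (hl : |l.re| < 1 / 2) (hl0 : l.re ≠ 0) (hla : a < l.im) (hlb : l.im < b) :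
    sideTransform w a b l + sideTransform (fun z => w (-z)) (-b) (-a) (-l) =
      (2 * Real.pi * I : ℂ) • cutoff a b l • w l := by
  have h1 := hw.right.tendsto_integral_imag_axis hab hl hl0 hla hlb
  have h2 := hw.left.tendsto_integral_imag_axis (neg_lt_neg hab) (l := -l) (by simpa using hl)
    (by simpa using hl0) (by simpa using hlb) (by simpa using hla)
  have h3 := h1.add h2
  rw [← sub_eq_zero]
  refine SeparatingDual.eq_zero_of_forall_dual_eq_zero (R := ℂ) fun φ => ?_
  have h4 := (φ.continuous.tendsto _).comp h3
  have h5 : sideTransform w a b l - (if 0 < l.re then (2 * Real.pi * I : ℂ) • cutoff a b l • w l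
      else 0) + (sideTransform (fun z => w (-z)) (-b) (-a) (-l) -
      if 0 < (-l).re then (2 * Real.pi * I : ℂ) • cutoff (-b) (-a) (-l) • w (- -l) else 0) =
      sideTransform w a b l + sideTransform (fun z => w (-z)) (-b) (-a) (-l) -
      (2 * Real.pi * I : ℂ) • cutoff a b l • w l := by
    rcases lt_or_gt_of_ne hl0 with h | h
    · rw [if_neg (not_lt.2 h.le), if_pos (by simpa using h), cutoff_neg, neg_neg]
      abel
    · rw [if_pos h, if_neg (by simpa using h.le)]
      abel
  rw [h5] at h4
  refine tendsto_nhds_unique h4 ((hw.tendsto_integral_mirrorJump hab hB φ (hφ φ) hl0).congr' ?_)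
  filter_upwards [self_mem_nhdsWithin] with ε hε
  have hε0 : (ε : ℝ) ≠ 0 := ne_of_gt hε
  simp only [Function.comp_apply]
  congr 1
  have e1 : ∫ y : ℝ in (-b)..(-a), (((y * I : ℂ) - -l)⁻¹ * cutoff (-b) (-a) (y * I)) •
      w (-(y * I + ε)) = ∫ y : ℝ in a..b,
        -(((((y : ℝ) * I : ℂ) - l)⁻¹ * cutoff a b (y * I)) • w (y * I + ((-ε : ℝ) : ℂ))) := by
    rw [← intervalIntegral.integral_comp_neg]
    refine intervalIntegral.integral_congr fun y _ => ?_
    have i1 : ((-y : ℝ) * I : ℂ) = -(y * I) := by push_cast; ring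
    have i2 : -((y : ℂ) * I) - -l = -(y * I - l) := by ring
    have i3 : -(-((y : ℂ) * I) + ε) = y * I + ((-ε : ℝ) : ℂ) := by push_cast; ring
    simp only [i1, i2, i3, cutoff_neg, inv_neg, neg_mul, neg_smul]
  have hκc : Continuous fun y : ℝ => ((y * I : ℂ) - l)⁻¹ * cutoff a b (y * I) := by
    refine Continuous.mul (Continuous.inv₀ (by fun_prop) fun y h => hl0 ?_)
      ((continuous_cutoff a b).comp (by fun_prop))
    simpa using congrArg re h
  have j1 : IntervalIntegrable (fun y : ℝ => (((y * I : ℂ) - l)⁻¹ * cutoff a b (y * I)) •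
      w (y * I + ε)) volume a b :=
    (hκc.smul (hw.continuous_line hε0)).intervalIntegrable _ _
  have j2 : IntervalIntegrable (fun y : ℝ => -((((y * I : ℂ) - l)⁻¹ * cutoff a b (y * I)) •
      w (y * I + ((-ε : ℝ) : ℂ)))) volume a b :=
    (hκc.smul (hw.continuous_line (neg_ne_zero.2 hε0))).neg.intervalIntegrable _ _
  rw [e1, ← smul_add, ← intervalIntegral.integral_add j1 j2]
  congr 1
  refine intervalIntegral.integral_congr fun y _ => ?_
  have i4 : -conj ((y : ℂ) * I + ε) = y * I + ((-ε : ℝ) : ℂ) := by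
    simp only [map_add, map_mul, conj_ofReal, conj_I]; push_cast; ring
  simp only [mirrorJump, i4]
  module

/-- If the jump across the segment `i [a, b]` is bounded and tends weakly to `0`, then `w` extends
holomorphically across `i (a, b)`. -/
theorem exists_extension [CompleteSpace E] {a b B : ℝ} (hab : a < b)
    (hB : ∀ z : ℂ, 0 < |z.re| → |z.re| ≤ 1 → a ≤ z.im → z.im ≤ b → ‖mirrorJump w z‖ ≤ B)
    (hφ : ∀ φ : E →L[ℂ] ℂ, ∀ y : ℝ, a ≤ y → y ≤ b →
      Tendsto (fun α : ℝ => φ (mirrorJump w (α + y * I))) (𝓝[>] 0) (𝓝 0)) :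
    ∃ U : Set ℂ, IsOpen U ∧ (∀ y : ℝ, a < y → y < b → (y * I : ℂ) ∈ U) ∧ ∃ g : ℂ → E,
      DifferentiableOn ℂ g U ∧ ∀ z ∈ U, z.re ≠ 0 → g z = w z := by
  set U : Set ℂ := Set.Ioo (-(1 / 2) : ℝ) (1 / 2) ×ℂ Set.Ioo a b with hU
  have hcut : ∀ l ∈ U, (2 * Real.pi * I * cutoff a b l : ℂ) ≠ 0 := by
    rintro l ⟨_, h1, h2⟩
    refine mul_ne_zero two_pi_I_ne_zero (pow_ne_zero _ (mul_ne_zero ?_ ?_))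
    · intro h
      have := congrArg im h
      simp at this; linarith
    · intro h
      have := congrArg im h
      simp at this; linarith
  refine ⟨U, isOpen_Ioo.reProdIm isOpen_Ioo, fun y h1 h2 => ⟨by simp, by simpa using ⟨h1, h2⟩⟩,
    fun l => (2 * Real.pi * I * cutoff a b l : ℂ)⁻¹ •
      (sideTransform w a b l + sideTransform (fun z => w (-z)) (-b) (-a) (-l)), ?_, ?_⟩
  · refine DifferentiableOn.smul (DifferentiableOn.inv ?_ hcut)
      ((hw.right.differentiableOn_sideTransform hab.le).add ?_)
    · unfold cutoff; fun_prop
    · refine (hw.left.differentiableOn_sideTransform (neg_le_neg hab.le)).comp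
        (f := fun l : ℂ => -l) (by fun_prop) fun l hl => ?_
      obtain ⟨h1, h2⟩ := hl
      simp only [mem_reProdIm, neg_re, neg_im, Set.mem_Ioo, Set.mem_preimage] at h1 h2 ⊢
      exact ⟨⟨by linarith [h1.2], by linarith [h1.1]⟩, by linarith [h2.2], by linarith [h2.1]⟩
  · intro l hl hl0
    have h := hl
    obtain ⟨h1, h2⟩ := h
    simp only [hw.sideTransform_add_eq hab hB hφ (abs_lt.2 h1) hl0 h2.1 h2.2]
    rw [smul_smul (2 * Real.pi * I : ℂ), inv_smul_smul₀ (hcut l hl)]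

end HasCubicGrowthOffAxis

end Extension

/-! ### Extension at a point of the singular set -/

section BoundaryUniqueness

open Complex ComplexConjugate

variable {E : Type*} [NormedAddCommGroup E] [NormedSpace ℂ E]

/-- The norm of the jump is symmetric in the imaginary axis. -/
theorem norm_mirrorJump_abs_re {E : Type*} [NormedAddCommGroup E] (w : ℂ → E) (z : ℂ) :
    ‖mirrorJump w ((|z.re| : ℝ) + z.im * I)‖ = ‖mirrorJump w z‖ := by
  rcases abs_choice z.re with h | h
  · rw [h, re_add_im]
  · have : ((|z.re| : ℝ) : ℂ) + z.im * I = -conj z := by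
      rw [h]
      apply Complex.ext <;> simp
    rw [this, mirrorJump_neg_conj, norm_neg]

theorem HasCubicGrowthOffAxis.continuous_mirrorJump {w : ℂ → E} {C : ℝ}
    (hw : HasCubicGrowthOffAxis w C) {α : ℝ} (hα : α ≠ 0) :
    Continuous fun y : ℝ => mirrorJump w (α + y * I) := by
  refine ((hw.continuous_line hα).sub (hw.continuous_line (neg_ne_zero.2 hα))).congr fun y => ?_
  have e : -conj ((α : ℂ) + y * I) = y * I + ((-α : ℝ) : ℂ) := by
    simp only [map_add, map_mul, conj_ofReal, conj_I]; push_cast; ring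
  simp only [mirrorJump, Pi.sub_apply]
  rw [e, add_comm (α : ℂ)]

/-- Baire's theorem on the singular set: some portion of it carries a uniform bound for the
pointwise bounded jump. -/
theorem exists_uniform_portion {w : ℂ → E} {C : ℝ} (hw : HasCubicGrowthOffAxis w C) {K : Set ℝ}
    (hK : IsClosed K) {a b : ℝ}
    (hbd : ∀ y, a ≤ y → y ≤ b → ∃ B : ℝ, ∀ α : ℝ, 0 < α → α ≤ 1 →
      ‖mirrorJump w (α + y * I)‖ ≤ B)
    (hne : ∃ y ∈ K, a < y ∧ y < b) :
    ∃ y₀ ∈ K, a < y₀ ∧ y₀ < b ∧ ∃ δ > 0, ∃ B : ℝ, ∀ y ∈ K, a ≤ y → y ≤ b → |y - y₀| < δ →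
      ∀ α : ℝ, 0 < α → α ≤ 1 → ‖mirrorJump w (α + y * I)‖ ≤ B := by
  set S : Set ℝ := K ∩ Set.Icc a b with hS
  have hSc : IsClosed S := hK.inter isClosed_Icc
  have : CompleteSpace S := hSc.completeSpace_coe
  set F : ℕ → Set S := fun n => {y | ∀ α : ℝ, 0 < α → α ≤ 1 →
    ‖mirrorJump w (α + (y : ℝ) * I)‖ ≤ n} with hF
  have hFc : ∀ n, IsClosed (F n) := by
    intro n
    have : F n = ⋂ α : Set.Ioc (0 : ℝ) 1, {y : S | ‖mirrorJump w ((α : ℝ) + (y : ℝ) * I)‖ ≤ n} := by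
      ext y
      simp [hF]
    rw [this]
    exact isClosed_iInter fun α => isClosed_le
      ((hw.continuous_mirrorJump α.2.1.ne').norm.comp continuous_subtype_val) continuous_const
  have hFu : ⋃ n, F n = Set.univ := by
    refine Set.eq_univ_of_forall fun y => ?_
    obtain ⟨B, hB⟩ := hbd y y.2.2.1 y.2.2.2
    obtain ⟨n, hn⟩ := exists_nat_ge B
    exact Set.mem_iUnion.2 ⟨n, fun α h1 h2 => (hB α h1 h2).trans hn⟩
  have hdense := dense_iUnion_interior_of_closed hFc hFu
  obtain ⟨y₁, hy₁K, hy₁a, hy₁b⟩ := hne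
  have hVo : IsOpen {y : S | a < (y : ℝ) ∧ (y : ℝ) < b} :=
    (isOpen_lt continuous_const continuous_subtype_val).inter
      (isOpen_lt continuous_subtype_val continuous_const)
  obtain ⟨y₀, ⟨h1, h2⟩, h3⟩ := hdense.inter_open_nonempty _ hVo
    ⟨⟨y₁, hy₁K, hy₁a.le, hy₁b.le⟩, hy₁a, hy₁b⟩
  obtain ⟨n, hn⟩ := Set.mem_iUnion.1 h3
  obtain ⟨δ, hδ, hball⟩ := Metric.isOpen_iff.1 isOpen_interior y₀ hn
  refine ⟨y₀, y₀.2.1, h1, h2, δ, hδ, n, fun y hy hya hyb hyd => ?_⟩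
  have : (⟨y, hy, hya, hyb⟩ : S) ∈ F n := interior_subset (hball (by
    rw [Metric.mem_ball, Subtype.dist_eq, Real.dist_eq]
    exact hyd))
  exact this

variable [CompleteSpace E]

/-- If the jump is bounded on the horizontal lines through a closed set containing `a`, `b` and the
singularities in `i [a, b]`, the bound propagates to the gaps, hence to the whole rectangle. The
term `C + C` bounds the jump on the lines `|Re z| = 1`. -/
theorem norm_mirrorJump_le_of_singular_set {w : ℂ → E} {C B : ℝ} (hw : HasCubicGrowthOffAxis w C)
    {S : Set ℝ} (hS : IsClosed S) {a b : ℝ} (ha : a ∈ S) (hb : b ∈ S)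
    (hd : ∀ y : ℝ, a ≤ y → y ≤ b → y ∉ S → DifferentiableAt ℂ w (y * I))
    (hB : ∀ y ∈ S, a ≤ y → y ≤ b → ∀ α : ℝ, 0 < α → α ≤ 1 → ‖mirrorJump w (α + y * I)‖ ≤ B)
    (hp : ∀ y : ℝ, a ≤ y → y ≤ b → HasNoDoublePole w y 1 ∧ HasNoDoublePole w y (-1))
    {z : ℂ} (hz0 : 0 < |z.re|) (hz1 : |z.re| ≤ 1) (hza : a ≤ z.im) (hzb : z.im ≤ b) :
    ‖mirrorJump w z‖ ≤ max B (C + C) := by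
  have hmem : ∀ z : ℂ, 0 < |z.re| → |z.re| ≤ 1 → z.im ∈ S → a ≤ z.im → z.im ≤ b →
      ‖mirrorJump w z‖ ≤ max B (C + C) := fun z h1 h2 h3 h4 h5 => by
    rw [← norm_mirrorJump_abs_re]
    exact le_max_of_le_left (hB _ h3 h4 h5 _ h1 h2)
  have htop : ∀ z : ℂ, |z.re| = 1 → ‖mirrorJump w z‖ ≤ max B (C + C) := fun z h1 => by
    have h2 := hw.growth z h1.le
    have h3 := hw.growth (-conj z) (by simpa using h1.le)
    have h4 : |(-conj z).re| = 1 := by simpa using h1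
    rw [h1, one_pow, one_mul] at h2
    rw [h4, one_pow, one_mul] at h3
    exact le_max_of_le_right ((norm_sub_le _ _).trans (add_le_add h2 h3))
  rcases hz1.lt_or_eq with hlt | heq
  swap
  · exact htop z heq
  by_cases hzS : z.im ∈ S
  · exact hmem z hz0 hz1 hzS hza hzb
  -- the gap of `S` containing `z.im`
  have hcl₁ : IsClosed (S ∩ Set.Icc a z.im) := hS.inter isClosed_Icc
  have hcl₂ : IsClosed (S ∩ Set.Icc z.im b) := hS.inter isClosed_Icc
  have hbd₁ : BddAbove (S ∩ Set.Icc a z.im) := bddAbove_Icc.mono Set.inter_subset_right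
  have hbd₂ : BddBelow (S ∩ Set.Icc z.im b) := bddBelow_Icc.mono Set.inter_subset_right
  have hp_mem := hcl₁.csSup_mem ⟨a, ha, le_rfl, hza⟩ hbd₁
  have hq_mem := hcl₂.csInf_mem ⟨b, hb, hzb, le_rfl⟩ hbd₂
  set p := sSup (S ∩ Set.Icc a z.im) with hpdef
  set q := sInf (S ∩ Set.Icc z.im b) with hqdef
  have hpz : p < z.im := lt_of_le_of_ne hp_mem.2.2 fun h => hzS (h ▸ hp_mem.1)
  have hzq : z.im < q := lt_of_le_of_ne hq_mem.2.1 fun h => hzS (h ▸ hq_mem.1)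
  have hpb : p ≤ b := (hpz.le.trans hzb)
  have haq : a ≤ q := hza.trans hzq.le
  refine norm_mirrorJump_le_of_gap (p := p) (q := q) (C := C) (hpz.trans hzq) ?_ hw.growth ?_
    (hp p hp_mem.2.1 hpb).1 (hp q haq hq_mem.2.2).2 hlt hpz hzq
  · intro y _ h2 h3 h4 h5
    by_cases hy0 : y.re = 0
    · have hy : y = y.im * I := by apply Complex.ext <;> simp [hy0]
      rw [hy]
      refine hd _ (hp_mem.2.1.trans h2) (h3.trans hq_mem.2.2) fun hyS => ?_
      rcases le_total y.im z.im with h | h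
      · exact h4 (by rw [hy, le_antisymm (le_csSup hbd₁ ⟨hyS, hp_mem.2.1.trans h2, h⟩) h2])
      · exact h5 (by rw [hy, le_antisymm h3 (csInf_le hbd₂ ⟨hyS, h, h3.trans hq_mem.2.2⟩)])
    · exact hw.diff y hy0
  · rintro y h1 h2 _ _ (h5 | h5 | h5)
    · exact htop y h5
    · exact hmem y h1 h2 (h5 ▸ hp_mem.1) (h5 ▸ hp_mem.2.1) (h5 ▸ hpb)
    · exact hmem y h1 h2 (h5 ▸ hq_mem.1) (h5 ▸ haq) (h5 ▸ hq_mem.2.2)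

/-- Boundary uniqueness: a function with cubic growth at the imaginary axis whose jump is pointwise
bounded and weakly null along an interval, and which has no double poles there, continues
holomorphically across some point of its singular set, if there is any. -/
theorem exists_extension_at_singular_point {w : ℂ → E} {C : ℝ} (hw : HasCubicGrowthOffAxis w C)
    {K : Set ℝ} (hK : IsClosed K) {a b : ℝ}
    (hd : ∀ y : ℝ, a ≤ y → y ≤ b → y ∉ K → DifferentiableAt ℂ w (y * I))
    (hbd : ∀ y, a ≤ y → y ≤ b → ∃ B : ℝ, ∀ α : ℝ, 0 < α → α ≤ 1 →
      ‖mirrorJump w (α + y * I)‖ ≤ B)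
    (hφ : ∀ φ : E →L[ℂ] ℂ, ∀ y : ℝ, a ≤ y → y ≤ b →
      Tendsto (fun α : ℝ => φ (mirrorJump w (α + y * I))) (𝓝[>] 0) (𝓝 0))
    (hp : ∀ y : ℝ, a ≤ y → y ≤ b → HasNoDoublePole w y 1 ∧ HasNoDoublePole w y (-1))
    (hne : ∃ y ∈ K, a < y ∧ y < b) :
    ∃ y ∈ K, a < y ∧ y < b ∧ ∃ U : Set ℂ, IsOpen U ∧ (y * I : ℂ) ∈ U ∧ ∃ g : ℂ → E,
      DifferentiableOn ℂ g U ∧ ∀ z ∈ U, z.re ≠ 0 → g z = w z := by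
  obtain ⟨y₀, hy₀K, hay, hyb, δ, hδ, B, hB⟩ := exists_uniform_portion hw hK hbd hne
  -- the endpoints `y₀ ± r` need not lie in `K`; they are added to it, with bounds of their own
  set r : ℝ := min δ (min (y₀ - a) (b - y₀)) / 2 with hr
  have hmin : 0 < min δ (min (y₀ - a) (b - y₀)) :=
    lt_min hδ (lt_min (sub_pos.2 hay) (sub_pos.2 hyb))
  have hr0 : 0 < r := half_pos hmin
  have hr2 : r < min δ (min (y₀ - a) (b - y₀)) := half_lt_self hmin
  have hrδ : r < δ := hr2.trans_le (min_le_left _ _)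
  have hra : r < y₀ - a := hr2.trans_le ((min_le_right _ _).trans (min_le_left _ _))
  have hrb : r < b - y₀ := hr2.trans_le ((min_le_right _ _).trans (min_le_right _ _))
  obtain ⟨B₁, hB₁⟩ := hbd (y₀ - r) (by linarith) (by linarith)
  obtain ⟨B₂, hB₂⟩ := hbd (y₀ + r) (by linarith) (by linarith)
  have hmain : ∀ z : ℂ, 0 < |z.re| → |z.re| ≤ 1 → y₀ - r ≤ z.im → z.im ≤ y₀ + r →
      ‖mirrorJump w z‖ ≤ max (max B (max B₁ B₂)) (C + C) := by
    intro z h1 h2 h3 h4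
    refine norm_mirrorJump_le_of_singular_set hw (S := K ∪ {y₀ - r, y₀ + r}) (a := y₀ - r)
      (b := y₀ + r) (hK.union (Set.toFinite _).isClosed) (by simp) (by simp) ?_ ?_ ?_ h1 h2 h3 h4
    · exact fun y h5 h6 h7 => hd y (by linarith) (by linarith) fun h => h7 (.inl h)
    · rintro y (hy | hy | hy) h5 h6 α h7 h8
      · exact le_max_of_le_left (hB y hy (by linarith) (by linarith)
          (abs_lt.2 ⟨by linarith, by linarith⟩) α h7 h8)
      · subst hy
        exact le_max_of_le_right (le_max_of_le_left (hB₁ α h7 h8))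
      · rw [Set.mem_singleton_iff] at hy
        subst hy
        exact le_max_of_le_right (le_max_of_le_right (hB₂ α h7 h8))
    · exact fun y h5 h6 => hp y (by linarith) (by linarith)
  obtain ⟨U, hU, hyU, g, hg, hgw⟩ := hw.exists_extension (a := y₀ - r) (b := y₀ + r)
    (by linarith) hmain fun φ y h5 h6 => hφ φ y (by linarith) (by linarith)
  exact ⟨y₀, hy₀K, hay, hyb, U, hU, hyU y₀ (by linarith) (by linarith), g, hg, hgw⟩

end BoundaryUniqueness

/-! ### The resolvent of the generator -/

section Resolvents

open MeasureTheory

variable {X : Type*} [NormedAddCommGroup X] [NormedSpace ℂ X]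

namespace IsResolventAt

variable {A : X →ₗ.[ℂ] X} {z z' : ℂ} {R R' : X →L[ℂ] X}

/-- The resolvent identity. -/
theorem sub_eq (h : IsResolventAt A z R) (h' : IsResolventAt A z' R') (x : X) :
    R x - R' x = (z' - z) • R (R' x) := by
  obtain ⟨hd, hx⟩ := h'.1 x
  have h1 := h.2 ⟨R' x, hd⟩
  have h2 : z • R' x - A ⟨R' x, hd⟩ = x + (z - z') • R' x := by
    rw [sub_smul]
    nth_rewrite 3 [← hx]
    abel
  simp only [h2, map_add, map_smul] at h1
  rw [sub_eq_iff_eq_add]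
  nth_rewrite 2 [← h1]
  module

theorem unique (h : IsResolventAt A z R) (h' : IsResolventAt A z R') : R = R' := by
  ext x
  have := h.sub_eq h' x
  rwa [sub_self, zero_smul, sub_eq_zero] at this

theorem opResolvent_eq (h : IsResolventAt A z R) : opResolvent A z = R := by
  have hex : ∃ R : X →L[ℂ] X, IsResolventAt A z R := ⟨R, h⟩
  rw [opResolvent, dif_pos hex]
  exact hex.choose_spec.unique h

end IsResolventAt

theorem isResolventAt_opResolvent {A : X →ₗ.[ℂ] X} {z : ℂ} (hz : z ∈ opResolventSet A) :
    IsResolventAt A z (opResolvent A z) := by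
  obtain ⟨R, hR⟩ := hz
  rwa [hR.opResolvent_eq]

namespace C0Group

variable (S : C0Group X)

theorem isGeneratorValue_generator {x : X} (hx : x ∈ S.generator.domain) :
    S.IsGeneratorValue x (S.generator ⟨x, hx⟩) :=
  Classical.choose_spec (p := fun y => S.IsGeneratorValue x y) hx

theorem isGeneratorValue_iff_hasDerivAt {x y : X} :
    S.IsGeneratorValue x y ↔ HasDerivAt (fun t : ℝ => S.T t x) y 0 := by
  rw [hasDerivAt_iff_tendsto_slope, IsGeneratorValue]
  refine tendsto_congr fun t => ?_
  rw [slope_def_module, sub_zero, S.map_zero, ContinuousLinearMap.id_apply, ← Complex.ofReal_inv,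
    Complex.coe_smul]

theorem isResolventAt_of {z : ℂ} {R : X →L[ℂ] X}
    (h1 : ∀ x, S.IsGeneratorValue (R x) (z • R x - x))
    (h2 : ∀ y v, S.IsGeneratorValue y v → R (z • y - v) = y) :
    IsResolventAt S.generator z R := by
  refine ⟨fun x => ⟨⟨_, h1 x⟩, ?_⟩, fun y => h2 _ _ (S.isGeneratorValue_generator y.2)⟩
  rw [(S.isGeneratorValue_generator ⟨_, h1 x⟩).unique (h1 x)]
  abel

theorem _root_.IsResolventAt.isGeneratorValue {S : C0Group X} {z : ℂ} {R : X →L[ℂ] X}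
    (h : IsResolventAt S.generator z R) (x : X) : S.IsGeneratorValue (R x) (z • R x - x) := by
  obtain ⟨hd, hx⟩ := h.1 x
  have := S.isGeneratorValue_generator hd
  have e : S.generator ⟨R x, hd⟩ = z • R x - x := by
    rw [eq_sub_iff_add_eq, add_comm]
    exact (sub_eq_iff_eq_add.1 hx).symm
  rwa [e] at this

theorem _root_.IsResolventAt.apply_sub {S : C0Group X} {z : ℂ} {R : X →L[ℂ] X}
    (h : IsResolventAt S.generator z R) {y v : X} (hy : S.IsGeneratorValue y v) :
    R (z • y - v) = y := by
  have h1 := h.2 ⟨y, v, hy⟩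
  rwa [(S.isGeneratorValue_generator ⟨v, hy⟩).unique hy] at h1

/-- The group `t ↦ T(-t)`, with generator `-A`. -/
def reversed : C0Group X where
  T t := S.T (-t)
  map_zero := by rw [neg_zero, S.map_zero]
  map_add s t := by rw [neg_add, S.map_add]
  strongly_continuous x := (S.strongly_continuous x).comp continuous_neg

theorem isGeneratorValue_reversed {x y : X} (h : S.reversed.IsGeneratorValue x y) :
    S.IsGeneratorValue x (-y) := by
  rw [isGeneratorValue_iff_hasDerivAt] at h ⊢
  have h1 : HasDerivAt (fun t : ℝ => -t) (-1) 0 := hasDerivAt_neg 0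
  have h2 := HasDerivAt.scomp (h := fun t : ℝ => -t) (0 : ℝ) (by simpa using h) h1
  simpa [reversed, Function.comp_def] using h2

theorem isGeneratorValue_reversed_of {x y : X} (h : S.IsGeneratorValue x y) :
    S.reversed.IsGeneratorValue x (-y) := by
  refine S.reversed.isGeneratorValue_reversed ?_
  have : S.reversed.reversed = S := by simp [reversed]
  rwa [this]

theorem isResolventAt_neg_of_reversed {z : ℂ} {R : X →L[ℂ] X}
    (h : IsResolventAt S.reversed.generator (-z) R) : IsResolventAt S.generator z (-R) := by
  refine S.isResolventAt_of (fun x => ?_) fun y v hy => ?_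
  · have := (S.isGeneratorValue_reversed (h.isGeneratorValue x)).smul (-1)
    convert this using 1
    · simp
    · simp only [_root_.neg_apply]
      module
  · have := h.apply_sub (S.isGeneratorValue_reversed_of hy)
    rw [_root_.neg_apply, ← map_neg]
    convert this using 2
    module

/-- The bound of the resolvent furnished by the Laplace transform of `M (1 + t ^ a)`. -/
noncomputable def resolventBound (M a r : ℝ) : ℝ :=
  M * (1 / r + (1 / r) ^ (a + 1) * Real.Gamma (a + 1))

theorem integrableOn_weight {M a r : ℝ} (ha : 0 ≤ a) (hr : 0 < r) :
    IntegrableOn (fun t : ℝ => Real.exp (-(r * t)) * (M * (1 + t ^ a))) (Set.Ioi 0) ∧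
    ∫ t in Set.Ioi 0, Real.exp (-(r * t)) * (M * (1 + t ^ a)) = resolventBound M a r := by
  have i (s : ℝ) (hs : 0 ≤ s) :
      IntegrableOn (fun t : ℝ => t ^ s * Real.exp (-(r * t))) (Set.Ioi 0) := by
    have := integrableOn_rpow_mul_exp_neg_mul_rpow (s := s) (p := 1) (by linarith)
      one_pos hr
    simpa [Real.rpow_one] using this
  have e : (fun t : ℝ => Real.exp (-(r * t)) * (M * (1 + t ^ a))) = fun t =>
      M * (t ^ (0 : ℝ) * Real.exp (-(r * t)) + t ^ a * Real.exp (-(r * t))) := by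
    funext t
    rw [Real.rpow_zero]
    ring
  have h0 := Real.integral_rpow_mul_exp_neg_mul_Ioi (a := 1) one_pos hr
  have h1 := Real.integral_rpow_mul_exp_neg_mul_Ioi (a := a + 1) (by linarith) hr
  rw [sub_self, Real.rpow_one, Real.Gamma_one, mul_one] at h0
  rw [add_sub_cancel_right] at h1
  rw [e]
  refine ⟨((i 0 le_rfl).add (i a ha)).const_mul M, ?_⟩
  rw [integral_const_mul, integral_add (i 0 le_rfl) (i a ha), h0, h1, resolventBound]

theorem norm_laplace_integrand_le {S : C0Group X} {M a : ℝ}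
    (hS : ∀ t : ℝ, ‖S.T t‖ ≤ M * (1 + |t| ^ a)) (z : ℂ) (x : X) {t : ℝ} (ht : 0 < t) :
    ‖Complex.exp (-(z * t)) • S.T t x‖ ≤
      Real.exp (-(z.re * t)) * (M * (1 + t ^ a)) * ‖x‖ := by
  have h1 := hS t
  rw [abs_of_pos ht] at h1
  rw [norm_smul, Complex.norm_exp, mul_assoc]
  have h2 : (-(z * (t : ℂ))).re = -(z.re * t) := by simp
  rw [h2]
  gcongr
  exact (S.T t).le_of_opNorm_le h1 x

section Laplace

variable {S} {M a : ℝ} (ha : 0 ≤ a) (hS : ∀ t : ℝ, ‖S.T t‖ ≤ M * (1 + |t| ^ a)) {z : ℂ}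
  (hz : 0 < z.re)
include ha hS hz

theorem integrableOn_laplace (x : X) :
    IntegrableOn (fun t : ℝ => Complex.exp (-(z * t)) • S.T t x) (Set.Ioi 0) := by
  have hc : Continuous fun t : ℝ => Complex.exp (-(z * t)) • S.T t x :=
    Continuous.smul (by fun_prop) (S.strongly_continuous x)
  refine Integrable.mono' ((integrableOn_weight (M := M) ha hz).1.mul_const ‖x‖)
    hc.aestronglyMeasurable ?_
  filter_upwards [ae_restrict_mem measurableSet_Ioi] with t ht
  exact norm_laplace_integrand_le hS z x ht

theorem norm_laplace_le (x : X) :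
    ‖∫ t in Set.Ioi (0 : ℝ), Complex.exp (-(z * t)) • S.T t x‖ ≤
      resolventBound M a z.re * ‖x‖ := by
  have h := integrableOn_weight (M := M) ha hz
  rw [← h.2, ← integral_mul_const]
  refine norm_integral_le_of_norm_le (h.1.mul_const ‖x‖) ?_
  filter_upwards [ae_restrict_mem measurableSet_Ioi] with t ht
  exact norm_laplace_integrand_le hS z x ht

/-- The group acts on the Laplace transform of an orbit by translation. -/
theorem apply_laplace (x : X) (h : ℝ) :
    S.T h (∫ t in Set.Ioi (0 : ℝ), Complex.exp (-(z * t)) • S.T t x) =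
      Complex.exp (z * h) • ((∫ t in Set.Ioi (0 : ℝ), Complex.exp (-(z * t)) • S.T t x) -
        ∫ t in (0 : ℝ)..h, Complex.exp (-(z * t)) • S.T t x) := by
  set f : ℝ → X := fun t => Complex.exp (-(z * t)) • S.T t x with hf
  have hc : Continuous f := Continuous.smul (by fun_prop) (S.strongly_continuous x)
  by_cases hX : CompleteSpace X
  swap
  · simp [integral_def, intervalIntegral, hX]
  have hint : IntegrableOn f (Set.Ioi 0) := integrableOn_laplace ha hS hz x
  have hint' : IntegrableOn f (Set.Ioi h) := by
    rcases le_total 0 h with h0 | h0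
    · exact hint.mono_set (Set.Ioi_subset_Ioi h0)
    · rw [← Set.Ioc_union_Ioi_eq_Ioi h0]
      exact (hc.integrableOn_Ioc).union hint
  have h1 : (∫ t in Set.Ioi (0 : ℝ), f t) - ∫ t in (0 : ℝ)..h, f t = ∫ t in Set.Ioi h, f t := by
    rw [← intervalIntegral.integral_interval_add_Ioi hint hint']
    abel
  have h2 : ∫ t in Set.Ioi (0 : ℝ), f (t + h) = ∫ t in Set.Ioi h, f t := by
    have := (measurePreserving_add_right volume h).setIntegral_preimage_emb
      (measurableEmbedding_addRight h) f (Set.Ioi h)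
    simpa using this
  rw [h1, ← h2, ← integral_smul, ← ContinuousLinearMap.integral_comp_comm _ hint]
  refine integral_congr_ae (.of_forall fun t => ?_)
  simp only [hf, map_smul, smul_smul, ← Complex.exp_add]
  rw [add_comm t h, S.map_add, ContinuousLinearMap.comp_apply]
  congr 2
  push_cast
  ring

theorem isGeneratorValue_laplace [CompleteSpace X] (x : X) :
    S.IsGeneratorValue (∫ t in Set.Ioi (0 : ℝ), Complex.exp (-(z * t)) • S.T t x)
      (z • (∫ t in Set.Ioi (0 : ℝ), Complex.exp (-(z * t)) • S.T t x) - x) := by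
  have hc : Continuous fun t : ℝ => Complex.exp (-(z * t)) • S.T t x :=
    Continuous.smul (by fun_prop) (S.strongly_continuous x)
  rw [isGeneratorValue_iff_hasDerivAt]
  simp only [apply_laplace ha hS hz]
  have h1 : HasDerivAt (fun h : ℝ => ∫ t in (0 : ℝ)..h, Complex.exp (-(z * t)) • S.T t x)
      (Complex.exp (-(z * (0 : ℝ))) • S.T 0 x) 0 :=
    intervalIntegral.integral_hasDerivAt_right (hc.intervalIntegrable _ _)
      (hc.stronglyMeasurableAtFilter _ _) hc.continuousAt
  have h2 : HasDerivAt (fun h : ℝ => Complex.exp (z * h)) (Complex.exp (z * (0 : ℝ)) * z) 0 := by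
    have : HasDerivAt (fun h : ℝ => z * (h : ℂ)) z 0 := by
      simpa using (Complex.ofRealCLM.hasDerivAt (x := (0 : ℝ))).const_mul z
    exact this.cexp
  have h3 := h2.smul (h1.const_sub (∫ t in Set.Ioi (0 : ℝ), Complex.exp (-(z * t)) • S.T t x))
  simp only [Complex.ofReal_zero, mul_zero, neg_zero, Complex.exp_zero, one_smul, one_mul,
    S.map_zero, ContinuousLinearMap.id_apply, intervalIntegral.integral_same, sub_zero] at h3
  refine h3.congr_deriv ?_
  abel

end Laplace

/-- In the right half-plane the Laplace transform of the group is the resolvent of its generator. -/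
theorem exists_isResolventAt_of_re_pos [CompleteSpace X] {M a : ℝ} (ha : 0 ≤ a)
    (hS : ∀ t : ℝ, ‖S.T t‖ ≤ M * (1 + |t| ^ a)) {z : ℂ} (hz : 0 < z.re) :
    ∃ R : X →L[ℂ] X, IsResolventAt S.generator z R ∧ ‖R‖ ≤ resolventBound M a z.re := by
  have hi := integrableOn_laplace ha hS hz
  let L : X →ₗ[ℂ] X :=
    { toFun := fun x => ∫ t in Set.Ioi (0 : ℝ), Complex.exp (-(z * t)) • S.T t x
      map_add' := fun x y => by
        rw [← integral_add (hi x) (hi y)]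
        simp only [_root_.map_add, smul_add]
      map_smul' := fun c x => by
        rw [RingHom.id_apply, ← integral_smul]
        simp only [_root_.map_smul, smul_comm c] }
  have hL : ∀ x, ‖L x‖ ≤ resolventBound M a z.re * ‖x‖ := norm_laplace_le ha hS hz
  have hM : 0 ≤ M := by
    have h1 := (norm_nonneg _).trans (hS 0)
    refine nonneg_of_mul_nonneg_left h1 ?_
    positivity
  have hb : 0 ≤ resolventBound M a z.re := by
    have : 0 < Real.Gamma (a + 1) := Real.Gamma_pos_of_pos (by linarith)
    unfold resolventBound
    positivity
  refine ⟨L.mkContinuous _ hL, S.isResolventAt_of (fun x => isGeneratorValue_laplace ha hS hz x)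
    fun y v hy => ?_, L.mkContinuous_norm_le hb hL⟩
  -- the Laplace transform commutes with the group, hence with its derivative at `0`
  set R := L.mkContinuous _ hL with hR
  have hcomm : ∀ (h : ℝ) (x : X), R (S.T h x) = S.T h (R x) := fun h x => by
    change ∫ t in Set.Ioi (0 : ℝ), Complex.exp (-(z * t)) • S.T t (S.T h x) =
      S.T h (∫ t in Set.Ioi (0 : ℝ), Complex.exp (-(z * t)) • S.T t x)
    rw [← ContinuousLinearMap.integral_comp_comm _ (hi x)]
    refine integral_congr_ae (.of_forall fun t => ?_)
    simp only [_root_.map_smul]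
    rw [← ContinuousLinearMap.comp_apply, ← ContinuousLinearMap.comp_apply, ← S.map_add,
      ← S.map_add, add_comm]
  have h1 : S.IsGeneratorValue (R y) (R v) := by
    refine ((R.continuous.tendsto _).comp hy).congr fun t => ?_
    simp only [Function.comp_apply, _root_.map_smul, _root_.map_sub, hcomm]
  have h2 : R v = z • R y - y := h1.unique (isGeneratorValue_laplace ha hS hz y)
  rw [_root_.map_sub, _root_.map_smul, h2]
  abel

theorem exists_isResolventAt [CompleteSpace X] {M a : ℝ} (ha : 0 ≤ a)
    (hS : ∀ t : ℝ, ‖S.T t‖ ≤ M * (1 + |t| ^ a)) {z : ℂ} (hz : z.re ≠ 0) :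
    ∃ R : X →L[ℂ] X, IsResolventAt S.generator z R ∧ ‖R‖ ≤ resolventBound M a |z.re| := by
  rcases lt_or_gt_of_ne hz with h | h
  · obtain ⟨R, hR, hn⟩ := S.reversed.exists_isResolventAt_of_re_pos (z := -z) ha
      (fun t => by simpa [reversed] using hS (-t)) (by simpa using h)
    refine ⟨-R, S.isResolventAt_neg_of_reversed hR, ?_⟩
    rwa [norm_neg, abs_of_neg h, ← Complex.neg_re]
  · rw [abs_of_pos h]
    exact S.exists_isResolventAt_of_re_pos ha hS h

end C0Group

end Resolvents

/-! ### Jumps of the resolvent: double poles and weak limits -/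

section ResolventJumps

open Complex ComplexConjugate

variable {X : Type*} [NormedAddCommGroup X] [NormedSpace ℂ X]

/-- The resolvent of `A` exists off the imaginary axis and grows at most like
`κ(|Re z|) |Re z|⁻³` near it. -/
structure HasResolventGrowth (A : X →ₗ.[ℂ] X) (κ : ℝ → ℝ) : Prop where
  isResolventAt : ∀ z : ℂ, z.re ≠ 0 → IsResolventAt A z (opResolvent A z)
  norm_le : ∀ z : ℂ, z.re ≠ 0 → |z.re| ≤ 1 → ‖opResolvent A z‖ ≤ κ |z.re| / |z.re| ^ 3

/-- The operator `(1 + (z - μ) R(μ)) (1 + (z' - μ') R(μ'))`, where `z'` and `μ'` are the mirror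
images of `z` and `μ` in the imaginary axis. It maps `R(z) R(z') x` to `R(μ) R(μ') x`, and it still
makes sense for `z` on the axis. -/
noncomputable def resolventTransfer (A : X →ₗ.[ℂ] X) (μ z : ℂ) (y : X) : X :=
  y + (-conj z - -conj μ) • opResolvent A (-conj μ) y + (z - μ) • opResolvent A μ y +
    ((z - μ) * (-conj z - -conj μ)) • opResolvent A μ (opResolvent A (-conj μ) y)

/-- The transfer operator is continuous in `z` and in the vector, the latter for the weak
topology. -/
theorem tendsto_resolventTransfer {A : X →ₗ.[ℂ] X} {μ z₀ : ℂ} {ι : Type*} {l : Filter ι}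
    {z : ι → ℂ} {v : ι → X} {c : X} (hz : Tendsto z l (𝓝 z₀))
    (hv : ∀ φ : X →L[ℂ] ℂ, Tendsto (fun i => φ (v i)) l (𝓝 (φ c))) (φ : X →L[ℂ] ℂ) :
    Tendsto (fun i => φ (resolventTransfer A μ (z i) (v i))) l
      (𝓝 (φ (resolventTransfer A μ z₀ c))) := by
  have hzc : Tendsto (fun i => -conj (z i)) l (𝓝 (-conj z₀)) :=
    ((Complex.continuous_conj.tendsto _).comp hz).neg
  have h1 := hz.sub_const μ
  have h2 := hzc.sub_const (-conj μ)
  simp only [resolventTransfer, map_add, map_smul, smul_eq_mul]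
  exact (((hv φ).add (h2.mul (hv (φ.comp (opResolvent A (-conj μ)))))).add
    (h1.mul (hv (φ.comp (opResolvent A μ))))).add
    ((h1.mul h2).mul (hv (φ.comp ((opResolvent A μ).comp (opResolvent A (-conj μ))))))

theorem re_neg_conj (z : ℂ) : (-conj z).re = -z.re := by simp

namespace HasResolventGrowth

variable {A : X →ₗ.[ℂ] X} {κ : ℝ → ℝ} (h : HasResolventGrowth A κ)
include h

theorem resolvent_sub {z μ : ℂ} (hz : z.re ≠ 0) (hμ : μ.re ≠ 0) (x : X) :
    opResolvent A z x - opResolvent A μ x = (μ - z) • opResolvent A z (opResolvent A μ x) :=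
  (h.isResolventAt z hz).sub_eq (h.isResolventAt μ hμ) x

theorem resolvent_comm {z μ : ℂ} (hz : z.re ≠ 0) (hμ : μ.re ≠ 0) (x : X) :
    opResolvent A z (opResolvent A μ x) = opResolvent A μ (opResolvent A z x) := by
  rcases eq_or_ne z μ with rfl | hne
  · rfl
  · have h1 := h.resolvent_sub hz hμ x
    have h2 := h.resolvent_sub hμ hz x
    have h3 : (μ - z) • (opResolvent A z (opResolvent A μ x) -
        opResolvent A μ (opResolvent A z x)) = 0 := by
      rw [smul_sub, ← h1, ← neg_sub z μ, neg_smul, ← h2]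
      abel
    exact sub_eq_zero.1 ((smul_eq_zero.1 h3).resolve_left (sub_ne_zero.2 hne.symm))

theorem mirrorJump_apply {z : ℂ} (hz : z.re ≠ 0) (x : X) :
    mirrorJump (opResolvent A) z x =
      (-conj z - z) • opResolvent A z (opResolvent A (-conj z) x) :=
  h.resolvent_sub hz (by rwa [re_neg_conj, neg_ne_zero]) x

theorem mirrorJump_comm {z μ : ℂ} (hz : z.re ≠ 0) (hμ : μ.re ≠ 0) (x : X) :
    mirrorJump (opResolvent A) z (mirrorJump (opResolvent A) μ x) =
      mirrorJump (opResolvent A) μ (mirrorJump (opResolvent A) z x) := by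
  have hz' : (-conj z).re ≠ 0 := by rwa [re_neg_conj, neg_ne_zero]
  have hμ' : (-conj μ).re ≠ 0 := by rwa [re_neg_conj, neg_ne_zero]
  simp only [mirrorJump, _root_.sub_apply, map_sub, h.resolvent_comm hz hμ,
    h.resolvent_comm hz hμ', h.resolvent_comm hz' hμ, h.resolvent_comm hz' hμ']
  abel

/-- By the resolvent identity `D(z) = (z' - z) R(z) R(z')`, the transfer operator turns jumps at
`z` into jumps at `μ`. As `z` approaches the axis, the factor `z' - z` tends to `0`. -/
theorem resolventTransfer_mirrorJump {z μ : ℂ} (hz : z.re ≠ 0) (hμ : μ.re ≠ 0) (x : X) :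
    resolventTransfer A μ z (mirrorJump (opResolvent A) z x) =
      (-conj z - z) • opResolvent A μ (opResolvent A (-conj μ) x) := by
  have hz' : (-conj z).re ≠ 0 := by rwa [re_neg_conj, neg_ne_zero]
  have hμ' : (-conj μ).re ≠ 0 := by rwa [re_neg_conj, neg_ne_zero]
  rw [h.mirrorJump_apply hz]
  set y := opResolvent A z (opResolvent A (-conj z) x) with hy
  have e1 : y + (-conj z - -conj μ) • opResolvent A (-conj μ) y =
      opResolvent A z (opResolvent A (-conj μ) x) := by
    have h1 := h.resolvent_sub hμ' hz' (opResolvent A z x)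
    rw [← h.resolvent_comm hz hz', ← hy] at h1
    rw [← h1, h.resolvent_comm hμ' hz]
    abel
  have e2 := h.resolvent_sub hμ hz (opResolvent A (-conj μ) x)
  have e3 : resolventTransfer A μ z y = opResolvent A μ (opResolvent A (-conj μ) x) := by
    have : resolventTransfer A μ z y = (y + (-conj z - -conj μ) • opResolvent A (-conj μ) y) +
        (z - μ) • opResolvent A μ (y + (-conj z - -conj μ) • opResolvent A (-conj μ) y) := by
      rw [resolventTransfer, map_add, map_smul]
      module
    rw [this, e1, ← e2]
    abel
  rw [← e3]
  simp only [resolventTransfer, map_smul]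
  module

/-- Vectors killed by the transfer operator to a point `i p` of the imaginary axis are multiplied
by `2 / α` under `D(α + i p)`. -/
theorem two_smul_eq_of_resolventTransfer_eq_zero {α p : ℝ} (hα : α ≠ 0) {c : X}
    (hc : resolventTransfer A (α + p * I) (p * I) c = 0) :
    (2 : ℂ) • c = (α : ℂ) • mirrorJump (opResolvent A) (α + p * I) c := by
  have hre : ((α : ℂ) + p * I).re ≠ 0 := by simpa using hα
  have h1 := h.mirrorJump_apply hre c
  have e1 : -conj ((p : ℂ) * I) - -conj ((α : ℂ) + p * I) = α := by
    simp only [map_add, map_mul, conj_ofReal, conj_I]; ring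
  have e2 : (p : ℂ) * I - (α + p * I) = -α := by ring
  have e3 : -conj ((α : ℂ) + p * I) - (α + p * I) = -2 * α := by
    simp only [map_add, map_mul, conj_ofReal, conj_I]; ring
  rw [e3] at h1
  rw [resolventTransfer, e1, e2] at hc
  have h2 : mirrorJump (opResolvent A) ((α : ℂ) + p * I) c =
      opResolvent A (α + p * I) c - opResolvent A (-conj ((α : ℂ) + p * I)) c := rfl
  have h3 : (2 : ℂ) • c = (2 : ℂ) • (0 : X) +
      (2 * α : ℂ) • (opResolvent A (α + p * I) c - opResolvent A (-conj ((α : ℂ) + p * I)) c) -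
      (α : ℂ) • ((-2 * α : ℂ) • opResolvent A (α + p * I)
        (opResolvent A (-conj ((α : ℂ) + p * I)) c)) := by
    rw [← hc]
    module
  rw [h3, ← h1, ← h2]
  module

theorem norm_mirrorJump_le {z : ℂ} (hz : z.re ≠ 0) (hz1 : |z.re| ≤ 1) :
    ‖mirrorJump (opResolvent A) z‖ ≤ 2 * (κ |z.re| / |z.re| ^ 3) := by
  have h1 := h.norm_le z hz hz1
  have h2 := h.norm_le (-conj z) (by rwa [re_neg_conj, neg_ne_zero])
    (by rwa [re_neg_conj, abs_neg])
  rw [re_neg_conj, abs_neg] at h2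
  rw [two_mul]
  exact (norm_sub_le _ _).trans (add_le_add h1 h2)

/-- The coefficient `c` of a double pole of the local resolvent at `i p` is the limit of
`η² D(z_η) x`, and satisfies `2 c = α D(α + i p) c` for all `α`. For `α = N η`, replacing `c` by
`η² D(z_η) x` on the right costs `O(N⁻²)`, while the remaining term
`N η³ D(z_η) D(N η + i p) x` is `O(N κ(η) ‖D(N η + i p) x‖)`. Let `η → 0`, then `N → ∞`. -/
theorem hasNoDoublePole {C₀ : ℝ} (hκ : ∀ η : ℝ, 0 < η → η ≤ 1 → κ η ≤ C₀) {x : X} {p : ℝ}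
    (hx : ∀ N : ℝ, 0 < N → Tendsto (fun η : ℝ =>
      κ η * ‖mirrorJump (opResolvent A) (((N * η : ℝ) : ℂ) + p * I) x‖) (𝓝[>] 0) (𝓝 0))
    {w : ℂ → X} (hw : ∀ z : ℂ, z.re ≠ 0 → w z = opResolvent A z x) (σ : ℝ) :
    HasNoDoublePole w p σ := by
  rintro c ⟨C, hC⟩
  set z : ℝ → ℂ := fun η => (η : ℂ) + ((p + σ * η : ℝ) : ℂ) * I with hz
  set v : ℝ → X := fun η => ((η : ℂ) ^ 2) • mirrorJump (opResolvent A) (z η) x with hv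
  have hzre : ∀ η, (z η).re = η := fun η => by simp [hz]
  have hC' : ∀ᶠ η : ℝ in 𝓝[>] 0, ‖v η - c‖ ≤ C * η ^ 2 := by
    filter_upwards [hC, self_mem_nhdsWithin] with η h1 (h2 : 0 < η)
    have e : mirrorJump w (z η) = mirrorJump (opResolvent A) (z η) x := by
      rw [mirrorJump, hw _ (by rw [hzre]; exact h2.ne'),
        hw _ (by rw [re_neg_conj, hzre]; exact (neg_neg_of_pos h2).ne)]
      rfl
    change ‖((η : ℂ) ^ 2) • mirrorJump w (z η) - c‖ ≤ _ at h1
    rw [e] at h1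
    exact h1
  have hsq : Tendsto (fun η : ℝ => C * η ^ 2) (𝓝[>] 0) (𝓝 0) := by
    have : Tendsto (fun η : ℝ => C * η ^ 2) (𝓝 0) (𝓝 (C * 0 ^ 2)) :=
      Continuous.tendsto (by fun_prop) 0
    simpa using this.mono_left nhdsWithin_le_nhds
  have hvc : Tendsto v (𝓝[>] 0) (𝓝 c) :=
    tendsto_iff_norm_sub_tendsto_zero.2 (squeeze_zero' (.of_forall fun _ => norm_nonneg _) hC' hsq)
  have hzlim : Tendsto z (𝓝[>] 0) (𝓝 (p * I)) := by
    have : Tendsto z (𝓝 0) (𝓝 (z 0)) := Continuous.tendsto (by fun_prop) 0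
    simpa [hz] using this.mono_left nhdsWithin_le_nhds
  have heig : ∀ α : ℝ, α ≠ 0 →
      (2 : ℂ) • c = (α : ℂ) • mirrorJump (opResolvent A) (α + p * I) c := by
    intro α hα
    have hre : ((α : ℂ) + p * I).re ≠ 0 := by simpa using hα
    refine h.two_smul_eq_of_resolventTransfer_eq_zero hα
      (SeparatingDual.eq_zero_of_forall_dual_eq_zero (R := ℂ) fun φ => ?_)
    have h1 := tendsto_resolventTransfer (A := A) (μ := α + p * I) hzlim
      (fun φ => (φ.continuous.tendsto c).comp hvc) φ
    have h2 : Tendsto (fun η : ℝ => φ (((η : ℂ) ^ 2 * (-conj (z η) - z η)) •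
        opResolvent A (α + p * I) (opResolvent A (-conj (α + p * I)) x))) (𝓝[>] 0) (𝓝 0) := by
      have : Tendsto (fun η : ℝ => φ (((η : ℂ) ^ 2 * (-conj (z η) - z η)) •
        opResolvent A (α + p * I) (opResolvent A (-conj (α + p * I)) x))) (𝓝 0)
        (𝓝 (φ ((((0 : ℝ) : ℂ) ^ 2 * (-conj (z 0) - z 0)) •
        opResolvent A (α + p * I) (opResolvent A (-conj (α + p * I)) x)))) :=
        Continuous.tendsto (by fun_prop) 0
      simpa using this.mono_left nhdsWithin_le_nhds
    refine tendsto_nhds_unique h1 (h2.congr' ?_)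
    filter_upwards [self_mem_nhdsWithin] with η (hη : 0 < η)
    rw [mul_smul, ← h.resolventTransfer_mirrorJump (by rw [hzre]; exact hη.ne') hre]
    congr 1
    simp only [hv, resolventTransfer, map_smul]
    module
  have hbound : ∀ N : ℝ, 0 < N → 2 * ‖c‖ ≤ 2 * C₀ * C * (N ^ 2)⁻¹ := by
    intro N hN
    have hlim : Tendsto (fun η : ℝ => 2 * C₀ * C * (N ^ 2)⁻¹ + 2 * N * (κ η *
        ‖mirrorJump (opResolvent A) (((N * η : ℝ) : ℂ) + p * I) x‖)) (𝓝[>] 0)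
        (𝓝 (2 * C₀ * C * (N ^ 2)⁻¹ + 2 * N * 0)) := ((hx N hN).const_mul _).const_add _
    rw [mul_zero, add_zero] at hlim
    refine ge_of_tendsto hlim ?_
    filter_upwards [hC', Ioc_mem_nhdsGT (lt_min one_pos (inv_pos.2 hN))] with η hη1 hη
    obtain ⟨hη0, hη2⟩ := hη
    have hη3 : η ≤ 1 := hη2.trans (min_le_left _ _)
    have hNη : 0 < N * η := mul_pos hN hη0
    have hNη1 : N * η ≤ 1 := by
      have := hη2.trans (min_le_right _ _)
      rw [← mul_inv_cancel₀ hN.ne']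
      gcongr
    set D := mirrorJump (opResolvent A) (((N * η : ℝ) : ℂ) + p * I) with hD
    have hreN : (((N * η : ℝ) : ℂ) + p * I).re = N * η := by simp
    have e1 := heig (N * η) hNη.ne'
    have n1 : ‖D‖ ≤ 2 * (C₀ / (N * η) ^ 3) := by
      have := h.norm_mirrorJump_le (z := ((N * η : ℝ) : ℂ) + p * I) (by rw [hreN]; exact hNη.ne')
        (by rw [hreN, abs_of_pos hNη]; exact hNη1)
      rw [hreN, abs_of_pos hNη] at this
      refine this.trans ?_
      gcongr
      exact hκ _ hNη hNη1
    have n2 : ‖mirrorJump (opResolvent A) (z η)‖ ≤ 2 * (κ η / η ^ 3) := by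
      have := h.norm_mirrorJump_le (z := z η) (by rw [hzre]; exact hη0.ne')
        (by rw [hzre, abs_of_pos hη0]; exact hη3)
      rwa [hzre, abs_of_pos hη0] at this
    have n3 : ‖D (c - v η)‖ ≤ 2 * (C₀ / (N * η) ^ 3) * (C * η ^ 2) := by
      refine (D.le_opNorm _).trans (mul_le_mul n1 ?_ (norm_nonneg _) ((norm_nonneg _).trans n1))
      rwa [norm_sub_rev]
    have n4 : ‖D (v η)‖ ≤ η ^ 2 * (2 * (κ η / η ^ 3) * ‖D x‖) := by
      have : D (v η) = ((η : ℂ) ^ 2) • mirrorJump (opResolvent A) (z η) (D x) := by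
        rw [hv, map_smul, hD, h.mirrorJump_comm (by rw [hreN]; exact hNη.ne')
          (by rw [hzre]; exact hη0.ne')]
      rw [this, norm_smul, norm_pow, norm_real, Real.norm_eq_abs, sq_abs]
      gcongr
      exact ContinuousLinearMap.le_of_opNorm_le _ n2 _
    have e2 : (2 : ℂ) • c = ((N * η : ℝ) : ℂ) • (D (c - v η) + D (v η)) := by
      rw [e1, ← map_add, sub_add_cancel]
    calc 2 * ‖c‖ = ‖(2 : ℂ) • c‖ := by rw [norm_smul]; simp
      _ = N * η * ‖D (c - v η) + D (v η)‖ := by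
          rw [e2, norm_smul, norm_real, Real.norm_eq_abs, abs_of_pos hNη]
      _ ≤ N * η * (2 * (C₀ / (N * η) ^ 3) * (C * η ^ 2) +
            η ^ 2 * (2 * (κ η / η ^ 3) * ‖D x‖)) := by
          gcongr
          exact (norm_add_le _ _).trans (add_le_add n3 n4)
      _ = _ := by
          field_simp
  have hlim : Tendsto (fun N : ℝ => 2 * C₀ * C * (N ^ 2)⁻¹) atTop (𝓝 (2 * C₀ * C * 0)) :=
    (tendsto_inv_atTop_zero.comp (tendsto_pow_atTop two_ne_zero)).const_mul _
  rw [mul_zero] at hlim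
  have : 2 * ‖c‖ ≤ 0 := ge_of_tendsto hlim <| by
    filter_upwards [eventually_gt_atTop 0] with N hN
    exact hbound N hN
  exact norm_le_zero_iff.1 (by linarith)

end HasResolventGrowth

/-- A fixed vector of `s R(z)` is an eigenvector of `A`. -/
theorem IsResolventAt.eq_zero_of_eq_smul {A : X →ₗ.[ℂ] X} {z s : ℂ} {R : X →L[ℂ] X}
    (hR : IsResolventAt A z R) (hA : opPointSpectrum A = ∅) {y : X} (hy : y = s • R y) :
    y = 0 := by
  obtain ⟨hd, h1⟩ := hR.1 y
  by_contra hy0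
  have h2 : R y ≠ 0 := fun h0 => hy0 (by rw [hy, h0, smul_zero])
  have : z - s ∈ opPointSpectrum A := by
    refine ⟨⟨R y, hd⟩, h2, ?_⟩
    rw [sub_smul, ← hy, eq_sub_iff_add_eq]
    nth_rewrite 2 [← h1]
    abel
  rw [hA] at this
  exact this

/-- In a reflexive space, a bounded function converges weakly along every ultrafilter, by the
Banach-Alaoglu theorem in the bidual. -/
theorem IsReflexiveSpace.exists_weak_limit (hX : IsReflexiveSpace X) {ι : Type*}
    (U : Ultrafilter ι) {v : ι → X} {B : ℝ} (hv : ∀ᶠ i in (U : Filter ι), ‖v i‖ ≤ B) :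
    ∃ c : X, ∀ φ : X →L[ℂ] ℂ, Tendsto (fun i => φ (v i)) U (𝓝 (φ c)) := by
  set V : ι → WeakDual ℂ (StrongDual ℂ X) := fun i =>
    StrongDual.toWeakDual (NormedSpace.inclusionInDoubleDual ℂ X (v i)) with hV
  have hmem : ∀ᶠ i in (U : Filter ι),
      V i ∈ WeakDual.toStrongDual ⁻¹' Metric.closedBall (0 : StrongDual ℂ (StrongDual ℂ X)) B := by
    filter_upwards [hv] with i hi
    refine (mem_closedBall_zero_iff (E := StrongDual ℂ (StrongDual ℂ X))).2 ?_
    exact (NormedSpace.double_dual_bound ℂ X (v i)).trans hi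
  obtain ⟨L, _, hL⟩ := (WeakDual.isCompact_closedBall (𝕜 := ℂ)
    (0 : StrongDual ℂ (StrongDual ℂ X)) B).ultrafilter_le_nhds (U.map V)
    (le_principal_iff.2 (Ultrafilter.mem_map.2 hmem))
  obtain ⟨c, hc⟩ := hX (WeakDual.toStrongDual L)
  refine ⟨c, fun φ => ?_⟩
  have h1 : Tendsto V U (𝓝 L) := hL
  have h2 := ((WeakDual.eval_continuous (𝕜 := ℂ) φ).tendsto L).comp h1
  have h3 : φ c = L φ := by
    rw [← NormedSpace.dual_def ℂ X c φ, hc]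
    rfl
  rw [h3]
  exact h2

/-- Without eigenvalues, bounded jumps in a reflexive space are weakly null: a weak limit `c` is
killed by the transfer operator to `i p`, that is, `(1 - R(μ)) (1 + R(μ')) c = 0` for `μ = 1 + i p`
and its mirror image `μ'`, and both factors are injective. -/
theorem HasResolventGrowth.tendsto_weakly_zero {A : X →ₗ.[ℂ] X} {κ : ℝ → ℝ}
    (h : HasResolventGrowth A κ) (hX : IsReflexiveSpace X) (hA : opPointSpectrum A = ∅) {x : X}
    {p B : ℝ} (hB : ∀ α : ℝ, 0 < α → ‖mirrorJump (opResolvent A) (α + p * I) x‖ ≤ B)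
    (φ : X →L[ℂ] ℂ) :
    Tendsto (fun α : ℝ => φ (mirrorJump (opResolvent A) (α + p * I) x)) (𝓝[>] 0) (𝓝 0) := by
  rw [tendsto_iff_ultrafilter]
  intro U hU
  obtain ⟨c, hc⟩ := hX.exists_weak_limit U
    (v := fun α : ℝ => mirrorJump (opResolvent A) (α + p * I) x) (B := B)
    (hU (by filter_upwards [self_mem_nhdsWithin] with α hα; exact hB α hα))
  suffices h0 : c = 0 by simpa [h0] using hc φ
  have hzlim : Tendsto (fun η : ℝ => (η : ℂ) + p * I) U (𝓝 (p * I)) := by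
    have : Tendsto (fun η : ℝ => (η : ℂ) + p * I) (𝓝 0) (𝓝 (((0 : ℝ) : ℂ) + p * I)) :=
      Continuous.tendsto (by fun_prop) 0
    rw [ofReal_zero, zero_add] at this
    exact this.mono_left (hU.trans nhdsWithin_le_nhds)
  have hre : ((1 : ℂ) + p * I).re ≠ 0 := by simp
  have hre' : (-conj ((1 : ℂ) + p * I)).re ≠ 0 := by simp
  have h1 : resolventTransfer A (1 + p * I) (p * I) c = 0 := by
    refine SeparatingDual.eq_zero_of_forall_dual_eq_zero (R := ℂ) fun ψ => ?_
    refine tendsto_nhds_unique (tendsto_resolventTransfer hzlim hc ψ) ?_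
    have h2 : Tendsto (fun η : ℝ => ψ ((-conj ((η : ℂ) + p * I) - (η + p * I)) •
        opResolvent A (1 + p * I) (opResolvent A (-conj (1 + p * I)) x))) (𝓝 0)
        (𝓝 (ψ ((-conj (((0 : ℝ) : ℂ) + p * I) - (((0 : ℝ) : ℂ) + p * I)) •
        opResolvent A (1 + p * I) (opResolvent A (-conj (1 + p * I)) x)))) :=
      Continuous.tendsto (by fun_prop) 0
    have e : -conj (((0 : ℝ) : ℂ) + p * I) - (((0 : ℝ) : ℂ) + p * I) = 0 := by
      simp
    rw [e, zero_smul, map_zero] at h2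
    refine (h2.mono_left (hU.trans nhdsWithin_le_nhds)).congr' ?_
    refine hU ?_
    filter_upwards [self_mem_nhdsWithin] with η (hη : 0 < η)
    rw [← h.resolventTransfer_mirrorJump (by simpa using hη.ne') hre]
  have e1 : -conj ((p : ℂ) * I) - -conj ((1 : ℂ) + p * I) = 1 := by
    simp only [map_add, map_mul, conj_ofReal, conj_I, map_one]; ring
  have e2 : (p : ℂ) * I - (1 + p * I) = -1 := by ring
  rw [resolventTransfer, e1, e2] at h1
  have h3 : c + opResolvent A (-conj (1 + p * I)) c = 0 := by
    refine (h.isResolventAt _ hre).eq_zero_of_eq_smul hA (s := 1) ?_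
    rw [(opResolvent A (1 + p * I)).map_add, one_smul, ← sub_eq_zero]
    rw [one_smul, mul_one, neg_one_smul, neg_one_smul] at h1
    refine Eq.trans ?_ h1
    abel
  refine (h.isResolventAt _ hre').eq_zero_of_eq_smul hA (s := -1) ?_
  rw [neg_one_smul]
  exact eq_neg_of_add_eq_zero_left h3

end ResolventJumps

/-! ### The local spectrum -/

section LocalSpectra

open Complex ComplexConjugate

variable {X : Type*} [NormedAddCommGroup X] [NormedSpace ℂ X]

theorem isClosed_localSpectrum (A : X →ₗ.[ℂ] X) (x : X) : IsClosed (localSpectrum A x) := by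
  rw [← isOpen_compl_iff, localSpectrum, compl_compl, isOpen_iff_mem_nhds]
  rintro z ⟨U, hU, hzU, g, hg⟩
  filter_upwards [hU.mem_nhds hzU] with z' hz'
  exact ⟨U, hU, hz', g, hg⟩

theorem resolventJump_apply (A : X →ₗ.[ℂ] X) (α β : ℝ) (x : X) :
    resolventJump A α β x = mirrorJump (opResolvent A) (α + β * I) x := by
  have h1 : (α : ℂ) + I * β = α + β * I := by ring
  have h2 : -(α : ℂ) + I * β = -conj ((α : ℂ) + β * I) := by
    rw [_root_.map_add, _root_.map_mul, conj_ofReal, conj_ofReal, conj_I]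
    ring
  rw [resolventJump, h1, h2]
  rfl

theorem tendsto_add_ofReal_nhdsWithin_re_ne_zero {z : ℂ} (hz : z.re = 0) :
    Tendsto (fun η : ℝ => z + η) (𝓝[>] 0) (𝓝[{z | z.re ≠ 0}] z) := by
  refine tendsto_nhdsWithin_iff.2 ⟨?_, ?_⟩
  · have : Tendsto (fun η : ℝ => z + η) (𝓝 0) (𝓝 (z + (0 : ℝ))) :=
      Continuous.tendsto (by fun_prop) 0
    rw [ofReal_zero, add_zero] at this
    exact this.mono_left nhdsWithin_le_nhds
  · filter_upwards [self_mem_nhdsWithin] with η (hη : 0 < η)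
    simpa [hz] using hη.ne'

open Classical in
/-- The local resolvent `z ↦ R(z, A) x` off the imaginary axis, continued by its limits to
the axis; its values at points of the axis where there is no limit are irrelevant. -/
noncomputable def continuedResolvent (A : X →ₗ.[ℂ] X) (x : X) (z : ℂ) : X :=
  if z.re ≠ 0 then opResolvent A z x
  else limUnder (𝓝[{z | z.re ≠ 0}] z) fun μ => opResolvent A μ x

theorem continuedResolvent_of_re_ne_zero {A : X →ₗ.[ℂ] X} {x : X} {z : ℂ} (hz : z.re ≠ 0) :
    continuedResolvent A x z = opResolvent A z x := if_pos hz

theorem mirrorJump_continuedResolvent {A : X →ₗ.[ℂ] X} {x : X} {α : ℝ} (hα : 0 < α) (y : ℝ) :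
    mirrorJump (continuedResolvent A x) (α + y * I) =
      mirrorJump (opResolvent A) (α + y * I) x := by
  rw [mirrorJump, continuedResolvent_of_re_ne_zero (by simpa using hα.ne'),
    continuedResolvent_of_re_ne_zero (by simpa using hα.ne')]
  rfl

theorem ContinuousAt.tendsto_opResolvent {A : X →ₗ.[ℂ] X} {x : X} {g : ℂ → X} {z : ℂ}
    (hg : ContinuousAt g z) (hgA : ∀ᶠ μ in 𝓝 z, μ.re ≠ 0 → g μ = opResolvent A μ x) :
    Tendsto (fun μ => opResolvent A μ x) (𝓝[{z | z.re ≠ 0}] z) (𝓝 (g z)) :=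
  (hg.tendsto.mono_left nhdsWithin_le_nhds).congr'
    (by filter_upwards [nhdsWithin_le_nhds hgA, self_mem_nhdsWithin] with μ h1 h2 using h1 h2)

theorem ContinuousAt.continuedResolvent_eq {A : X →ₗ.[ℂ] X} {x : X} {g : ℂ → X} {z : ℂ}
    (hg : ContinuousAt g z) (hgA : ∀ᶠ μ in 𝓝 z, μ.re ≠ 0 → g μ = opResolvent A μ x) :
    continuedResolvent A x z = g z := by
  by_cases hz : z.re = 0
  · have : (𝓝[{z | z.re ≠ 0}] z).NeBot := (tendsto_add_ofReal_nhdsWithin_re_ne_zero hz).neBot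
    rw [continuedResolvent, if_neg (not_not.2 hz)]
    exact (hg.tendsto_opResolvent hgA).limUnder_eq
  · rw [continuedResolvent_of_re_ne_zero hz, hgA.self_of_nhds hz]

namespace HasResolventGrowth

variable {A : X →ₗ.[ℂ] X} {κ : ℝ → ℝ} (h : HasResolventGrowth A κ)
include h

/-- No growth bound is needed: by the resolvent identity,
`‖R(μ) x‖ ≤ 2 ‖R(z) x‖` as soon as `‖μ - z‖ ‖R(z)‖ ≤ 1 / 2`. -/
theorem continuousAt_opResolvent (x : X) {z : ℂ} (hz : z.re ≠ 0) :
    ContinuousAt (fun μ => opResolvent A μ x) z := by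
  refine tendsto_iff_norm_sub_tendsto_zero.2 ?_
  set n := ‖opResolvent A z‖ with hn
  have hlim (c : ℝ) : Tendsto (fun μ : ℂ => ‖μ - z‖ * c) (𝓝 z) (𝓝 0) := by
    have : Tendsto (fun μ : ℂ => ‖μ - z‖ * c) (𝓝 z) (𝓝 (‖z - z‖ * c)) :=
      Continuous.tendsto (by fun_prop) z
    simpa using this
  refine squeeze_zero' (.of_forall fun _ => norm_nonneg _) ?_
    (hlim (n * (2 * ‖opResolvent A z x‖)))
  have hre : ∀ᶠ μ : ℂ in 𝓝 z, μ.re ≠ 0 := continuous_re.continuousAt.eventually_ne hz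
  filter_upwards [hre, (hlim n).eventually_lt_const one_half_pos] with μ hμ h2
  have h1 : ‖opResolvent A μ x - opResolvent A z x‖ ≤ ‖μ - z‖ * n * ‖opResolvent A μ x‖ := by
    rw [norm_sub_rev, h.resolvent_sub hz hμ, norm_smul, mul_assoc]
    gcongr
    exact (opResolvent A z).le_opNorm _
  have h3 : ‖opResolvent A μ x‖ ≤ 2 * ‖opResolvent A z x‖ := by
    have h4 := norm_sub_norm_le (opResolvent A μ x) (opResolvent A z x)
    have h5 : ‖μ - z‖ * n * ‖opResolvent A μ x‖ ≤ 1 / 2 * ‖opResolvent A μ x‖ := by gcongr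
    linarith
  refine h1.trans ?_
  rw [mul_assoc]
  gcongr

theorem differentiableAt_opResolvent (x : X) {z : ℂ} (hz : z.re ≠ 0) :
    DifferentiableAt ℂ (fun μ => opResolvent A μ x) z := by
  have hlim : Tendsto (fun μ => -opResolvent A z (opResolvent A μ x)) (𝓝[≠] z)
      (𝓝 (-opResolvent A z (opResolvent A z x))) :=
    ((((opResolvent A z).continuous.tendsto _).comp
      (h.continuousAt_opResolvent x hz)).neg).mono_left nhdsWithin_le_nhds
  refine (hasDerivAt_iff_tendsto_slope.2 (hlim.congr' ?_)).differentiableAt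
  have hre : ∀ᶠ μ : ℂ in 𝓝 z, μ.re ≠ 0 := continuous_re.continuousAt.eventually_ne hz
  filter_upwards [nhdsWithin_le_nhds hre, self_mem_nhdsWithin] with μ hμ (hne : μ ≠ z)
  rw [slope_def_module, ← neg_sub (opResolvent A z x), h.resolvent_sub hz hμ, smul_neg,
    inv_smul_smul₀ (sub_ne_zero.2 hne)]

theorem mem_opResolventSet {z : ℂ} (hz : z.re ≠ 0) : z ∈ opResolventSet A :=
  ⟨_, h.isResolventAt z hz⟩

/-- The local spectrum is detected by the resolvent off the imaginary axis alone, since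
a continuous extension of the local resolvent to a point of `ρ(A)` has the right value there. -/
theorem notMem_localSpectrum [CompleteSpace X] {x : X} {U : Set ℂ} (hU : IsOpen U) {z : ℂ}
    (hz : z ∈ U) {g : ℂ → X} (hg : DifferentiableOn ℂ g U)
    (hgA : ∀ μ ∈ U, μ.re ≠ 0 → g μ = opResolvent A μ x) : z ∉ localSpectrum A x := by
  rw [localSpectrum, Set.mem_compl_iff, not_not]
  refine ⟨U, hU, hz, g, hg.analyticOnNhd hU, fun w ⟨hwU, hwA⟩ => ?_⟩
  by_cases hw : w.re = 0
  swap
  · exact hgA w hwU hw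
  have hR := isResolventAt_opResolvent hwA
  have hgw : Tendsto (fun μ => opResolvent A μ x) (𝓝[{z | z.re ≠ 0}] w) (𝓝 (g w)) :=
    (hg.continuousOn.continuousAt (hU.mem_nhds hwU)).tendsto_opResolvent
      (by filter_upwards [hU.mem_nhds hwU] with μ hμ using hgA μ hμ)
  have : (𝓝[{z | z.re ≠ 0}] w).NeBot := (tendsto_add_ofReal_nhdsWithin_re_ne_zero hw).neBot
  have hμw : Tendsto (fun μ : ℂ => μ - w) (𝓝[{z | z.re ≠ 0}] w) (𝓝 0) := by
    have : Tendsto (fun μ : ℂ => μ - w) (𝓝 w) (𝓝 (w - w)) := Continuous.tendsto (by fun_prop) w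
    rw [sub_self] at this
    exact this.mono_left nhdsWithin_le_nhds
  have hlim := hgw.add (hμw.smul (((opResolvent A w).continuous.tendsto _).comp hgw))
  rw [zero_smul, add_zero] at hlim
  refine tendsto_nhds_unique hlim (tendsto_const_nhds.congr' ?_)
  filter_upwards [self_mem_nhdsWithin] with μ (hμ : μ.re ≠ 0)
  exact sub_eq_iff_eq_add'.1 (hR.sub_eq (h.isResolventAt μ hμ) x)

theorem notMem_localSpectrum_of_re_ne_zero [CompleteSpace X] (x : X) {z : ℂ} (hz : z.re ≠ 0) :
    z ∉ localSpectrum A x :=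
  h.notMem_localSpectrum (isOpen_ne.preimage continuous_re) hz
    (fun _ hμ => (h.differentiableAt_opResolvent x hμ).differentiableWithinAt) fun _ _ _ => rfl

/-- A local extension of the local resolvent, in the form of germs at all points near `z`. -/
theorem exists_extension_of_notMem_localSpectrum {x : X} {z : ℂ} (hz : z ∉ localSpectrum A x) :
    ∃ g : ℂ → X, DifferentiableAt ℂ g z ∧
      ∀ᶠ μ in 𝓝 z, ContinuousAt g μ ∧ ∀ᶠ ν in 𝓝 μ, ν.re ≠ 0 → g ν = opResolvent A ν x := by
  rw [localSpectrum, Set.mem_compl_iff, not_not] at hz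
  obtain ⟨U, hU, hzU, g, hg, hgA⟩ := hz
  refine ⟨g, (hg z hzU).differentiableAt, ?_⟩
  filter_upwards [hU.mem_nhds hzU] with μ hμ
  refine ⟨(hg μ hμ).continuousAt, ?_⟩
  filter_upwards [hU.mem_nhds hμ] with ν hν hν0
  exact hgA ν ⟨hν, h.mem_opResolventSet hν0⟩

theorem differentiableAt_continuedResolvent {x : X} {z : ℂ} (hz : z ∉ localSpectrum A x) :
    DifferentiableAt ℂ (continuedResolvent A x) z := by
  obtain ⟨g, hg, hgA⟩ := h.exists_extension_of_notMem_localSpectrum hz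
  refine hg.congr_of_eventuallyEq ?_
  filter_upwards [hgA] with μ hμ using hμ.1.continuedResolvent_eq hμ.2

theorem tendsto_mirrorJump_of_notMem_localSpectrum {x : X} {β : ℝ}
    (hβ : (β : ℂ) * I ∉ localSpectrum A x) :
    Tendsto (fun α : ℝ => mirrorJump (opResolvent A) (α + β * I) x) (𝓝[>] 0) (𝓝 0) := by
  obtain ⟨g, -, hgA⟩ := h.exists_extension_of_notMem_localSpectrum hβ
  obtain ⟨hg, hgA⟩ := hgA.self_of_nhds
  have hlim := hg.tendsto_opResolvent hgA
  have h1 : Tendsto (fun α : ℝ => (α : ℂ) + β * I) (𝓝[>] 0)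
      (𝓝[{z | z.re ≠ 0}] ((β : ℂ) * I)) := by
    simpa only [add_comm] using
      tendsto_add_ofReal_nhdsWithin_re_ne_zero (z := (β : ℂ) * I) (by simp)
  have h2 : Tendsto (fun α : ℝ => -conj ((α : ℂ) + β * I)) (𝓝[>] 0)
      (𝓝[{z | z.re ≠ 0}] ((β : ℂ) * I)) := by
    refine tendsto_nhdsWithin_iff.2 ⟨?_, ?_⟩
    · have : Tendsto (fun z => -conj z) (𝓝 ((β : ℂ) * I)) (𝓝 (-conj ((β : ℂ) * I))) :=
        Continuous.tendsto (by fun_prop) _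
      have e : -conj ((β : ℂ) * I) = β * I := by simp
      rw [e] at this
      exact this.comp (h1.mono_right nhdsWithin_le_nhds)
    · filter_upwards [self_mem_nhdsWithin] with α (hα : 0 < α)
      simpa using hα.ne'
  have h3 := (hlim.comp h1).sub (hlim.comp h2)
  rw [sub_self] at h3
  exact h3

theorem hasCubicGrowthOffAxis_continuedResolvent {C₀ : ℝ}
    (hκ : ∀ η : ℝ, 0 < η → η ≤ 1 → κ η ≤ C₀) (x : X) :
    HasCubicGrowthOffAxis (continuedResolvent A x) (C₀ * ‖x‖) := by
  have hb : ∀ z : ℂ, z.re ≠ 0 → |z.re| ≤ 1 → |z.re| ^ 3 * ‖opResolvent A z x‖ ≤ C₀ * ‖x‖ := by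
    intro z hz hz1
    have h0 : 0 < |z.re| := abs_pos.2 hz
    calc |z.re| ^ 3 * ‖opResolvent A z x‖
        ≤ |z.re| ^ 3 * (κ |z.re| / |z.re| ^ 3 * ‖x‖) := by
          gcongr
          exact (opResolvent A z).le_of_opNorm_le (h.norm_le z hz hz1) x
      _ = κ |z.re| * ‖x‖ := by field_simp
      _ ≤ C₀ * ‖x‖ := by gcongr; exact hκ _ h0 hz1
  refine ⟨fun z hz => ?_, fun z hz1 => ?_⟩
  · refine (h.differentiableAt_opResolvent x hz).congr_of_eventuallyEq ?_
    filter_upwards [continuous_re.continuousAt.eventually_ne hz] with μ hμ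
    exact continuedResolvent_of_re_ne_zero hμ
  · by_cases hz : z.re = 0
    · rw [hz, abs_zero, zero_pow three_ne_zero, zero_mul]
      refine le_trans (by positivity) (hb 1 (by simp) (by simp))
    · rw [continuedResolvent_of_re_ne_zero hz]
      exact hb z hz hz1

/-- Jumps that are pointwise bounded and weakly null off `F` force the local spectrum into `i F`:
otherwise the local resolvent would extend across a point of its own singular set. -/
theorem mem_spectralSubspace [CompleteSpace X] {C₀ : ℝ}
    (hκ : ∀ η : ℝ, 0 < η → η ≤ 1 → κ η ≤ C₀) {F : Set ℝ} (hF : IsClosed F) {x : X}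
    (hbd : ∀ y ∉ F, ∃ B : ℝ, ∀ α : ℝ, 0 < α → α ≤ 1 →
      ‖mirrorJump (opResolvent A) (α + y * I) x‖ ≤ B)
    (hφ : ∀ φ : X →L[ℂ] ℂ, ∀ y ∉ F,
      Tendsto (fun α : ℝ => φ (mirrorJump (opResolvent A) (α + y * I) x)) (𝓝[>] 0) (𝓝 0))
    (hx : ∀ y ∉ F, ∀ N : ℝ, 0 < N → Tendsto (fun η : ℝ =>
      κ η * ‖mirrorJump (opResolvent A) (((N * η : ℝ) : ℂ) + y * I) x‖) (𝓝[>] 0) (𝓝 0)) :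
    x ∈ spectralSubspace A F := by
  intro z hz
  have hz0 : z.re = 0 := by
    by_contra hz0
    exact h.notMem_localSpectrum_of_re_ne_zero x hz0 hz
  have hzI : z = I * (z.im : ℂ) := by
    apply Complex.ext <;> simp [hz0]
  refine ⟨z.im, ?_, hzI.symm⟩
  by_contra hzF
  obtain ⟨ε, hε, hball⟩ := Metric.isOpen_iff.1 hF.isOpen_compl z.im hzF
  -- a compact interval around the singular point, disjoint from `F`
  have hI : ∀ y : ℝ, z.im - ε / 2 ≤ y → y ≤ z.im + ε / 2 → y ∉ F := fun y h1 h2 =>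
    hball (by rw [Metric.mem_ball, Real.dist_eq, abs_lt]; constructor <;> linarith)
  have hK : IsClosed {y : ℝ | (y : ℂ) * I ∈ localSpectrum A x} :=
    (isClosed_localSpectrum A x).preimage (by fun_prop)
  obtain ⟨y, hyK, -, -, U, hU, hyU, g, hg, hgw⟩ := exists_extension_at_singular_point
    (h.hasCubicGrowthOffAxis_continuedResolvent hκ x) hK
    (a := z.im - ε / 2) (b := z.im + ε / 2)
    (fun y _ _ hy => h.differentiableAt_continuedResolvent hy)
    (fun y h1 h2 => by
      obtain ⟨B, hB⟩ := hbd y (hI y h1 h2)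
      exact ⟨B, fun α hα hα1 => by rw [mirrorJump_continuedResolvent hα]; exact hB α hα hα1⟩)
    (fun φ y h1 h2 => (hφ φ y (hI y h1 h2)).congr' (by
      filter_upwards [self_mem_nhdsWithin] with α hα
      rw [mirrorJump_continuedResolvent hα]))
    (fun y h1 h2 =>
      have := h.hasNoDoublePole hκ (hx y (hI y h1 h2))
        (fun z hz => continuedResolvent_of_re_ne_zero (x := x) hz)
      ⟨this 1, this (-1)⟩)
    ⟨z.im, by rwa [Set.mem_ofPred_eq, mul_comm, ← hzI], by linarith, by linarith⟩
  refine h.notMem_localSpectrum hU hyU hg (fun μ hμ hμ0 => ?_) hyK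
  rw [hgw μ hμ hμ0, continuedResolvent_of_re_ne_zero hμ0]

end HasResolventGrowth

end LocalSpectra

/-! ### Groups of polynomial growth -/

section PolynomialGrowth

open Complex ComplexConjugate

namespace C0Group

theorem resolventBound_anti {M a r s : ℝ} (hM : 0 ≤ M) (ha : 0 ≤ a) (hr : 0 < r) (hrs : r ≤ s) :
    resolventBound M a s ≤ resolventBound M a r := by
  have hΓ : 0 < Real.Gamma (a + 1) := Real.Gamma_pos_of_pos (by linarith)
  have hs : 0 < s := hr.trans_le hrs
  have h1 : 1 / s ≤ 1 / r := one_div_le_one_div_of_le hr hrs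
  unfold resolventBound
  gcongr

/-- The growth of the resolvent is cubic for `a = 2`, with a factor `r ^ (2 - a)` to spare for
`a < 2`. -/
theorem resolventBound_le {M a r : ℝ} (hM : 0 ≤ M) (ha : 0 ≤ a) (hr : 0 < r) (hr1 : r ≤ 1) :
    resolventBound M a r ≤ M * (1 + Real.Gamma (a + 1)) * r ^ (2 - a) / r ^ 3 := by
  have h1 : (1 / r) ^ (a + 1) = r ^ (2 - a) / r ^ 3 := by
    rw [one_div, Real.inv_rpow hr.le, ← Real.rpow_neg hr.le, ← Real.rpow_natCast,
      ← Real.rpow_sub hr]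
    congr 1
    push_cast
    ring
  have h2 : 1 / r ≤ (1 / r) ^ (a + 1) := by
    have : 1 ≤ 1 / r := by rwa [le_div_iff₀ hr, one_mul]
    simpa using Real.rpow_le_rpow_of_exponent_le this (show (1 : ℝ) ≤ a + 1 by linarith)
  rw [mul_div_assoc, ← h1, mul_assoc, resolventBound]
  gcongr
  linarith

variable {X : Type*} [NormedAddCommGroup X] [NormedSpace ℂ X] [CompleteSpace X] {S : C0Group X}
  {M a : ℝ} (ha : 0 ≤ a) (hS : ∀ t : ℝ, ‖S.T t‖ ≤ M * (1 + |t| ^ a))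
include ha hS

omit [CompleteSpace X] ha in
theorem bound_nonneg : 0 ≤ M :=
  nonneg_of_mul_nonneg_left ((norm_nonneg _).trans (hS 0)) (by positivity)

theorem norm_opResolvent_le {z : ℂ} (hz : z.re ≠ 0) :
    ‖opResolvent S.generator z‖ ≤ resolventBound M a |z.re| := by
  obtain ⟨R, hR, hn⟩ := S.exists_isResolventAt ha hS hz
  rwa [hR.opResolvent_eq]

theorem hasResolventGrowth : HasResolventGrowth S.generator
    fun η => M * (1 + Real.Gamma (a + 1)) * η ^ (2 - a) where
  isResolventAt z hz := by
    obtain ⟨R, hR, -⟩ := S.exists_isResolventAt ha hS hz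
    rwa [hR.opResolvent_eq]
  norm_le z hz hz1 := (norm_opResolvent_le ha hS hz).trans
    (resolventBound_le (bound_nonneg hS) ha (abs_pos.2 hz) hz1)

/-- Vanishing boundary values bound the jump near the axis, and the resolvent bound does so away
from it. -/
theorem exists_norm_mirrorJump_le {x : X} {β : ℝ}
    (hx : Tendsto (fun α : ℝ => mirrorJump (opResolvent S.generator) (α + β * I) x)
      (𝓝[>] 0) (𝓝 0)) :
    ∃ B : ℝ, ∀ α : ℝ, 0 < α → ‖mirrorJump (opResolvent S.generator) (α + β * I) x‖ ≤ B := by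
  have h1 := hx.norm.eventually_lt_const (u := 1) (by simp)
  obtain ⟨δ, hδ, h1⟩ := (mem_nhdsGT_iff_exists_Ioo_subset (a := (0 : ℝ))).1 h1
  have hδ : 0 < δ := hδ
  refine ⟨max 1 (2 * resolventBound M a δ * ‖x‖), fun α hα => ?_⟩
  rcases lt_or_ge α δ with h2 | h2
  · exact (le_of_lt (h1 ⟨hα, h2⟩)).trans (le_max_left _ _)
  refine le_trans ?_ (le_max_right _ _)
  have hR : ∀ z : ℂ, |z.re| = α → ‖opResolvent S.generator z‖ ≤ resolventBound M a δ := by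
    intro z hz
    refine (norm_opResolvent_le ha hS (abs_pos.1 (hz ▸ hα))).trans ?_
    rw [hz]
    exact resolventBound_anti (bound_nonneg hS) ha hδ h2
  refine ContinuousLinearMap.le_of_opNorm_le _ ?_ x
  rw [mirrorJump, two_mul]
  exact (norm_sub_le _ _).trans (add_le_add (hR _ (by simp [abs_of_pos hα]))
    (hR _ (by simp [abs_of_pos hα])))

end C0Group

end PolynomialGrowth

/-! ### Spectral subspaces and boundary values -/

open Complex in
theorem theorem1p5 {X : Type*} [NormedAddCommGroup X] [NormedSpace ℂ X] [CompleteSpace X]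
    (S : C0Group X) (M a : ℝ) (ha0 : 0 ≤ a) (ha2 : a ≤ 2)
    (hS : ∀ t : ℝ, ‖S.T t‖ ≤ M * (1 + |t| ^ a)) (F : Set ℝ) (hF : IsClosed F) :
    spectralSubspace S.generator F =
        {x : X | ∀ β : ℝ, β ∉ F →
          Tendsto (fun α : ℝ => resolventJump S.generator α β x) (𝓝[>] 0) (𝓝 0)} ∧
      (IsReflexiveSpace X → opPointSpectrum S.generator = ∅ → a < 2 →
        spectralSubspace S.generator F =
          {x : X | ∀ β : ℝ, β ∉ F →
            BddAbove ((fun α : ℝ => ‖resolventJump S.generator α β x‖) '' Set.Ioi 0)}) := by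
  simp only [resolventJump_apply]
  set A := S.generator
  have h := C0Group.hasResolventGrowth ha0 hS
  have hΓ : 0 < Real.Gamma (a + 1) := Real.Gamma_pos_of_pos (by linarith)
  have hM : 0 ≤ M := C0Group.bound_nonneg hS
  have hκ0 : ∀ η : ℝ, 0 < η → 0 ≤ M * (1 + Real.Gamma (a + 1)) * η ^ (2 - a) := fun η hη => by
    positivity
  have hκ : ∀ η : ℝ, 0 < η → η ≤ 1 →
      M * (1 + Real.Gamma (a + 1)) * η ^ (2 - a) ≤ M * (1 + Real.Gamma (a + 1)) :=
    fun η hη hη1 => mul_le_of_le_one_right (by positivity)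
      (Real.rpow_le_one hη.le hη1 (by linarith))
  have hvanish : ∀ x ∈ spectralSubspace A F, ∀ β ∉ F,
      Tendsto (fun α : ℝ => mirrorJump (opResolvent A) (α + β * I) x) (𝓝[>] 0) (𝓝 0) := by
    intro x hx β hβ
    refine h.tendsto_mirrorJump_of_notMem_localSpectrum fun hσ => hβ ?_
    obtain ⟨β', hβ', e⟩ := hx hσ
    have : β' = β := by simpa using congrArg Complex.im e
    rwa [← this]
  have hscale : ∀ N : ℝ, 0 < N → Tendsto (fun η : ℝ => N * η) (𝓝[>] 0) (𝓝[>] 0) := by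
    intro N hN
    refine tendsto_nhdsWithin_iff.2 ⟨?_, ?_⟩
    · have : Tendsto (fun η : ℝ => N * η) (𝓝 0) (𝓝 (N * 0)) := Continuous.tendsto (by fun_prop) 0
      rw [mul_zero] at this
      exact this.mono_left nhdsWithin_le_nhds
    · filter_upwards [self_mem_nhdsWithin] with η (hη : 0 < η) using mul_pos hN hη
  refine ⟨Set.Subset.antisymm hvanish fun x hx => ?_, fun hX hA ha2' =>
    Set.Subset.antisymm (fun x hx β hβ => ?_) fun x hx => ?_⟩
  · refine h.mem_spectralSubspace hκ hF (fun y hy => ?_) (fun φ y hy => ?_) fun y hy N hN => ?_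
    · obtain ⟨B, hB⟩ := C0Group.exists_norm_mirrorJump_le ha0 hS (hx y hy)
      exact ⟨B, fun α hα _ => hB α hα⟩
    · have h1 := (φ.continuous.tendsto _).comp (hx y hy)
      rw [φ.map_zero] at h1
      exact h1
    · have h1 : Tendsto (fun η : ℝ => M * (1 + Real.Gamma (a + 1)) *
          ‖mirrorJump (opResolvent A) (((N * η : ℝ) : ℂ) + y * I) x‖) (𝓝[>] 0) (𝓝 0) := by
        simpa using (((hx y hy).comp (hscale N hN)).norm).const_mul (M * (1 + Real.Gamma (a + 1)))
      refine squeeze_zero' ?_ ?_ h1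
      · filter_upwards [self_mem_nhdsWithin] with η hη
        exact mul_nonneg (hκ0 η hη) (norm_nonneg _)
      · filter_upwards [Ioo_mem_nhdsGT one_pos] with η hη
        exact mul_le_mul_of_nonneg_right (hκ η hη.1 hη.2.le) (norm_nonneg _)
  · obtain ⟨B, hB⟩ := C0Group.exists_norm_mirrorJump_le ha0 hS (hvanish x hx β hβ)
    exact ⟨B, Set.forall_mem_image.2 hB⟩
  · have hB : ∀ y ∉ F, ∃ B : ℝ, ∀ α : ℝ, 0 < α →
        ‖mirrorJump (opResolvent A) (α + y * I) x‖ ≤ B := fun y hy =>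
      ⟨(hx y hy).some, fun α hα => (hx y hy).some_mem (Set.mem_image_of_mem _ hα)⟩
    refine h.mem_spectralSubspace hκ hF (fun y hy => ?_) (fun φ y hy => ?_) fun y hy N hN => ?_
    · obtain ⟨B, hB⟩ := hB y hy
      exact ⟨B, fun α hα _ => hB α hα⟩
    · obtain ⟨B, hB⟩ := hB y hy
      exact h.tendsto_weakly_zero hX hA hB φ
    · obtain ⟨B, hB⟩ := hB y hy
      have h1 : Tendsto (fun η : ℝ => M * (1 + Real.Gamma (a + 1)) * η ^ (2 - a) * B)
          (𝓝[>] 0) (𝓝 0) := by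
        have h2 : Tendsto (fun η : ℝ => η ^ (2 - a)) (𝓝 0) (𝓝 ((0 : ℝ) ^ (2 - a))) :=
          (Real.continuous_rpow_const (by linarith)).tendsto 0
        rw [Real.zero_rpow (by linarith)] at h2
        simpa using ((h2.mono_left nhdsWithin_le_nhds).const_mul
          (M * (1 + Real.Gamma (a + 1)))).mul_const B
      refine squeeze_zero' ?_ ?_ h1
      · filter_upwards [self_mem_nhdsWithin] with η hη
        exact mul_nonneg (hκ0 η hη) (norm_nonneg _)
      · filter_upwards [self_mem_nhdsWithin] with η (hη : 0 < η)
        have := hκ0 η hη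
        gcongr
        exact hB _ (mul_pos hN hη)
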